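/- Let $'=\frac{1}{2\pi i}\frac{d}{d\tau}$, $q=e^{2\pi i\tau}$, let $E_2,E_4,E_6$ be the normalized Eisenstein series of level one, $\eta$ the Dedekind eta function, and $\theta_2=\sum_{n\in\mathbb Z}q^{(n+1/2)^2/2}$, $\theta_3=\sum_{n\in\mathbb Z}q^{n^2/2}$, $\theta_0=\sum_{n\in\mathbb Z}(-1)^nq^{n^2/2}$. For $x,y\in\mathbb C$ let $S(x,y)$ be the space of holomorphic functions $f$ on the upper half plane with $$f'''-\tfrac12E_2f''+\bigl(\tfrac12E_2'+xE_4\bigr)f'+yE_6f=0,$$ whose indicial roots are the roots (with multiplicity) of $t^3-\tfrac12t^2+xt+y$. For $n\in\mathbb N$ put $x_n=-(6n^2-9n+4)/6$ and $y_n=x_n/3+5/54$. (a) $E_4/\eta^8=q^{-1/3}(1+248q+\cdots)$, and $E_4/\eta^8\in S(x,x/3+5/54)$ for every $x\in\mathbb C$. (b) Let $f_0\in S(x,y)$ have a convergent expansion $f_0=q^{-1/3}(1+248q+\cdots)$. Then $y=x/3+5/54$, and the indicial roots are $-1/3$ and $\bigl(5\pm\sqrt{3(-48x-5)}\bigr)/12$.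 If $f_0\neq E_4/\eta^8$, then there is an integer $n\ge2$ with $x=x_n$, and the indicial roots are $7/6-n$, $-1/3$, $n-1/3$; in particular the last two differ by the integer $n$. (c) Let $n\ge1$ be an integer. The equation with parameters $(x_n,y_n)$ has indicial roots $7/6-n,\,-1/3,\,n-1/3$ and exactly one solution of the form $f_3=q^{7/6-n}(1+b_1q+b_2q^2+\cdots)$. Its second coefficient is $$b_1=-\frac{4(6n-7)(40n^2-30n+17)}{(2n-5)(4n-5)},$$ and $b_1$ is a non-negative integer if and only if $n\in\{1,2\}$. (d) Let $L_{D_l,1}$ be the affine vertex operator algebra of type $D_l$ and level one, realized as the lattice vertex operator algebra $V_L$ of the root lattice $L=D_l$; its simple modules are $V_{\gamma+L}=S(\mathfrak h\otimes t^{-1}\mathbb C[t^{-1}])\otimes\mathbb C[\gamma+L]$ with $\gamma$ in the dual lattice of $L$, where $h_{i_1}(-n_1)\cdots h_{i_r}(-n_r)e^{\alpha}$ has weight $n_1+\dots+n_r+\langle\alpha,\alpha\rangle/2$, and the character of $V_{\gamma+L}$ is $\sum_\Delta\dim(V_{\gamma+L})_\Delta\,q^{\Delta-l/24}$. For $l=8$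 and $l=20$ the set of characters of the simple modules is $\bigl\{\frac{\theta_3^l+\theta_0^l}{2\eta^l},\frac{\theta_3^l-\theta_0^l}{2\eta^l},\frac{\theta_2^l}{2\eta^l}\bigr\}$. For $n=1$, $S(x_1,y_1)$ is the space spanned by the characters of $L_{D_8,1}$, and it has the basis $\frac{E_4}{\eta^8},\ \frac{\theta_3^8-\theta_0^8}{2\eta^8},\ \frac{\theta_2^8}{2\eta^8}$. For $n=2$, $S(x_2,y_2)$ is the space spanned by the characters of $L_{D_{20},1}$, and it has the basis $\frac{\theta_3^{20}+\theta_0^{20}}{2\eta^{20}},\ \frac{\theta_3^{20}-\theta_0^{20}}{2\eta^{20}},\ \frac{\theta_2^{20}}{2\eta^{20}}$. -/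

import Mathlib

noncomputable section

namespace ThirdOrderMLDE

open UpperHalfPlane hiding I
open scoped Manifold
open Complex

/-- `q ^ r = exp (2 π i r τ)`. -/
def qpow (τ : ℍ) (r : ℂ) : ℂ := cexp (2 * Real.pi * I * r * τ)

/-- `f` has the (convergent) expansion `f = q ^ r * (a 0 + a 1 * q + a 2 * q ^ 2 + ⋯)` on `ℍ`. -/
def HasQExpansion (f : ℍ → ℂ) (r : ℂ) (a : ℕ → ℂ) : Prop :=
  ∀ τ : ℍ, HasSum (fun k : ℕ => a k * qpow τ (r + k)) (f τ)

/-- The differential operator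
`f ↦ f''' - (1/2) E₂ f'' + ((1/2) E₂' + x E₄) f' + y E₆ f`, where `' = (2 π i)⁻¹ d/dτ`. -/
def mldeOp (x y : ℂ) (f : ℍ → ℂ) (τ : ℍ) : ℂ :=
  let D := Derivative.normalizedDerivOfComplex
  D (D (D f)) τ - 1 / 2 * EisensteinSeries.E2 τ * D (D f) τ
    + (1 / 2 * D EisensteinSeries.E2 τ + x * ModularForm.E₄ τ) * D f τ
    + y * ModularForm.E₆ τ * f τ

/-- The space of all holomorphic solutions on `ℍ` of the third order modular linear differential
equation with parameters `x`, `y`. -/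
def solutionSpace (x y : ℂ) : Submodule ℂ (ℍ → ℂ) where
  carrier := {f | MDifferentiable 𝓘(ℂ) 𝓘(ℂ) f ∧ ∀ τ, mldeOp x y f τ = 0}
  zero_mem' := by
    have h : Derivative.normalizedDerivOfComplex (0 : ℍ → ℂ) = 0 :=
      Derivative.normalizedDerivOfComplex_const 0
    exact ⟨mdifferentiable_const, fun τ => by simp [mldeOp, h]⟩
  add_mem' := by
    rintro f g ⟨hf, hf0⟩ ⟨hg, hg0⟩
    have hf1 := Derivative.normalizedDerivOfComplex_mdifferentiable hf
    have hg1 := Derivative.normalizedDerivOfComplex_mdifferentiable hg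
    have hf2 := Derivative.normalizedDerivOfComplex_mdifferentiable hf1
    have hg2 := Derivative.normalizedDerivOfComplex_mdifferentiable hg1
    refine ⟨hf.add hg, fun τ => ?_⟩
    have e1 := hf0 τ
    have e2 := hg0 τ
    simp only [mldeOp] at e1 e2 ⊢
    rw [Derivative.normalizedDerivOfComplex_add f g hf hg,
      Derivative.normalizedDerivOfComplex_add _ _ hf1 hg1,
      Derivative.normalizedDerivOfComplex_add _ _ hf2 hg2]
    simp only [Pi.add_apply]
    linear_combination e1 + e2
  smul_mem' := by
    rintro c f ⟨hf, hf0⟩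
    have hf1 := Derivative.normalizedDerivOfComplex_mdifferentiable hf
    have hf2 := Derivative.normalizedDerivOfComplex_mdifferentiable hf1
    refine ⟨hf.const_smul c, fun τ => ?_⟩
    have e1 := hf0 τ
    simp only [mldeOp] at e1 ⊢
    rw [Derivative.normalizedDerivOfComplex_smul c f hf,
      Derivative.normalizedDerivOfComplex_smul c _ hf1,
      Derivative.normalizedDerivOfComplex_smul c _ hf2]
    simp only [Pi.smul_apply, smul_eq_mul]
    linear_combination c * e1

/-- The indicial polynomial at `q = 0`: since `E₂, E₄, E₆ → 1` and `E₂' → 0` as `q → 0`,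
the leading coefficient of the operator applied to `q ^ t` is `t³ - t²/2 + x t + y`. -/
def indicialPoly (x y : ℂ) : Polynomial ℂ :=
  Polynomial.X ^ 3 - Polynomial.C (1 / 2) * Polynomial.X ^ 2
    + Polynomial.C x * Polynomial.X + Polynomial.C y

/-- The function `E₄ / η ^ 8`. -/
def e4OverEta8 (τ : ℍ) : ℂ := ModularForm.E₄ τ / ModularForm.eta τ ^ 8

/-- `θ₂ = ∑ q ^ ((n + 1/2)² / 2)`. -/
def theta2 (τ : ℍ) : ℂ := ∑' n : ℤ, qpow τ (((n : ℂ) + 1 / 2) ^ 2 / 2)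

/-- `θ₃ = ∑ q ^ (n² / 2)`. -/
def theta3 (τ : ℍ) : ℂ := ∑' n : ℤ, qpow τ ((n : ℂ) ^ 2 / 2)

/-- `θ₀ = ∑ (-1) ^ n q ^ (n² / 2)`. -/
def theta0 (τ : ℍ) : ℂ := ∑' n : ℤ, (-1 : ℂ) ^ n * qpow τ ((n : ℂ) ^ 2 / 2)

/-- `(θ₃ ^ l + θ₀ ^ l) / (2 η ^ l)`. -/
def thetaVac (l : ℕ) (τ : ℍ) : ℂ :=
  (theta3 τ ^ l + theta0 τ ^ l) / (2 * ModularForm.eta τ ^ l)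

/-- `(θ₃ ^ l - θ₀ ^ l) / (2 η ^ l)`. -/
def thetaVec (l : ℕ) (τ : ℍ) : ℂ :=
  (theta3 τ ^ l - theta0 τ ^ l) / (2 * ModularForm.eta τ ^ l)

/-- `θ₂ ^ l / (2 η ^ l)`. -/
def thetaSpin (l : ℕ) (τ : ℍ) : ℂ := theta2 τ ^ l / (2 * ModularForm.eta τ ^ l)

/-! ### Characters of the level one affine vertex operator algebra of type `D_l`

`L_{D_l,1}` is the lattice vertex operator algebra `V_L` of the root lattice `L = D_l`
(Frenkel--Kac), and its simple modules are the spaces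
`V_{γ+L} = S(𝔥 ⊗ t⁻¹ℂ[t⁻¹]) ⊗ ℂ[γ + L]` for `γ` in the dual lattice, graded by the eigenvalues of
`L(0)`: the vector `h_{i₁}(-n₁) ⋯ h_{iᵣ}(-nᵣ) e^α` has weight `n₁ + ⋯ + nᵣ + ⟨α, α⟩ / 2`. -/

/-- The root lattice `D_l`: integer vectors with even coordinate sum. -/
def rootLattice (l : ℕ) : Set (Fin l → ℚ) :=
  {v | (∀ i, ∃ z : ℤ, v i = z) ∧ ∃ m : ℤ, ∑ i, v i = 2 * m}

/-- The dual lattice of `D_l`. -/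
def dualLattice (l : ℕ) : Set (Fin l → ℚ) :=
  {v | ∀ u ∈ rootLattice l, ∃ z : ℤ, v ⬝ᵥ u = z}

/-- The coset `γ + D_l`. -/
abbrev Coset (l : ℕ) (γ : Fin l → ℚ) : Type := {α : Fin l → ℚ // α - γ ∈ rootLattice l}

/-- The module `V_{γ+L} = S(𝔥 ⊗ t⁻¹ℂ[t⁻¹]) ⊗ ℂ[γ + L]`; the variable indexed by `(i, k)` is the
oscillator `h_i(-(k+1))`, where `h_1, …, h_l` is an orthonormal basis of `𝔥`. -/
abbrev LatticeModule (l : ℕ) (γ : Fin l → ℚ) : Type :=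
  Coset l γ →₀ MvPolynomial (Fin l × ℕ) ℂ

/-- The `L(0)`-weight of the basis vector (oscillator monomial `m`) `⊗ e^α`. -/
def basisWeight (l : ℕ) (m : Fin l × ℕ →₀ ℕ) (α : Fin l → ℚ) : ℚ :=
  (m.sum fun p e => (e : ℚ) * ((p.2 : ℚ) + 1)) + α ⬝ᵥ α / 2

/-- The subspace of `V_{γ+L}` of `L(0)`-weight `Δ`. -/
def weightSpace (l : ℕ) (γ : Fin l → ℚ) (Δ : ℚ) : Submodule ℂ (LatticeModule l γ) where
  carrier := {u | ∀ α m, MvPolynomial.coeff m (u α) ≠ 0 → basisWeight l m α.1 = Δ}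
  zero_mem' := by
    intro α m h
    simp at h
  add_mem' := by
    intro u v hu hv α m h
    by_cases h0 : MvPolynomial.coeff m (u α) = 0
    · refine hv α m fun h1 => h ?_
      simp [h0, h1]
    · exact hu α m h0
  smul_mem' := by
    intro c u hu α m h
    refine hu α m fun h1 => h ?_
    simp [h1]

/-- The character `tr q ^ (L(0) - l/24) = ∑ dim (V_{γ+L})_Δ q ^ (Δ - l/24)` of `V_{γ+L}`
(the central charge is `l`). -/
def character (l : ℕ) (γ : Fin l → ℚ) (τ : ℍ) : ℂ :=
  ∑' Δ : ℚ, (Module.finrank ℂ (weightSpace l γ Δ) : ℂ) * qpow τ ((Δ : ℂ) - (l : ℂ) / 24)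

/-- The space spanned by the characters of all simple modules of `L_{D_l,1} = V_{D_l}`. -/
def characterSpace (l : ℕ) : Submodule ℂ (ℍ → ℂ) :=
  Submodule.span ℂ (character l '' dualLattice l)

/-- `x = -(6n² - 9n + 4)/6`. -/
def xParam (n : ℕ) : ℂ := -(6 * (n : ℂ) ^ 2 - 9 * n + 4) / 6

/-- `y = x/3 + 5/54`. -/
def yParam (x : ℂ) : ℂ := x / 3 + 5 / 54

end ThirdOrderMLDE

end

noncomputable section

namespace ThirdOrderMLDE

open UpperHalfPlane hiding I
open scoped Manifold Topology Derivative MatrixGroups ModularForm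
open Complex Filter
open Finset.HasAntidiagonal (antidiagonal mem_antidiagonal)

/-! ### Calculus of `q`-expansions -/

/-! The coefficients of the equation are power series in q, so a series q^r (a_0 + a_1 q + ⋯) solves
it exactly when P(r+k) a_k plus a combination of the earlier a_j vanishes for every k, with P the
indicial polynomial (`mem_solutionSpace_iff_isFrobenius`). Every assertion about expansions is read
off this recursion. A solution with a_0 ≠ 0 and r = -1/3 forces P(-1/3) = 0, which determines y. If
f₀ differs from E₄/η⁸, the first nonzero coefficient of the difference sits at some n ≥ 2 and
survives only if P(n - 1/3) = n (x - x_n) vanishes. At x = x_n the root 7/6 - n differs from the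
other two by half-integers, so the recursion starting there never degenerates; its solution
converges by a majorant argument (`IsFrobenius.exists_solution`), and the step k = 1 gives b_1,
which is negative for n ≥ 3.

The explicit solutions rest on one principle: a holomorphic level one form of weight below 12
vanishing at i∞ is zero (`eq_zero_of_levelOne`). It yields Ramanujan's formulas for E₂', E₄', E₆',
Jacobi's identity, E₄ and E₆ as polynomials in θ₂⁴ and θ₀⁴, and the logarithmic derivatives of the
theta functions (`thetaDefect_eq_zero`). After that, membership in a solution space is a polynomial
identity. A solution is determined by three initial values at a point, so the space has dimension at
most 3, and three solutions with distinct leading exponents at i∞ form a basis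
(`solutionSpace_eq_span`).

A character is a sum over the monomial basis of the lattice module. It factors into the oscillator
sum, which together with q^(-l/24) is η^(-l), and the theta series of a coset of D_l. Such a coset
is cut out of a shifted copy of ℤ^l by the parity of the coordinate sum, and averaging with a sign
(`hasSum_coset`) produces (θ₃^l ± θ₀^l)/2 or θ₂^l/2. -/

lemma qpow_add (τ : ℍ) (r s : ℂ) : qpow τ (r + s) = qpow τ r * qpow τ s := by
  simp only [qpow, ← Complex.exp_add]
  ring_nf

lemma qpow_zero (τ : ℍ) : qpow τ 0 = 1 := by simp [qpow]

lemma qpow_ne_zero (τ : ℍ) (r : ℂ) : qpow τ r ≠ 0 := Complex.exp_ne_zero _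

lemma qpow_nat_mul (τ : ℍ) (k : ℕ) (r : ℂ) : qpow τ (k * r) = qpow τ r ^ k := by
  simp only [qpow, ← Complex.exp_nat_mul]
  ring_nf

lemma qpow_natCast (τ : ℍ) (k : ℕ) : qpow τ k = qpow τ 1 ^ k := by
  rw [← qpow_nat_mul, mul_one]

lemma qpow_neg (τ : ℍ) (r : ℂ) : qpow τ (-r) = (qpow τ r)⁻¹ := by
  exact eq_inv_of_mul_eq_one_left (by rw [← qpow_add, neg_add_cancel, qpow_zero])

lemma qpow_one_eq_qParam (τ : ℍ) : qpow τ 1 = Function.Periodic.qParam 1 τ := by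
  simp [qpow, Function.Periodic.qParam]

lemma norm_qpow_one_lt (τ : ℍ) : ‖qpow τ 1‖ < 1 := by
  rw [qpow_one_eq_qParam]
  exact_mod_cast UpperHalfPlane.norm_qParam_lt_one 1 τ

lemma norm_qpow_ofReal (τ : ℍ) (r : ℝ) : ‖qpow τ r‖ = Real.exp (-2 * Real.pi * r * τ.im) := by
  rw [qpow, Complex.norm_exp]
  congr 1
  simp

lemma exists_qpow_one_eq {z : ℂ} (hz : ‖z‖ < 1) (hz0 : z ≠ 0) : ∃ τ : ℍ, qpow τ 1 = z := by
  refine ⟨⟨Function.Periodic.invQParam 1 z,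
    Function.Periodic.im_invQParam_pos_of_norm_lt_one one_pos hz hz0⟩, ?_⟩
  rw [qpow_one_eq_qParam]
  exact Function.Periodic.qParam_right_inv one_ne_zero hz0

lemma mdifferentiable_qpow (r : ℂ) : MDiff (fun τ : ℍ => qpow τ r) := by
  rw [UpperHalfPlane.mdifferentiable_iff]
  have h : DifferentiableOn ℂ (fun w : ℂ => cexp (2 * Real.pi * I * r * w)) upperHalfPlaneSet := by
    fun_prop
  refine h.congr fun w hw => ?_
  simp [qpow, ofComplex_apply_of_im_pos hw]

/-- The normalized derivative computed from a derivative of a function on `ℂ` that agrees with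
the given one on `ℍ`. -/
lemma normalizedDeriv_of_hasDerivAt {f : ℍ → ℂ} {g : ℂ → ℂ} {g' : ℂ} {τ : ℍ}
    (h : ∀ w : ℍ, f w = g w) (hg : HasDerivAt g g' τ) :
    Derivative.normalizedDerivOfComplex f τ = (2 * Real.pi * I)⁻¹ * g' := by
  rw [Derivative.normalizedDerivOfComplex]
  congr 1
  refine (hg.congr_of_eventuallyEq ?_).deriv
  filter_upwards [isOpen_upperHalfPlaneSet.mem_nhds τ.im_pos] with w hw
  simpa [ofComplex_apply_of_im_pos hw] using h ⟨w, hw⟩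

lemma normalizedDeriv_qpow (r : ℂ) (τ : ℍ) : D (fun τ : ℍ => qpow τ r) τ = r * qpow τ r := by
  have h : HasDerivAt (fun w : ℂ => cexp (2 * Real.pi * I * r * w))
      (cexp (2 * Real.pi * I * r * τ) * (2 * Real.pi * I * r)) (τ : ℂ) := by
    have := ((hasDerivAt_id (τ : ℂ)).const_mul (2 * Real.pi * I * r)).cexp
    simpa using this
  rw [normalizedDeriv_of_hasDerivAt (f := fun τ : ℍ => qpow τ r)
    (g := fun w : ℂ => cexp (2 * Real.pi * I * r * w)) (fun w => rfl) h, qpow]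
  have : (2 * Real.pi * I : ℂ) ≠ 0 := two_pi_I_ne_zero
  field_simp

/-- Removing the factor q^r leaves an ordinary power series in q, to which disc-based analysis
applies even when r is not an integer. -/
lemma hasQExpansion_iff {f : ℍ → ℂ} {r : ℂ} {a : ℕ → ℂ} : HasQExpansion f r a ↔
    ∀ τ, HasSum (fun k => a k * qpow τ 1 ^ k) (qpow τ (-r) * f τ) := by
  refine forall_congr' fun τ => ?_
  rw [← hasSum_mul_left_iff (qpow_ne_zero τ (-r))]
  refine iff_of_eq (congrArg (HasSum · _) (funext fun k => ?_))
  rw [mul_left_comm, ← qpow_add, neg_add_cancel_left, qpow_natCast]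

/-- Since q maps ℍ onto the punctured unit disc, convergence at every τ is convergence on the whole
open disc. -/
lemma HasQExpansion.summable {f : ℍ → ℂ} {r : ℂ} {a : ℕ → ℂ} (h : HasQExpansion f r a) {z : ℂ}
    (hz : ‖z‖ < 1) : Summable fun k => a k * z ^ k := by
  rcases eq_or_ne z 0 with rfl | hz0
  · refine summable_of_ne_finset_zero (s := {0}) fun k hk => ?_
    simp [zero_pow (by simpa using hk : k ≠ 0)]
  · obtain ⟨τ, rfl⟩ := exists_qpow_one_eq hz hz0
    exact (hasQExpansion_iff.1 h τ).summable

lemma HasQExpansion.summable_norm {f : ℍ → ℂ} {r : ℂ} {a : ℕ → ℂ} (h : HasQExpansion f r a)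
    {ρ : ℝ} (h0 : 0 ≤ ρ) (h1 : ρ < 1) : Summable fun k => ‖a k‖ * ρ ^ k := by
  have := (h.summable (z := ρ) (by simpa [abs_of_nonneg h0] using h1)).norm
  simpa [abs_of_nonneg h0] using this

lemma HasQExpansion.add {f g : ℍ → ℂ} {r : ℂ} {a b : ℕ → ℂ} (hf : HasQExpansion f r a)
    (hg : HasQExpansion g r b) : HasQExpansion (f + g) r (a + b) := fun τ => by
  simpa [add_mul] using (hf τ).add (hg τ)

lemma HasQExpansion.sub {f g : ℍ → ℂ} {r : ℂ} {a b : ℕ → ℂ} (hf : HasQExpansion f r a)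
    (hg : HasQExpansion g r b) : HasQExpansion (f - g) r (a - b) := fun τ => by
  simpa [sub_mul] using (hf τ).sub (hg τ)

lemma HasQExpansion.smul {f : ℍ → ℂ} {r : ℂ} {a : ℕ → ℂ} (c : ℂ) (hf : HasQExpansion f r a) :
    HasQExpansion (c • f) r (c • a) := fun τ => by
  simpa [mul_assoc] using (hf τ).mul_left c

/-- Cauchy product. Exponent 0 on the left suffices because that factor is always a coefficient of
the equation. -/
lemma HasQExpansion.mul {f g : ℍ → ℂ} {r : ℂ} {a b : ℕ → ℂ} (hf : HasQExpansion f 0 a)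
    (hg : HasQExpansion g r b) :
    HasQExpansion (f * g) r (fun k => ∑ p ∈ antidiagonal k, a p.1 * b p.2) := by
  rw [hasQExpansion_iff] at hf hg ⊢
  intro τ
  have h1 := (hf τ).summable.norm
  have h2 := (hg τ).summable.norm
  have h3 := (summable_norm_sum_mul_antidiagonal_of_summable_norm h1 h2).of_norm.hasSum
  rw [← tsum_mul_tsum_eq_tsum_sum_antidiagonal_of_summable_norm h1 h2, (hf τ).tsum_eq,
    (hg τ).tsum_eq] at h3
  convert! h3 using 1
  · funext k
    rw [Finset.sum_mul]
    refine Finset.sum_congr rfl fun p hp => ?_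
    rw [← mem_antidiagonal.1 hp, pow_add]
    ring
  · simp only [neg_zero, qpow_zero, Pi.mul_apply]
    ring

/-- Weierstrass's theorem on half planes bounded away from the real axis, where the series is
dominated by its values at a fixed radius below 1; the factor q^r is handled by the product rule. -/
lemma HasQExpansion.mdifferentiable_and_deriv {f : ℍ → ℂ} {r : ℂ} {a : ℕ → ℂ}
    (hf : HasQExpansion f r a) : MDiff f ∧ HasQExpansion (D f) r (fun k => (r + k) * a k) := by
  set F : ℕ → ℂ → ℂ := fun k w => a k * cexp (2 * Real.pi * I * w) ^ k with hF
  set G : ℂ → ℂ := fun w => ∑' k, F k w with hG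
  have key (τ : ℍ) : DifferentiableAt ℂ G τ ∧
      HasSum (fun k => deriv (F k) τ) (deriv G τ) := by
    -- On the half plane above height y, the modulus of q is at most ρ < 1, and τ lies in its
    -- interior.
    set y : ℝ := τ.im / 2
    have hy : 0 < y := half_pos τ.im_pos
    set ρ : ℝ := Real.exp (-2 * Real.pi * y)
    have hρ : ρ < 1 := by
      rw [Real.exp_lt_one_iff]
      have := mul_pos Real.pi_pos hy
      linarith
    have hu := hf.summable_norm (Real.exp_pos _).le hρ
    have hU : IsOpen {w : ℂ | y < w.im} := isOpen_lt continuous_const Complex.continuous_im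
    have hτ : (τ : ℂ) ∈ {w : ℂ | y < w.im} := half_lt_self τ.im_pos
    have hd : ∀ k, DifferentiableOn ℂ (F k) {w : ℂ | y < w.im} := fun k => by
      simp only [hF]
      fun_prop
    have hle : ∀ k, ∀ w ∈ {w : ℂ | y < w.im}, ‖F k w‖ ≤ ‖a k‖ * ρ ^ k := fun k w hw => by
      rw [hF, norm_mul, norm_pow, Complex.norm_exp]
      gcongr
      rw [Real.exp_le_exp]
      simp only [mul_re, re_ofNat, ofReal_re, im_ofNat, ofReal_im, mul_zero, sub_zero,
        Complex.I_re, mul_im, zero_mul, add_zero, Complex.I_im, mul_one, zero_sub]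
      have := mul_lt_mul_of_pos_left (show y < w.im from hw) Real.pi_pos
      linarith
    exact ⟨(Complex.differentiableOn_tsum_of_summable_norm hu hd hU hle).differentiableAt
      (hU.mem_nhds hτ), Complex.hasSum_deriv_of_summable_norm hu hd hU hle hτ⟩
  have hqG (τ : ℍ) : f τ = qpow τ r * G τ := by
    have := hasQExpansion_iff.1 hf τ
    have h2 : G τ = qpow τ (-r) * f τ := by
      rw [← this.tsum_eq]
      simp [hG, hF, qpow]
    rw [h2, ← mul_assoc, ← qpow_add, add_neg_cancel, qpow_zero, one_mul]
  have hGm : MDiff (fun τ : ℍ => G τ) := by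
    rw [UpperHalfPlane.mdifferentiable_iff]
    intro w hw
    have := (key ⟨w, hw⟩).1
    refine (this.congr_of_eventuallyEq ?_).differentiableWithinAt
    filter_upwards [isOpen_upperHalfPlaneSet.mem_nhds hw] with v hv
    simp [ofComplex_apply_of_im_pos hv]
  have hfeq : f = (fun τ : ℍ => qpow τ r) * fun τ : ℍ => G τ := funext hqG
  refine ⟨by rw [hfeq]; exact (mdifferentiable_qpow r).mul hGm, ?_⟩
  rw [hasQExpansion_iff]
  intro τ
  have hD : D f τ = qpow τ r * (r * G τ + (2 * Real.pi * I)⁻¹ * deriv G τ) := by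
    rw [hfeq, Derivative.normalizedDerivOfComplex_mul _ _ (mdifferentiable_qpow r) hGm]
    simp only [Pi.add_apply, Pi.mul_apply]
    rw [normalizedDeriv_qpow,
      normalizedDeriv_of_hasDerivAt (f := fun τ : ℍ => G τ) (fun w => rfl) (key τ).1.hasDerivAt]
    ring
  have h1 := ((hasQExpansion_iff.1 hf τ).mul_left r).add ((key τ).2.mul_left (2 * Real.pi * I)⁻¹)
  convert! h1 using 1
  · funext k
    have hk : HasDerivAt (F k)
        (a k * (k * cexp (2 * Real.pi * I * τ) ^ k * (2 * Real.pi * I))) (τ : ℂ) := by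
      have h3 : HasDerivAt (fun w : ℂ => a k * cexp (k * (2 * Real.pi * I * w)))
          (a k * (cexp (k * (2 * Real.pi * I * τ)) * (k * (2 * Real.pi * I)))) (τ : ℂ) := by
        have := (((hasDerivAt_id (τ : ℂ)).const_mul (2 * Real.pi * I)).const_mul
          (k : ℂ)).cexp.const_mul (a k)
        simpa using this
      have h4 : F k = fun w : ℂ => a k * cexp (k * (2 * Real.pi * I * w)) := by
        funext w
        simp only [hF]
        rw [← Complex.exp_nat_mul]
      rw [h4]
      convert! h3 using 1
      rw [← Complex.exp_nat_mul]
      ring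
    rw [hk.deriv, qpow, mul_one]
    have : (2 * Real.pi * I : ℂ) ≠ 0 := two_pi_I_ne_zero
    field_simp
  · rw [hD, hqG τ]
    have h5 : qpow τ (-r) * qpow τ r = 1 := by rw [← qpow_add, neg_add_cancel, qpow_zero]
    linear_combination ((2 * Real.pi * I)⁻¹ * deriv G τ) * h5

lemma HasQExpansion.mdifferentiable {f : ℍ → ℂ} {r : ℂ} {a : ℕ → ℂ}
    (hf : HasQExpansion f r a) : MDiff f := hf.mdifferentiable_and_deriv.1

lemma HasQExpansion.deriv {f : ℍ → ℂ} {r : ℂ} {a : ℕ → ℂ}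
    (hf : HasQExpansion f r a) : HasQExpansion (D f) r (fun k => (r + k) * a k) :=
  hf.mdifferentiable_and_deriv.2

/-- Divide by the power of q at the first nonzero coefficient: the quotient series vanishes on the
punctured disc, yet tends to that coefficient at 0. -/
lemma HasQExpansion.coeff_eq_zero {r : ℂ} {a : ℕ → ℂ} (h : HasQExpansion 0 r a) : a = 0 := by
  by_contra hne
  have hex : ∃ k, a k ≠ 0 := by
    by_contra! H
    exact hne (funext H)
  classical
  set m := Nat.find hex with hm
  have hmin : ∀ j < m, a j = 0 := fun j hj => by simpa using Nat.find_min hex hj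
  set b : ℕ → ℂ := fun k => a (m + k) with hb
  have hsum {z : ℂ} (hz : ‖z‖ < 1) : Summable fun k => b k * z ^ k := by
    rcases eq_or_ne z 0 with rfl | hz0
    · refine summable_of_ne_finset_zero (s := {0}) fun k hk => ?_
      simp [zero_pow (by simpa using hk : k ≠ 0)]
    · have h1 := (summable_nat_add_iff m).2 (h.summable hz)
      refine ((h1.mul_left (z ^ m)⁻¹).congr fun k => ?_)
      have : z ^ m ≠ 0 := pow_ne_zero _ hz0
      rw [hb, pow_add, add_comm]
      field_simp
  have hzero {z : ℂ} (hz : ‖z‖ < 1) (hz0 : z ≠ 0) : ∑' k, b k * z ^ k = 0 := by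
    obtain ⟨τ, rfl⟩ := exists_qpow_one_eq hz hz0
    have h1 := (hasQExpansion_iff.1 h τ).tsum_eq
    rw [← (h.summable hz).sum_add_tsum_nat_add m, Finset.sum_eq_zero, zero_add] at h1
    · have h2 : (∑' k, a (k + m) * qpow τ 1 ^ (k + m)) =
          (∑' k, b k * qpow τ 1 ^ k) * qpow τ 1 ^ m := by
        rw [← tsum_mul_right]
        refine tsum_congr fun k => ?_
        rw [hb, pow_add, add_comm, mul_assoc]
      rw [h2] at h1
      simpa [qpow_ne_zero] using h1
    · intro k hk
      rw [hmin k (Finset.mem_range.1 hk), zero_mul]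
  have hcont : Tendsto (fun z : ℂ => ∑' k, b k * z ^ k) (𝓝 0) (𝓝 (∑' k, b k * (0 : ℂ) ^ k)) := by
    refine tendsto_tsum_of_dominated_convergence (bound := fun k => ‖b k‖ * (1 / 2 : ℝ) ^ k) ?_ ?_ ?_
    · have := (hsum (z := (1 / 2 : ℝ)) (by norm_num)).norm
      simpa using this
    · intro k
      exact (continuous_const.mul (continuous_pow k)).tendsto _
    · filter_upwards [Metric.ball_mem_nhds (0 : ℂ) (by norm_num : (0 : ℝ) < 1 / 2)] with z hz k
      rw [norm_mul, norm_pow]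
      gcongr
      exact (mem_ball_zero_iff.1 hz).le
  have h0 : (∑' k, b k * (0 : ℂ) ^ k) = b 0 := by
    rw [tsum_eq_single 0 fun k hk => by simp [zero_pow hk]]
    simp
  have hlim : Tendsto (fun z : ℂ => ∑' k, b k * z ^ k) (𝓝[≠] 0) (𝓝 0) := by
    refine tendsto_const_nhds.congr' ?_
    have h1 : Metric.ball (0 : ℂ) 1 ∈ 𝓝[≠] (0 : ℂ) :=
      mem_nhdsWithin_of_mem_nhds (Metric.ball_mem_nhds _ one_pos)
    filter_upwards [h1, self_mem_nhdsWithin] with z hz hz0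
    exact (hzero (mem_ball_zero_iff.1 hz) hz0).symm
  have := tendsto_nhds_unique hlim (hcont.mono_left nhdsWithin_le_nhds)
  rw [h0] at this
  exact Nat.find_spec hex this.symm

lemma HasQExpansion.eq_of_coeff_eq {f g : ℍ → ℂ} {r : ℂ} {a : ℕ → ℂ} (hf : HasQExpansion f r a)
    (hg : HasQExpansion g r a) : f = g :=
  funext fun τ => (hf τ).unique (hg τ)

/-- The `q`-expansion of a periodic holomorphic function that is bounded at `i∞`. -/
lemma exists_hasQExpansion {f : ℍ → ℂ} (hf : MDiff f) (hT : ∀ τ : ℍ, f ((1 : ℝ) +ᵥ τ) = f τ)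
    (hb : IsBoundedAtImInfty f) : ∃ a, HasQExpansion f 0 a := by
  have hper : Function.Periodic (f ∘ ofComplex) ((1 : ℝ) : ℂ) := by
    intro w
    by_cases hw : 0 < w.im
    · have h1 : 0 < (w + ((1 : ℝ) : ℂ)).im := by simpa using hw
      simp only [Function.comp_apply, ofComplex_apply_of_im_pos hw, ofComplex_apply_of_im_pos h1]
      rw [← hT ⟨w, hw⟩]
      congr 1
      ext
      simp [add_comm]
    · have h1 : (w + ((1 : ℝ) : ℂ)).im ≤ 0 := by simpa using hw
      simp only [Function.comp_apply, ofComplex_apply_of_im_nonpos h1,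
        ofComplex_apply_of_im_nonpos (not_lt.1 hw)]
  refine ⟨fun k => (qExpansion 1 f).coeff k, hasQExpansion_iff.2 fun τ => ?_⟩
  simpa [qpow_zero, qpow_one_eq_qParam] using hasSum_qExpansion one_pos hper hf hb τ

/-! ### The recursion for the coefficients of a solution -/

/-- The coefficients of `E₂ = 1 - 24 ∑ σ₁(m) q ^ m`. -/
def e2Coeff (m : ℕ) : ℂ := if m = 0 then 1 else -24 * (ArithmeticFunction.sigma 1 m : ℂ)

/-- The coefficients of `E₄`. -/
def e4Coeff (m : ℕ) : ℂ := (qExpansion 1 ModularForm.E₄).coeff m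

/-- The coefficients of `E₆`. -/
def e6Coeff (m : ℕ) : ℂ := (qExpansion 1 ModularForm.E₆).coeff m

lemma hasQExpansion_E2 : HasQExpansion EisensteinSeries.E2 0 e2Coeff := by
  rw [hasQExpansion_iff]
  intro τ
  simpa [qpow, e2Coeff] using EisensteinSeries.hasSum_qExpansion_E2 (z := τ)

lemma hasQExpansion_E4 : HasQExpansion ModularForm.E₄ 0 e4Coeff := by
  rw [hasQExpansion_iff]
  intro τ
  simpa [qpow_zero, qpow_one_eq_qParam, e4Coeff] using
    ModularForm.hasSum_qExpansion ModularForm.E₄ one_pos one_mem_strictPeriods_SL τ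

lemma hasQExpansion_E6 : HasQExpansion ModularForm.E₆ 0 e6Coeff := by
  rw [hasQExpansion_iff]
  intro τ
  simpa [qpow_zero, qpow_one_eq_qParam, e6Coeff] using
    ModularForm.hasSum_qExpansion ModularForm.E₆ one_pos one_mem_strictPeriods_SL τ

lemma e2Coeff_zero : e2Coeff 0 = 1 := by simp [e2Coeff]

lemma e2Coeff_one : e2Coeff 1 = -24 := by simp [e2Coeff]

lemma e4Coeff_zero : e4Coeff 0 = 1 := EisensteinSeries.E_qExpansion_coeff_zero _ ⟨2, rfl⟩

lemma e4Coeff_one : e4Coeff 1 = 240 := ModularForm.E₄_qExpansion_coeff_one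

lemma e6Coeff_zero : e6Coeff 0 = 1 := EisensteinSeries.E_qExpansion_coeff_zero _ ⟨3, rfl⟩

lemma e6Coeff_one : e6Coeff 1 = -504 := ModularForm.E₆_qExpansion_coeff_one

/-- The indicial polynomial as a function. -/
def indicial (x y t : ℂ) : ℂ := t ^ 3 - 1 / 2 * t ^ 2 + x * t + y

/-- The coefficient of `q ^ (t + m)` in the lower order part of the operator applied to `q ^ t`. -/
def lowerCoeff (x y : ℂ) (m : ℕ) (t : ℂ) : ℂ :=
  -1 / 2 * e2Coeff m * t ^ 2 + (1 / 2 * m * e2Coeff m + x * e4Coeff m) * t + y * e6Coeff m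

lemma lowerCoeff_zero (x y t : ℂ) : t ^ 3 + lowerCoeff x y 0 t = indicial x y t := by
  simp only [lowerCoeff, indicial, e2Coeff_zero, e4Coeff_zero, e6Coeff_zero, Nat.cast_zero]
  ring

lemma lowerCoeff_one (x y t : ℂ) :
    lowerCoeff x y 1 t = 12 * t ^ 2 + (-12 + 240 * x) * t - 504 * y := by
  simp only [lowerCoeff, e2Coeff_one, e4Coeff_one, e6Coeff_one, Nat.cast_one]
  ring

/-- Differentiation multiplies the k-th coefficient by r + k, and each Eisenstein coefficient acts
by a Cauchy product; the three lower order terms merge into `lowerCoeff`. -/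
lemma HasQExpansion.mldeOp {f : ℍ → ℂ} {r : ℂ} {a : ℕ → ℂ} (hf : HasQExpansion f r a) (x y : ℂ) :
    HasQExpansion (mldeOp x y f) r (fun k => (r + k) ^ 3 * a k +
      ∑ p ∈ antidiagonal k, lowerCoeff x y p.1 (r + p.2) * a p.2) := by
  have h1 := hf.deriv
  have h2 := h1.deriv
  have h3 := h2.deriv
  have hE := hasQExpansion_E2.deriv
  have key := ((h3.sub ((hasQExpansion_E2.smul (1 / 2)).mul h2)).add
    (((hE.smul (1 / 2)).add (hasQExpansion_E4.smul x)).mul h1)).add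
    ((hasQExpansion_E6.smul y).mul hf)
  convert! key using 1
  funext k
  simp only [Pi.add_apply, Pi.sub_apply, Pi.smul_apply, smul_eq_mul]
  rw [sub_add, sub_add, ← Finset.sum_sub_distrib, ← Finset.sum_sub_distrib, sub_eq_add_neg,
    ← Finset.sum_neg_distrib]
  congr 1
  · ring
  · refine Finset.sum_congr rfl fun p _ => ?_
    simp only [lowerCoeff, zero_add]
    ring

/-- The recursion satisfied by the coefficients of a solution. -/
def IsFrobenius (x y r : ℂ) (a : ℕ → ℂ) : Prop :=
  ∀ k : ℕ, indicial x y (r + k) * a k +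
    ∑ j ∈ Finset.range k, lowerCoeff x y (k - j) (r + j) * a j = 0

/-- The term of the convolution that involves a_k itself joins the cubic term to form the indicial
polynomial; what remains involves only earlier coefficients. -/
lemma coeff_mldeOp_eq (x y r : ℂ) (a : ℕ → ℂ) (k : ℕ) :
    (r + k) ^ 3 * a k + ∑ p ∈ antidiagonal k, lowerCoeff x y p.1 (r + p.2) * a p.2 =
      indicial x y (r + k) * a k +
        ∑ j ∈ Finset.range k, lowerCoeff x y (k - j) (r + j) * a j := by
  rw [← Finset.Nat.sum_antidiagonal_swap]
  simp only [Prod.fst_swap, Prod.snd_swap]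
  rw [Finset.Nat.sum_antidiagonal_eq_sum_range_succ
    (fun i j => lowerCoeff x y j (r + i) * a i), Finset.sum_range_succ, Nat.sub_self,
    ← lowerCoeff_zero]
  ring

/-- The bridge between analysis and algebra: by uniqueness of coefficients the operator kills f
exactly when it kills each coefficient. -/
lemma mem_solutionSpace_iff_isFrobenius {f : ℍ → ℂ} {r : ℂ} {a : ℕ → ℂ}
    (hf : HasQExpansion f r a) (x y : ℂ) : f ∈ solutionSpace x y ↔ IsFrobenius x y r a := by
  have h := hf.mldeOp x y
  constructor
  · rintro ⟨-, h0⟩ k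
    rw [show mldeOp x y f = 0 from funext h0] at h
    rw [← coeff_mldeOp_eq]
    exact congrFun h.coeff_eq_zero k
  · intro ha
    refine ⟨hf.mdifferentiable, fun τ => ?_⟩
    have h1 := h τ
    simp only [coeff_mldeOp_eq] at h1
    refine h1.unique ?_
    simp only [ha _, zero_mul]
    exact hasSum_zero

lemma IsFrobenius.indicial_eq_zero {x y r : ℂ} {a : ℕ → ℂ} (h : IsFrobenius x y r a)
    (h0 : a 0 ≠ 0) : indicial x y r = 0 := by
  simpa [h0] using h 0

lemma IsFrobenius.one {x y r : ℂ} {a : ℕ → ℂ} (h : IsFrobenius x y r a) :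
    indicial x y (r + 1) * a 1 + lowerCoeff x y 1 r * a 0 = 0 := by
  simpa using h 1

lemma IsFrobenius.unique {x y r : ℂ} {a b : ℕ → ℂ} (ha : IsFrobenius x y r a)
    (hb : IsFrobenius x y r b) (h0 : a 0 = b 0)
    (hr : ∀ k : ℕ, 1 ≤ k → indicial x y (r + k) ≠ 0) : a = b := by
  funext k
  induction k using Nat.strong_induction_on with
  | _ k ih =>
    rcases Nat.eq_zero_or_pos k with rfl | hk
    · exact h0
    · have h1 := ha k
      have h2 : ∑ j ∈ Finset.range k, lowerCoeff x y (k - j) (r + j) * a j =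
          ∑ j ∈ Finset.range k, lowerCoeff x y (k - j) (r + j) * b j :=
        Finset.sum_congr rfl fun j hj => by rw [ih j (Finset.mem_range.1 hj)]
      rw [h2] at h1
      exact mul_left_cancel₀ (hr k hk) (by linear_combination h1 - hb k)

/-- The coefficients of the Frobenius solution of index `r`. -/
def frobeniusCoeff (x y r : ℂ) (k : ℕ) : ℂ :=
  if k = 0 then 1 else
    -(∑ j : Fin k, lowerCoeff x y (k - j) (r + (j : ℕ)) * frobeniusCoeff x y r j) /
      indicial x y (r + k)
termination_by k
decreasing_by exact j.2

lemma frobeniusCoeff_zero (x y r : ℂ) : frobeniusCoeff x y r 0 = 1 := by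
  rw [frobeniusCoeff, if_pos rfl]

lemma isFrobenius_frobeniusCoeff {x y r : ℂ} (h0 : indicial x y r = 0)
    (hr : ∀ k : ℕ, 1 ≤ k → indicial x y (r + k) ≠ 0) :
    IsFrobenius x y r (frobeniusCoeff x y r) := by
  intro k
  rcases Nat.eq_zero_or_pos k with rfl | hk
  · simp [h0]
  · have h1 := frobeniusCoeff.eq_1 x y r k
    rw [if_neg hk.ne', Fin.sum_univ_eq_sum_range
      (fun j => lowerCoeff x y (k - j) (r + (j : ℕ)) * frobeniusCoeff x y r j)] at h1
    rw [h1, mul_div_cancel₀ _ (hr k hk), neg_add_cancel]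

/-! ### Convergence of Frobenius series -/

/-- A weight for the size of `lowerCoeff`. -/
def lowerBound (x y : ℂ) (m : ℕ) : ℝ :=
  ‖e2Coeff m‖ + ‖((0 : ℂ) + m) * e2Coeff m‖ + ‖x‖ * ‖e4Coeff m‖ + ‖y‖ * ‖e6Coeff m‖

lemma lowerBound_nonneg (x y : ℂ) (m : ℕ) : 0 ≤ lowerBound x y m := by
  unfold lowerBound
  positivity

/-- `lowerCoeff` has degree two in t, so s² dominates every monomial. The factor (0 + m) is kept in
the shape produced by `HasQExpansion.deriv` for E₂, which supplies the summability of the bound. -/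
lemma norm_lowerCoeff_le (x y : ℂ) (m : ℕ) {t : ℂ} {s : ℝ} (hs : 1 ≤ s) (ht : ‖t‖ ≤ s) :
    ‖lowerCoeff x y m t‖ ≤ s ^ 2 * lowerBound x y m := by
  have hs2 : s ≤ s ^ 2 := by nlinarith
  have e : lowerCoeff x y m t = -(1 / 2) * (e2Coeff m * t ^ 2) +
      1 / 2 * ((((0 : ℂ) + m) * e2Coeff m) * t) + (x * e4Coeff m) * t + y * e6Coeff m := by
    simp only [lowerCoeff]
    ring
  have ht2 : ‖t‖ ^ 2 ≤ s ^ 2 := by gcongr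
  have ht1 : ‖t‖ ≤ s ^ 2 := ht.trans hs2
  have h1 : ‖-(1 / 2) * (e2Coeff m * t ^ 2)‖ ≤ s ^ 2 * ‖e2Coeff m‖ := by
    rw [norm_mul, norm_mul, norm_pow]
    have : ‖(-(1 / 2) : ℂ)‖ = 1 / 2 := by norm_num
    rw [this]
    nlinarith [mul_le_mul_of_nonneg_left ht2 (norm_nonneg (e2Coeff m)), norm_nonneg (e2Coeff m),
      mul_nonneg (norm_nonneg (e2Coeff m)) (sq_nonneg ‖t‖)]
  have h2 : ‖1 / 2 * ((((0 : ℂ) + m) * e2Coeff m) * t)‖ ≤ s ^ 2 * ‖((0 : ℂ) + m) * e2Coeff m‖ := by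
    rw [norm_mul, norm_mul _ t]
    have : ‖(1 / 2 : ℂ)‖ = 1 / 2 := by norm_num
    rw [this]
    nlinarith [mul_le_mul_of_nonneg_left ht1 (norm_nonneg (((0 : ℂ) + m) * e2Coeff m)),
      mul_nonneg (norm_nonneg (((0 : ℂ) + m) * e2Coeff m)) (norm_nonneg t)]
  have h3 : ‖(x * e4Coeff m) * t‖ ≤ s ^ 2 * (‖x‖ * ‖e4Coeff m‖) := by
    rw [norm_mul, norm_mul, mul_comm]
    gcongr
  have h4 : ‖y * e6Coeff m‖ ≤ s ^ 2 * (‖y‖ * ‖e6Coeff m‖) := by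
    rw [norm_mul]
    exact le_mul_of_one_le_left (by positivity) (by nlinarith)
  rw [e]
  refine (norm_add_le _ _).trans ?_
  refine (add_le_add_left ((norm_add_le _ _).trans
    (add_le_add_left (norm_add_le _ _) _)) _).trans ?_
  rw [lowerBound]
  linarith

lemma summable_lowerBound (x y : ℂ) {ρ : ℝ} (h0 : 0 ≤ ρ) (h1 : ρ < 1) :
    Summable fun m => lowerBound x y m * ρ ^ m := by
  have := (((hasQExpansion_E2.summable_norm h0 h1).add
    (hasQExpansion_E2.deriv.summable_norm h0 h1)).add
    ((hasQExpansion_E4.summable_norm h0 h1).mul_left ‖x‖)).add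
    ((hasQExpansion_E6.summable_norm h0 h1).mul_left ‖y‖)
  refine this.congr fun m => ?_
  rw [lowerBound]
  ring

/-- The cubic indicial polynomial eventually beats the quadratic bound on the lower order terms;
this makes the induction in `IsFrobenius.bounded` close. -/
lemma exists_indicial_large (x y r : ℂ) (A : ℝ) (hA : 0 ≤ A) :
    ∃ N : ℕ, ∀ k : ℕ, N ≤ k → (1 + ‖r‖ + k) ^ 2 * A ≤ ‖indicial x y (r + k)‖ := by
  -- With t = |r + k|, this size of k gives t ≥ k/2 and 1 + |r| + k ≤ 4t; the 16 is the square of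
  -- that 4.
  obtain ⟨N, hN⟩ := exists_nat_ge (2 * (16 * A + 1 / 2 + ‖x‖ + ‖y‖) + 2 * (1 + ‖r‖))
  refine ⟨N, fun k hk => ?_⟩
  have hk' : 2 * (16 * A + 1 / 2 + ‖x‖ + ‖y‖) + 2 * (1 + ‖r‖) ≤ (k : ℝ) :=
    hN.trans (by exact_mod_cast hk)
  have hx := norm_nonneg x
  have hy := norm_nonneg y
  have hr := norm_nonneg r
  set t := ‖r + k‖ with ht
  have ht1 : (k : ℝ) / 2 ≤ t := by
    have := norm_sub_norm_le (k : ℂ) (-r)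
    rw [norm_neg, sub_neg_eq_add, add_comm (k : ℂ), Complex.norm_natCast] at this
    linarith
  have ht2 : 1 ≤ t := by linarith
  have h1 : t ^ 3 - 1 / 2 * t ^ 2 - ‖x‖ * t - ‖y‖ ≤ ‖indicial x y (r + k)‖ := by
    have e : (r + k) ^ 3 = indicial x y (r + k) + 1 / 2 * (r + k) ^ 2 - x * (r + k) - y := by
      simp only [indicial]
      ring
    have h2 := norm_sub_le (indicial x y (r + k) + 1 / 2 * (r + k) ^ 2 - x * (r + k)) y
    have h3 := norm_sub_le (indicial x y (r + k) + 1 / 2 * (r + k) ^ 2) (x * (r + k))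
    have h4 := norm_add_le (indicial x y (r + k)) (1 / 2 * (r + k) ^ 2)
    rw [← e, norm_pow] at h2
    rw [norm_mul] at h3
    rw [norm_mul, norm_pow, show ‖(1 / 2 : ℂ)‖ = 1 / 2 by norm_num] at h4
    linarith
  refine le_trans ?_ h1
  have h5 : (1 + ‖r‖ + k) ^ 2 ≤ 16 * t ^ 2 := by
    have : 1 + ‖r‖ + k ≤ 4 * t := by linarith
    calc (1 + ‖r‖ + k) ^ 2 ≤ (4 * t) ^ 2 := by gcongr
      _ = 16 * t ^ 2 := by ring
  have h6 : (1 + ‖r‖ + k) ^ 2 * A ≤ 16 * t ^ 2 * A := by gcongr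
  have h7 : ‖x‖ * t ≤ ‖x‖ * t ^ 2 := by
    gcongr
    nlinarith
  have h8 : ‖y‖ ≤ ‖y‖ * t ^ 2 := le_mul_of_one_le_right hy (by nlinarith)
  have h9 : (16 * A + 1 / 2 + ‖x‖ + ‖y‖) * t ^ 2 ≤ t * t ^ 2 := by
    gcongr
    linarith
  nlinarith

/-- Strong induction on the recursion: beyond N the sum of the earlier terms, weighted by ρ, is at
most (1 + |r| + k)² A M, and the indicial value absorbs (1 + |r| + k)² A. The constant M just covers
the first N + 1 terms. -/
lemma IsFrobenius.bounded {x y r : ℂ} {a : ℕ → ℂ} (ha : IsFrobenius x y r a)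
    (hr : ∀ k : ℕ, 1 ≤ k → indicial x y (r + k) ≠ 0) {ρ : ℝ} (h0 : 0 < ρ) (h1 : ρ < 1) :
    ∃ M, ∀ k, ‖a k‖ * ρ ^ k ≤ M := by
  set A := ∑' m, lowerBound x y m * ρ ^ m
  have hs := summable_lowerBound x y h0.le h1
  have hnn : ∀ m, 0 ≤ lowerBound x y m * ρ ^ m :=
    fun m => mul_nonneg (lowerBound_nonneg x y m) (by positivity)
  obtain ⟨N, hN⟩ := exists_indicial_large x y r A (tsum_nonneg hnn)
  set M := ∑ j ∈ Finset.range (N + 1), ‖a j‖ * ρ ^ j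
  have hM : 0 ≤ M := Finset.sum_nonneg fun j _ => by positivity
  refine ⟨M, fun k => ?_⟩
  induction k using Nat.strong_induction_on with
  | _ k ih =>
    rcases lt_or_ge k (N + 1) with hk | hk
    · exact Finset.single_le_sum (f := fun j => ‖a j‖ * ρ ^ j) (fun j _ => by positivity)
        (Finset.mem_range.2 hk)
    · have hP : 0 < ‖indicial x y (r + k)‖ := norm_pos_iff.2 (hr k (by omega))
      have hrec : ‖indicial x y (r + k)‖ * ‖a k‖ ≤ ∑ j ∈ Finset.range k,
          (1 + ‖r‖ + k) ^ 2 * lowerBound x y (k - j) * ‖a j‖ := by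
        rw [← norm_mul, eq_neg_of_add_eq_zero_left (ha k), norm_neg]
        refine (norm_sum_le _ _).trans (Finset.sum_le_sum fun j hj => ?_)
        rw [norm_mul]
        gcongr
        refine norm_lowerCoeff_le x y _ ?_ ?_
        · have := norm_nonneg r
          have : (0 : ℝ) ≤ k := Nat.cast_nonneg k
          linarith
        · have h2 := norm_add_le r (j : ℂ)
          rw [Complex.norm_natCast] at h2
          have : (j : ℝ) ≤ k := by exact_mod_cast (Finset.mem_range.1 hj).le
          linarith
      have hsum : ∑ j ∈ Finset.range k, lowerBound x y (k - j) * ρ ^ (k - j) ≤ A := by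
        -- As j runs below k, k - j runs over 1, …, k, so this is a partial sum of the series A
        -- without its term at 0.
        have h2 := Finset.sum_range_reflect (fun i => lowerBound x y (i + 1) * ρ ^ (i + 1)) k
        rw [Finset.sum_congr rfl fun j hj => by
          rw [show k - 1 - j + 1 = k - j by have := Finset.mem_range.1 hj; omega]] at h2
        rw [h2]
        refine le_trans ?_ (hs.sum_le_tsum (Finset.range (k + 1)) fun m _ => hnn m)
        rw [Finset.sum_range_succ']
        exact le_add_of_nonneg_right (hnn 0)
      refine le_of_mul_le_mul_left ?_ hP
      calc ‖indicial x y (r + k)‖ * (‖a k‖ * ρ ^ k)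
          = (‖indicial x y (r + k)‖ * ‖a k‖) * ρ ^ k := by ring
        _ ≤ (∑ j ∈ Finset.range k, (1 + ‖r‖ + k) ^ 2 * lowerBound x y (k - j) * ‖a j‖) * ρ ^ k := by
          gcongr
        _ = (1 + ‖r‖ + k) ^ 2 * ∑ j ∈ Finset.range k,
            (lowerBound x y (k - j) * ρ ^ (k - j)) * (‖a j‖ * ρ ^ j) := by
          rw [Finset.sum_mul, Finset.mul_sum]
          refine Finset.sum_congr rfl fun j hj => ?_
          rw [show ρ ^ k = ρ ^ (k - j) * ρ ^ j by
            rw [← pow_add, Nat.sub_add_cancel (Finset.mem_range.1 hj).le]]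
          ring
        _ ≤ (1 + ‖r‖ + k) ^ 2 * ∑ j ∈ Finset.range k,
            (lowerBound x y (k - j) * ρ ^ (k - j)) * M := by
          gcongr with j hj
          · exact hnn _
          · exact ih j (Finset.mem_range.1 hj)
        _ = (1 + ‖r‖ + k) ^ 2 * (∑ j ∈ Finset.range k,
            (lowerBound x y (k - j) * ρ ^ (k - j))) * M := by
          rw [← Finset.sum_mul, mul_assoc]
        _ ≤ (1 + ‖r‖ + k) ^ 2 * A * M := by gcongr
        _ ≤ ‖indicial x y (r + k)‖ * M := by
          gcongr
          exact hN k (by omega)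

/-- For each τ choose ρ strictly between |q| and 1; boundedness of |a_k| ρ^k gives comparison with a
geometric series. -/
lemma IsFrobenius.exists_solution {x y r : ℂ} {a : ℕ → ℂ} (ha : IsFrobenius x y r a)
    (hr : ∀ k : ℕ, 1 ≤ k → indicial x y (r + k) ≠ 0) :
    ∃ f ∈ solutionSpace x y, HasQExpansion f r a := by
  have hsum : ∀ τ : ℍ, Summable fun k => a k * qpow τ (r + k) := by
    intro τ
    set z := qpow τ 1
    have hz : ‖z‖ < 1 := norm_qpow_one_lt τ
    obtain ⟨ρ, hρ1, hρ2⟩ := exists_between hz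
    have hρ0 : 0 < ρ := (norm_nonneg z).trans_lt hρ1
    obtain ⟨M, hM⟩ := ha.bounded hr hρ0 hρ2
    have h1 : Summable fun k => a k * z ^ k := by
      refine Summable.of_norm_bounded (g := fun k => M * (‖z‖ / ρ) ^ k)
        ((summable_geometric_of_lt_one (by positivity) ((div_lt_one hρ0).2 hρ1)).mul_left M)
        fun k => ?_
      rw [norm_mul, norm_pow, div_pow, mul_div_assoc', le_div_iff₀ (by positivity), mul_right_comm]
      gcongr
      exact hM k
    refine (h1.mul_left (qpow τ r)).congr fun k => ?_
    rw [qpow_add, qpow_natCast, mul_left_comm]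
  have hf : HasQExpansion (fun τ => ∑' k, a k * qpow τ (r + k)) r a := fun τ => (hsum τ).hasSum
  exact ⟨_, (mem_solutionSpace_iff_isFrobenius hf x y).2 ha, hf⟩

/-! ### Level one vanishing and the Ramanujan identities -/

lemma denom_T (τ : ℍ) : denom ModularGroup.T τ = 1 := by
  rw [ModularGroup.denom_apply]
  simp [ModularGroup.T]

/-- A holomorphic function that is modular of level one and weight `k < 12` and vanishes at `i∞`
is zero. -/
lemma eq_zero_of_levelOne {k : ℤ} (hk : k < 12) {f : ℍ → ℂ} (hf : MDiff f)
    (hT : ∀ τ : ℍ, f ((1 : ℝ) +ᵥ τ) = f τ)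
    (hS : ∀ τ : ℍ, f (ModularGroup.S • τ) = (τ : ℂ) ^ k * f τ)
    (h0 : Tendsto f atImInfty (𝓝 0)) : f = 0 := by
  have hT' : f ∣[k] ModularGroup.T = f := by
    ext τ
    rw [ModularForm.SL_slash_apply, modular_T_smul, hT, denom_T, one_zpow, mul_one]
  have hS' : f ∣[k] ModularGroup.S = f := by
    ext τ
    rw [ModularForm.SL_slash_apply, hS, ModularGroup.denom_S, mul_right_comm, ← zpow_add₀ τ.ne_zero,
      add_neg_cancel, zpow_zero, one_mul]
  -- S and T generate the modular group, and every cusp is equivalent to i∞, so f is a cusp form,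
  -- hence zero in weight below 12.
  have hall := SlashInvariantForm.slash_action_generators_SL2Z hS' hT'
  let F : CuspForm 𝒮ℒ k :=
    { toFun := f
      slash_action_eq' := fun A hA => by
        obtain ⟨A, rfl⟩ := hA
        exact hall A
      holo' := hf
      zero_at_cusps' := fun hc => by
        rw [Subgroup.IsArithmetic.isCusp_iff_isCusp_SL2Z] at hc
        rw [OnePoint.isZeroAt_iff_forall_SL2Z hc]
        intro γ _
        rw [hall]
        exact h0 }
  have hF : F = 0 := rank_zero_iff_forall_zero.1 (CuspForm.rank_eq_zero_of_weight_lt_twelve hk) F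
  exact congrArg DFunLike.coe hF

/-- If `F` is holomorphic with a limit at `i∞`, then its derivative tends to zero there. -/
lemma tendsto_normalizedDeriv_zero {F : ℍ → ℂ} (hF : MDiff F) {c : ℂ}
    (hc : Tendsto F atImInfty (𝓝 c)) : Tendsto (D F) atImInfty (𝓝 0) := by
  rw [Metric.tendsto_nhds]
  intro ε hε
  have hδ : 0 < Real.pi * ε / 2 := by positivity
  have h1 := Metric.tendsto_nhds.1 hc _ hδ
  obtain ⟨A, hA⟩ := (atImInfty_mem _).1 h1
  refine (atImInfty_mem _).2 ⟨max A 0 + 1, fun τ hτ => ?_⟩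
  have him : ∀ w ∈ Metric.closedBall (τ : ℂ) (1 / 2), max A 0 < w.im := by
    intro w hw
    have h2 : |(w - τ).im| ≤ 1 / 2 := (Complex.abs_im_le_norm _).trans (by
      simpa [dist_eq_norm] using hw)
    rw [sub_im, abs_le] at h2
    have : τ.im = (τ : ℂ).im := rfl
    linarith [h2.1]
  have hd : DifferentiableOn ℂ (fun w => (F ∘ ofComplex) w - c)
      (Metric.closedBall (τ : ℂ) (1 / 2)) := by
    refine ((UpperHalfPlane.mdifferentiable_iff.1 hF).mono fun w hw => ?_).sub_const c
    exact (le_max_right A 0).trans_lt (him w hw)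
  -- Cauchy's estimate on a disc of fixed radius lying inside the region where F is close to c.
  have h3 := Complex.norm_deriv_le_of_forall_mem_sphere_norm_le (c := (τ : ℂ)) (R := 1 / 2)
    (C := Real.pi * ε / 2) (by norm_num) (hd.diffContOnCl_ball subset_rfl) fun w hw => by
      have hw' := him w (Metric.sphere_subset_closedBall hw)
      have hw0 : 0 < w.im := (le_max_right A 0).trans_lt hw'
      have := hA ⟨w, hw0⟩ ((le_max_left A 0).trans hw'.le)
      simp only [Set.mem_ofPred_eq, dist_eq_norm] at this
      simpa [ofComplex_apply_of_im_pos hw0] using this.le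
  rw [deriv_sub_const] at h3
  simp only [Set.mem_ofPred_eq, dist_zero_right, Derivative.normalizedDerivOfComplex, norm_mul,
    norm_inv]
  have h4 : ‖(2 : ℂ)‖ * ‖(Real.pi : ℂ)‖ * ‖I‖ = 2 * Real.pi := by
    simp [abs_of_pos Real.pi_pos]
  rw [h4]
  have hpi := Real.pi_pos
  calc (2 * Real.pi)⁻¹ * ‖deriv (F ∘ ofComplex) τ‖ ≤ (2 * Real.pi)⁻¹ * (Real.pi * ε / 2 / (1 / 2)) := by
        gcongr
    _ = ε / 2 := by field_simp
    _ < ε := half_lt_self hε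

/-- The weight 0 case of the slash formula is the chain rule without a correction term, so it
applies to any holomorphic F, modular or not. -/
lemma normalizedDeriv_comp_S {F : ℍ → ℂ} (hF : MDiff F) (τ : ℍ) :
    D F (ModularGroup.S • τ) = (τ : ℂ) ^ 2 * D (fun τ : ℍ => F (ModularGroup.S • τ)) τ := by
  have h := congrFun (Derivative.normalizedDerivOfComplex_SL_slash (k := 0) hF
    (γ := ModularGroup.S)) τ
  have e : F ∣[(0 : ℤ)] ModularGroup.S = fun τ : ℍ => F (ModularGroup.S • τ) := by
    ext τ
    simp [ModularForm.SL_slash_apply]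
  rw [e] at h
  rw [h]
  simp only [Pi.sub_apply, ModularForm.SL_slash_apply, ModularGroup.denom_S]
  have := τ.ne_zero
  simp
  field_simp

lemma normalizedDeriv_comp_T {F : ℍ → ℂ} (hF : MDiff F) (τ : ℍ) :
    D F ((1 : ℝ) +ᵥ τ) = D (fun τ : ℍ => F ((1 : ℝ) +ᵥ τ)) τ := by
  have h := congrFun (Derivative.normalizedDerivOfComplex_SL_slash (k := 0) hF
    (γ := ModularGroup.T)) τ
  have e : F ∣[(0 : ℤ)] ModularGroup.T = fun τ : ℍ => F ((1 : ℝ) +ᵥ τ) := by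
    ext τ
    rw [ModularForm.SL_slash_apply, modular_T_smul, denom_T, one_zpow, mul_one]
  rw [e] at h
  rw [h, Pi.sub_apply, ModularForm.SL_slash_apply, modular_T_smul, denom_T, one_zpow, mul_one]
  simp

lemma normalizedDeriv_coe (τ : ℍ) : D (fun τ : ℍ => (τ : ℂ)) τ = (2 * Real.pi * I)⁻¹ := by
  rw [normalizedDeriv_of_hasDerivAt (f := fun τ : ℍ => (τ : ℂ)) (g := id) (fun w => rfl)
    (hasDerivAt_id _), mul_one]

lemma E2_vadd_one (τ : ℍ) :
    EisensteinSeries.E2 ((1 : ℝ) +ᵥ τ) = EisensteinSeries.E2 τ := by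
  have h := congrFun (EisensteinSeries.E2_slash_action ModularGroup.T) τ
  rw [ModularForm.SL_slash_apply, EisensteinSeries.D2_T, modular_T_smul, denom_T] at h
  simpa using h

/-- Quasimodularity; the anomaly 6τ/(πi) is what the derivatives of forms and of theta functions
must cancel below. -/
lemma E2_S (τ : ℍ) : EisensteinSeries.E2 (ModularGroup.S • τ) =
    (τ : ℂ) ^ 2 * EisensteinSeries.E2 τ + 6 / (Real.pi * I) * τ := by
  have h := congrFun (EisensteinSeries.E2_slash_action ModularGroup.S) τ
  rw [ModularForm.SL_slash_apply, Pi.sub_apply, Pi.smul_apply, EisensteinSeries.D2_S,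
    ModularGroup.denom_S, riemannZeta_two] at h
  have h0 := τ.ne_zero
  have hpi : (Real.pi : ℂ) ≠ 0 := by exact_mod_cast Real.pi_ne_zero
  have h1 : EisensteinSeries.E2 (ModularGroup.S • τ) = (τ : ℂ) ^ 2 *
      (EisensteinSeries.E2 (ModularGroup.S • τ) * (τ : ℂ) ^ (-2 : ℤ)) := by
    rw [zpow_neg, zpow_ofNat]
    field_simp
  rw [h1, h, smul_eq_mul]
  field_simp
  linear_combination (-6) * Complex.I_sq

lemma levelOne_vadd_one {k : ℤ} (f : ModularForm 𝒮ℒ k) (τ : ℍ) : f ((1 : ℝ) +ᵥ τ) = f τ :=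
  SlashInvariantForm.vAdd_apply_of_mem_strictPeriods f τ one_mem_strictPeriods_SL

lemma levelOne_S {k : ℤ} (f : ModularForm 𝒮ℒ k) (τ : ℍ) :
    f (ModularGroup.S • τ) = (τ : ℂ) ^ k * f τ := by
  have h := congrFun (SlashInvariantForm.slash_action_eqn f
    (ModularGroup.S : GL (Fin 2) ℝ) ⟨ModularGroup.S, rfl⟩) τ
  rw [← ModularForm.SL_slash, ModularForm.SL_slash_apply, ModularGroup.denom_S] at h
  rw [← h, mul_comm, mul_assoc, ← zpow_add₀ τ.ne_zero, neg_add_cancel, zpow_zero, mul_one]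

/-- The power series is continuous at 0 by dominated convergence, and q tends to 0 at i∞. -/
lemma HasQExpansion.tendsto {f : ℍ → ℂ} {a : ℕ → ℂ} (h : HasQExpansion f 0 a) :
    Tendsto f atImInfty (𝓝 (a 0)) := by
  have h1 : Tendsto (fun z : ℂ => ∑' k, a k * z ^ k) (𝓝 0) (𝓝 (∑' k, a k * (0 : ℂ) ^ k)) := by
    refine tendsto_tsum_of_dominated_convergence (bound := fun k => ‖a k‖ * (1 / 2 : ℝ) ^ k)
      (h.summable_norm (by norm_num) (by norm_num)) ?_ ?_
    · intro k
      exact (continuous_const.mul (continuous_pow k)).tendsto _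
    · filter_upwards [Metric.ball_mem_nhds (0 : ℂ) (by norm_num : (0 : ℝ) < 1 / 2)] with z hz k
      rw [norm_mul, norm_pow]
      gcongr
      exact (mem_ball_zero_iff.1 hz).le
  have h0 : (∑' k, a k * (0 : ℂ) ^ k) = a 0 := by
    rw [tsum_eq_single 0 fun k hk => by simp [zero_pow hk]]
    simp
  rw [h0] at h1
  refine (h1.comp (qParam_tendsto_atImInfty one_pos)).congr fun τ => ?_
  have := (hasQExpansion_iff.1 h τ).tsum_eq
  simpa [qpow_zero, qpow_one_eq_qParam] using this

lemma tendsto_E2 : Tendsto EisensteinSeries.E2 atImInfty (𝓝 1) := by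
  simpa [e2Coeff_zero] using hasQExpansion_E2.tendsto

lemma tendsto_E4 : Tendsto ModularForm.E₄ atImInfty (𝓝 1) := by
  simpa [e4Coeff_zero] using hasQExpansion_E4.tendsto

lemma tendsto_E6 : Tendsto ModularForm.E₆ atImInfty (𝓝 1) := by
  simpa [e6Coeff_zero] using hasQExpansion_E6.tendsto

lemma mdifferentiable_E4 : MDiff (ModularForm.E₄ : ℍ → ℂ) := hasQExpansion_E4.mdifferentiable

lemma mdifferentiable_E6 : MDiff (ModularForm.E₆ : ℍ → ℂ) := hasQExpansion_E6.mdifferentiable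

lemma mdifferentiable_const_fun (c : ℂ) : MDiff (fun _ : ℍ => c) := mdifferentiable_const

/-- The Serre derivative of a level one form transforms with weight `k + 2` under `S`. -/
lemma normalizedDeriv_levelOne_S {k : ℕ} {f : ℍ → ℂ} (hf : MDiff f)
    (hS : ∀ τ : ℍ, f (ModularGroup.S • τ) = (τ : ℂ) ^ k * f τ) (τ : ℍ) :
    D f (ModularGroup.S • τ) =
      (τ : ℂ) ^ (k + 2) * D f τ + k * (2 * Real.pi * I)⁻¹ * (τ : ℂ) ^ (k + 1) * f τ := by
  rw [normalizedDeriv_comp_S hf, funext hS]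
  have h1 : MDiff (fun τ : ℍ => (τ : ℂ)) := mdifferentiable_coe
  have h2 := Derivative.normalizedDerivOfComplex_mul _ _ (h1.pow k) hf
  have h3 : (fun τ : ℍ => (τ : ℂ) ^ k * f τ) = (fun τ : ℍ => (τ : ℂ)) ^ k * f := rfl
  rw [h3, h2, Derivative.normalizedDerivOfComplex_pow _ _ h1]
  simp only [Pi.add_apply, Pi.mul_apply, Pi.pow_apply, normalizedDeriv_coe, Pi.natCast_apply]
  rcases k with _ | k
  · simp
  · simp only [Nat.add_sub_cancel]
    ring

/-- `E₄' = (E₂ E₄ - E₆) / 3`. -/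
lemma normalizedDeriv_E4 (τ : ℍ) : D ModularForm.E₄ τ =
    (EisensteinSeries.E2 τ * ModularForm.E₄ τ - ModularForm.E₆ τ) / 3 := by
  have hE2 := E2_mdifferentiable
  set f : ℍ → ℂ := fun τ => D ModularForm.E₄ τ -
    1 / 3 * (EisensteinSeries.E2 τ * ModularForm.E₄ τ) + 1 / 3 * ModularForm.E₆ τ with hf
  have hm : MDiff f :=
    ((Derivative.normalizedDerivOfComplex_mdifferentiable mdifferentiable_E4).sub
      ((mdifferentiable_const_fun _).mul (hE2.mul mdifferentiable_E4))).add
      ((mdifferentiable_const_fun _).mul mdifferentiable_E6)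
  have h0 : f = 0 := by
    -- The anomalies of E₄' and of E₂E₄/3 under S cancel, leaving weight 6; the constant terms
    -- cancel because E₂, E₄ and E₆ all tend to 1.
    refine eq_zero_of_levelOne (k := 6) (by norm_num) hm (fun τ => ?_) (fun τ => ?_) ?_
    · simp only [hf]
      rw [normalizedDeriv_comp_T mdifferentiable_E4]
      simp only [levelOne_vadd_one, E2_vadd_one]
    · simp only [hf]
      rw [normalizedDeriv_levelOne_S (k := 4) mdifferentiable_E4
        (fun τ => by simpa using! levelOne_S ModularForm.E₄ τ), E2_S,
        levelOne_S ModularForm.E₄, levelOne_S ModularForm.E₆]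
      have hpi : (Real.pi : ℂ) ≠ 0 := by exact_mod_cast Real.pi_ne_zero
      have := I_ne_zero
      simp only [zpow_ofNat]
      push_cast
      field_simp
      ring
    · have := ((tendsto_normalizedDeriv_zero mdifferentiable_E4 tendsto_E4).sub
        ((tendsto_E2.mul tendsto_E4).const_mul (1 / 3))).add (tendsto_E6.const_mul (1 / 3))
      simpa [hf] using this
  have := congrFun h0 τ
  simp only [hf, Pi.zero_apply] at this
  linear_combination this

/-- `E₆' = (E₂ E₆ - E₄²) / 2`. -/
lemma normalizedDeriv_E6 (τ : ℍ) : D ModularForm.E₆ τ =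
    (EisensteinSeries.E2 τ * ModularForm.E₆ τ - ModularForm.E₄ τ ^ 2) / 2 := by
  have hE2 := E2_mdifferentiable
  set f : ℍ → ℂ := fun τ => D ModularForm.E₆ τ -
    1 / 2 * (EisensteinSeries.E2 τ * ModularForm.E₆ τ) +
      1 / 2 * (ModularForm.E₄ τ * ModularForm.E₄ τ) with hf
  have hm : MDiff f :=
    ((Derivative.normalizedDerivOfComplex_mdifferentiable mdifferentiable_E6).sub
      ((mdifferentiable_const_fun _).mul (hE2.mul mdifferentiable_E6))).add
      ((mdifferentiable_const_fun _).mul (mdifferentiable_E4.mul mdifferentiable_E4))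
  have h0 : f = 0 := by
    refine eq_zero_of_levelOne (k := 8) (by norm_num) hm (fun τ => ?_) (fun τ => ?_) ?_
    · simp only [hf]
      rw [normalizedDeriv_comp_T mdifferentiable_E6]
      simp only [levelOne_vadd_one, E2_vadd_one]
    · simp only [hf]
      rw [normalizedDeriv_levelOne_S (k := 6) mdifferentiable_E6
        (fun τ => by simpa using! levelOne_S ModularForm.E₆ τ), E2_S,
        levelOne_S ModularForm.E₄, levelOne_S ModularForm.E₆]
      have hpi : (Real.pi : ℂ) ≠ 0 := by exact_mod_cast Real.pi_ne_zero
      have := I_ne_zero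
      simp only [zpow_ofNat]
      push_cast
      field_simp
      ring
    · have := ((tendsto_normalizedDeriv_zero mdifferentiable_E6 tendsto_E6).sub
        ((tendsto_E2.mul tendsto_E6).const_mul (1 / 2))).add
        ((tendsto_E4.mul tendsto_E4).const_mul (1 / 2))
      simpa [hf] using this
  have := congrFun h0 τ
  simp only [hf, Pi.zero_apply] at this
  linear_combination this

/-- `E₂' = (E₂² - E₄) / 12`. -/
lemma normalizedDeriv_E2 (τ : ℍ) : D EisensteinSeries.E2 τ =
    (EisensteinSeries.E2 τ ^ 2 - ModularForm.E₄ τ) / 12 := by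
  have hE2 := E2_mdifferentiable
  set f : ℍ → ℂ := fun τ => D EisensteinSeries.E2 τ -
    1 / 12 * (EisensteinSeries.E2 τ * EisensteinSeries.E2 τ) + 1 / 12 * ModularForm.E₄ τ with hf
  have hm : MDiff f :=
    ((Derivative.normalizedDerivOfComplex_mdifferentiable hE2).sub
      ((mdifferentiable_const_fun _).mul (hE2.mul hE2))).add
      ((mdifferentiable_const_fun _).mul mdifferentiable_E4)
  have h0 : f = 0 := by
    refine eq_zero_of_levelOne (k := 4) (by norm_num) hm (fun τ => ?_) (fun τ => ?_) ?_
    · simp only [hf]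
      rw [normalizedDeriv_comp_T hE2]
      simp only [levelOne_vadd_one, E2_vadd_one]
    · simp only [hf]
      have hcoe : MDiff (fun τ : ℍ => (τ : ℂ)) := mdifferentiable_coe
      have e : (fun τ : ℍ => EisensteinSeries.E2 (ModularGroup.S • τ)) =
          (fun τ : ℍ => (τ : ℂ)) ^ 2 * EisensteinSeries.E2 +
            (6 / (Real.pi * I) : ℂ) • fun τ : ℍ => (τ : ℂ) := funext fun τ => E2_S τ
      rw [normalizedDeriv_comp_S hE2, e,
        Derivative.normalizedDerivOfComplex_add _ _ ((hcoe.pow 2).mul hE2) (hcoe.const_smul _),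
        Derivative.normalizedDerivOfComplex_mul _ _ (hcoe.pow 2) hE2,
        Derivative.normalizedDerivOfComplex_pow _ _ hcoe,
        Derivative.normalizedDerivOfComplex_smul _ _ hcoe, E2_S, levelOne_S ModularForm.E₄]
      simp only [Pi.add_apply, Pi.mul_apply, Pi.pow_apply, Pi.smul_apply, normalizedDeriv_coe,
        smul_eq_mul, Pi.natCast_apply]
      have hpi : (Real.pi : ℂ) ≠ 0 := by exact_mod_cast Real.pi_ne_zero
      have := I_ne_zero
      simp only [zpow_ofNat]
      push_cast
      field_simp
      ring
    · have := ((tendsto_normalizedDeriv_zero hE2 tendsto_E2).sub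
        ((tendsto_E2.mul tendsto_E2).const_mul (1 / 12))).add (tendsto_E4.const_mul (1 / 12))
      simpa [hf] using this
  have := congrFun h0 τ
  simp only [hf, Pi.zero_apply] at this
  linear_combination this

/-! ### Theta functions: modular transformations, holomorphy, behaviour at `i∞` -/

/-- The automorphy factor `(-iτ) ^ (1/2)` of the theta functions. -/
def thetaFactor (τ : ℍ) : ℂ := (-I * τ) ^ (1 / 2 : ℂ)

lemma neg_I_mul_ne_zero (τ : ℍ) : -I * (τ : ℂ) ≠ 0 :=
  mul_ne_zero (neg_ne_zero.2 I_ne_zero) τ.ne_zero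

lemma thetaFactor_sq (τ : ℍ) : thetaFactor τ ^ 2 = -I * τ := by
  rw [thetaFactor, ← Complex.cpow_nat_mul]
  norm_num

lemma thetaFactor_pow_four (τ : ℍ) : thetaFactor τ ^ 4 = -(τ : ℂ) ^ 2 := by
  rw [show thetaFactor τ ^ 4 = (thetaFactor τ ^ 2) ^ 2 by ring, thetaFactor_sq]
  linear_combination (τ : ℂ) ^ 2 * Complex.I_sq

lemma thetaFactor_ne_zero (τ : ℍ) : thetaFactor τ ≠ 0 := by
  intro h
  have := thetaFactor_sq τ
  rw [h] at this
  exact neg_I_mul_ne_zero τ (by simpa using this.symm)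

lemma mdifferentiable_thetaFactor : MDiff thetaFactor := by
  rw [UpperHalfPlane.mdifferentiable_iff]
  have h : DifferentiableOn ℂ (fun w : ℂ => (-I * w) ^ (1 / 2 : ℂ)) upperHalfPlaneSet := by
    intro w hw
    refine (DifferentiableAt.cpow_const (by fun_prop) (Or.inl ?_)).differentiableWithinAt
    simpa using hw
  refine h.congr fun w hw => ?_
  simp [thetaFactor, ofComplex_apply_of_im_pos hw]

lemma thetaFactor_mul_normalizedDeriv (τ : ℍ) :
    thetaFactor τ * D thetaFactor τ = -1 / (4 * Real.pi) := by
  have h1 : thetaFactor * thetaFactor = (-I) • fun τ : ℍ => (τ : ℂ) := by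
    funext τ
    have := thetaFactor_sq τ
    rw [sq] at this
    simpa using this
  have h2 := congrFun (congrArg Derivative.normalizedDerivOfComplex h1) τ
  rw [Derivative.normalizedDerivOfComplex_mul _ _ mdifferentiable_thetaFactor
    mdifferentiable_thetaFactor, Derivative.normalizedDerivOfComplex_smul _ _
    mdifferentiable_coe] at h2
  simp only [Pi.add_apply, Pi.mul_apply, Pi.smul_apply, normalizedDeriv_coe, smul_eq_mul] at h2
  have hpi : (Real.pi : ℂ) ≠ 0 := by exact_mod_cast Real.pi_ne_zero
  have h3 : -I * (2 * Real.pi * I)⁻¹ = -1 / (2 * Real.pi) := by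
    have := I_ne_zero
    field_simp
  rw [h3] at h2
  have h4 : (-1 / (4 * Real.pi) : ℂ) = -1 / (2 * Real.pi) / 2 := by
    field_simp
    norm_num
  rw [h4]
  linear_combination h2 / 2

/-- Mathlib's factor is a quotient of exponentials of half logarithms; it equals the principal root
of -iτ once the logarithms add without a jump. -/
lemma eta_S (τ : ℍ) :
    ModularForm.eta (ModularGroup.S • τ : ℍ) = thetaFactor τ * ModularForm.eta τ := by
  have h := ModularForm.eta_comp_eq_csqrt_I_inv τ.2
  have hS : ((ModularGroup.S • τ : ℍ) : ℂ) = -1 / τ := by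
    rw [modular_S_smul]
    simp [neg_div]
  rw [hS]
  simp only [Function.comp_apply, Pi.smul_apply, Pi.mul_apply, smul_eq_mul] at h
  refine h.trans ?_
  rw [← mul_assoc]
  congr 1
  rw [_root_.sqrt_eq_exp I_ne_zero, _root_.sqrt_eq_exp τ.ne_zero, ← Complex.exp_neg,
    ← Complex.exp_add, thetaFactor, Complex.cpow_def_of_ne_zero (neg_I_mul_ne_zero τ)]
  -- The argument of τ lies in [0, π] and that of -i is -π/2, so their sum stays in the principal
  -- range.
  have hlog : Complex.log (-I * τ) = Complex.log (-I) + Complex.log τ := by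
    refine Complex.log_mul (neg_ne_zero.2 I_ne_zero) τ.ne_zero ?_
    have h0 : 0 ≤ (τ : ℂ).arg := Complex.arg_nonneg_iff.2 τ.im_pos.le
    have h1 := Complex.arg_le_pi (τ : ℂ)
    rw [Complex.arg_neg_I]
    constructor <;> linarith [Real.pi_pos]
  rw [hlog, Complex.log_neg_I, Complex.log_I]
  congr 1
  ring

lemma eta_vadd_one (τ : ℍ) : ModularForm.eta ((1 : ℝ) +ᵥ τ : ℍ) =
    cexp (2 * Real.pi * I / 24) * ModularForm.eta τ := by
  have h : (((1 : ℝ) +ᵥ τ : ℍ) : ℂ) = 1 + τ := by simp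
  rw [ModularForm.eta, ModularForm.eta, h, ← mul_assoc]
  congr 1
  · simp only [Function.Periodic.qParam, ← Complex.exp_add]
    congr 1
    push_cast
    ring
  · refine tprod_congr fun n => ?_
    rw [ModularForm.eta_q_eq_pow, ModularForm.eta_q_eq_pow, mul_add, Complex.exp_add, mul_one,
      Complex.exp_two_pi_mul_I, one_mul]

lemma mdifferentiable_eta : MDiff (fun τ : ℍ => ModularForm.eta τ) := by
  rw [UpperHalfPlane.mdifferentiable_iff]
  intro w hw
  refine ((ModularForm.differentiableAt_eta_of_mem_upperHalfPlaneSet hw).congr_of_eventuallyEq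
    ?_).differentiableWithinAt
  filter_upwards [isOpen_upperHalfPlaneSet.mem_nhds hw] with v hv
  simp [ofComplex_apply_of_im_pos hv]

lemma eta_ne_zero (τ : ℍ) : ModularForm.eta τ ≠ 0 := ModularForm.eta_ne_zero τ.2

/-- `η' = E₂ η / 24`. -/
lemma normalizedDeriv_eta (τ : ℍ) : D (fun τ : ℍ => ModularForm.eta τ) τ =
    EisensteinSeries.E2 τ / 24 * ModularForm.eta τ := by
  rw [normalizedDeriv_of_hasDerivAt (f := fun τ : ℍ => ModularForm.eta τ) (fun w => rfl)
    (ModularForm.differentiableAt_eta_of_mem_upperHalfPlaneSet τ.2).hasDerivAt]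
  have h := ModularForm.logDeriv_eta_eq_E2 τ
  rw [logDeriv_apply, div_eq_iff (eta_ne_zero τ)] at h
  rw [h]
  have hpi : (Real.pi : ℂ) ≠ 0 := by exact_mod_cast Real.pi_ne_zero
  have := I_ne_zero
  field_simp
  ring

/-- Dominated convergence for the infinite product as q → 0. -/
lemma tendsto_eta : Tendsto (fun τ : ℍ => qpow τ (-(1 / 24)) * ModularForm.eta τ) atImInfty
    (𝓝 1) := by
  have htprod : Tendsto (fun q : ℂ => ∏' (n : ℕ), (1 - q ^ (n + 1))) (𝓝 0) (𝓝 1) := by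
    have := tendsto_tprod_one_add_of_dominated_convergence (𝓕 := 𝓝 0) (g := 0)
      (f := fun (q : ℂ) (n : ℕ) => -q ^ (n + 1)) (bound := fun n => (1 / 2 : ℝ) ^ (n + 1))
    simp only [Pi.zero_apply, norm_neg, norm_pow, add_zero, tprod_one] at this
    simp_rw [sub_eq_add_neg]
    refine this
      (by simpa only [pow_succ'] using (summable_geometric_of_abs_lt_one (by norm_num)).mul_left _)
      (fun k => by simpa using ((continuous_pow (M := ℂ) (k + 1)).tendsto 0).neg) ?_
    filter_upwards [Metric.ball_mem_nhds (0 : ℂ) (by norm_num : (0 : ℝ) < 1 / 2)] with q hq k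
    exact pow_le_pow_left₀ (norm_nonneg _) (mem_ball_zero_iff.mp hq).le _
  refine (htprod.comp (qParam_tendsto_atImInfty one_pos)).congr fun τ => ?_
  have h1 : Function.Periodic.qParam 24 (τ : ℂ) = qpow τ (1 / 24) := by
    simp only [Function.Periodic.qParam, qpow]
    congr 1
    push_cast
    ring
  rw [ModularForm.eta, ← mul_assoc, h1, ← qpow_add, neg_add_cancel, qpow_zero, one_mul]
  rfl

lemma theta3_eq (τ : ℍ) : theta3 τ = jacobiTheta₂ 0 τ := by
  rw [theta3, jacobiTheta₂]
  refine tsum_congr fun n => ?_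
  rw [qpow, jacobiTheta₂_term]
  congr 1
  ring

lemma cexp_pi_I_int (n : ℤ) : cexp (Real.pi * I * n) = (-1) ^ n := by
  rw [mul_comm, Complex.exp_int_mul, Complex.exp_pi_mul_I]

lemma theta0_eq (τ : ℍ) : theta0 τ = jacobiTheta₂ (1 / 2) τ := by
  rw [theta0, jacobiTheta₂]
  refine tsum_congr fun n => ?_
  rw [qpow, jacobiTheta₂_term, ← cexp_pi_I_int, ← Complex.exp_add]
  congr 1
  ring

lemma theta2_eq (τ : ℍ) : theta2 τ = qpow τ (1 / 8) * jacobiTheta₂ (τ / 2) τ := by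
  rw [theta2, jacobiTheta₂, ← tsum_mul_left]
  refine tsum_congr fun n => ?_
  rw [qpow, qpow, jacobiTheta₂_term, ← Complex.exp_add]
  congr 1
  ring

lemma coe_S_smul (τ : ℍ) : ((ModularGroup.S • τ : ℍ) : ℂ) = -1 / τ := by
  rw [modular_S_smul]
  simp [neg_div]

lemma theta3_S (τ : ℍ) : theta3 (ModularGroup.S • τ) = thetaFactor τ * theta3 τ := by
  rw [theta3_eq, theta3_eq, coe_S_smul, jacobiTheta₂_functional_equation 0 τ, ← thetaFactor]
  have := thetaFactor_ne_zero τ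
  simp
  field_simp

lemma theta2_S (τ : ℍ) : theta2 (ModularGroup.S • τ) = thetaFactor τ * theta0 τ := by
  rw [theta2_eq, theta0_eq, coe_S_smul, jacobiTheta₂_functional_equation (1 / 2) τ, ← thetaFactor]
  have h := thetaFactor_ne_zero τ
  have h0 := τ.ne_zero
  rw [← jacobiTheta₂_neg_left, ← mul_assoc, ← mul_assoc, mul_one_div_cancel h, one_mul]
  congr 1
  · rw [qpow, coe_S_smul]
    congr 1
    field_simp
    norm_num
  · congr 1
    field_simp

lemma theta0_S (τ : ℍ) : theta0 (ModularGroup.S • τ) = thetaFactor τ * theta2 τ := by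
  have h := thetaFactor_ne_zero τ
  have h0 := τ.ne_zero
  rw [theta2_eq, theta0_eq, coe_S_smul, jacobiTheta₂_functional_equation (τ / 2) τ, ← thetaFactor]
  have h1 : (τ : ℂ) / 2 / τ = 1 / 2 := by field_simp
  have h2 : cexp (-Real.pi * I * ((τ : ℂ) / 2) ^ 2 / τ) = qpow τ (-(1 / 8)) := by
    rw [qpow]
    congr 1
    field_simp
    norm_num
  rw [h1, h2, qpow_neg]
  have := qpow_ne_zero τ (1 / 8)
  field_simp

/-- Integers n and n² have the same parity, so the new factor exp(πi n²) equals exp(πi n), which is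
a shift of z by 1/2. -/
lemma jacobiTheta₂_add_one (z τ : ℂ) : jacobiTheta₂ z (1 + τ) = jacobiTheta₂ (z + 1 / 2) τ := by
  refine tsum_congr fun n => ?_
  have h : cexp (Real.pi * I * n ^ 2) = cexp (Real.pi * I * n) := by
    have h1 : (Real.pi * I * n ^ 2 : ℂ) = Real.pi * I * ((n ^ 2 : ℤ) : ℂ) := by push_cast; ring
    rw [h1, cexp_pi_I_int, cexp_pi_I_int]
    rcases Int.even_or_odd n with hn | hn
    · rw [hn.neg_one_zpow, (hn.pow_of_ne_zero two_ne_zero).neg_one_zpow]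
    · rw [hn.neg_one_zpow, (hn.pow).neg_one_zpow]
  rw [jacobiTheta₂_term, jacobiTheta₂_term,
    show (2 * Real.pi * I * n * z + Real.pi * I * n ^ 2 * (1 + τ) : ℂ) =
      Real.pi * I * n ^ 2 + (2 * Real.pi * I * n * z + Real.pi * I * n ^ 2 * τ) by ring,
    Complex.exp_add, h, ← Complex.exp_add]
  congr 1
  ring

lemma theta3_vadd_one (τ : ℍ) : theta3 ((1 : ℝ) +ᵥ τ) = theta0 τ := by
  rw [theta3_eq, theta0_eq, coe_vadd, ofReal_one, jacobiTheta₂_add_one, zero_add]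

lemma theta0_vadd_one (τ : ℍ) : theta0 ((1 : ℝ) +ᵥ τ) = theta3 τ := by
  rw [theta3_eq, theta0_eq, coe_vadd, ofReal_one, jacobiTheta₂_add_one, ← jacobiTheta₂_add_left 0]
  norm_num

lemma theta2_vadd_one (τ : ℍ) :
    theta2 ((1 : ℝ) +ᵥ τ) = cexp (2 * Real.pi * I / 8) * theta2 τ := by
  rw [theta2_eq, theta2_eq, coe_vadd, ofReal_one, jacobiTheta₂_add_one, ← mul_assoc]
  congr 1
  · rw [qpow, qpow, ← Complex.exp_add, coe_vadd]
    congr 1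
    push_cast
    ring
  · rw [← jacobiTheta₂_add_left (τ / 2)]
    congr 1
    ring

lemma mdifferentiable_jacobiTheta₂ {z : ℂ → ℂ} (hz : Differentiable ℂ z) :
    MDiff (fun τ : ℍ => jacobiTheta₂ (z τ) τ) := by
  rw [UpperHalfPlane.mdifferentiable_iff]
  intro w hw
  have h1 : DifferentiableAt ℂ (fun w : ℂ => (z w, w)) w := (hz w).prodMk differentiableAt_id
  have h2 := (hasFDerivAt_jacobiTheta₂ (z w) (τ := w) hw).differentiableAt
  have h3 := DifferentiableAt.comp (f := fun w : ℂ => (z w, w)) w h2 h1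
  refine (h3.congr_of_eventuallyEq ?_).differentiableWithinAt
  filter_upwards [isOpen_upperHalfPlaneSet.mem_nhds hw] with v hv
  simp [ofComplex_apply_of_im_pos hv]

lemma mdifferentiable_theta3 : MDiff theta3 := by
  rw [funext theta3_eq]
  exact mdifferentiable_jacobiTheta₂ (z := fun _ => 0) (by fun_prop)

lemma mdifferentiable_theta0 : MDiff theta0 := by
  rw [funext theta0_eq]
  exact mdifferentiable_jacobiTheta₂ (z := fun _ => 1 / 2) (by fun_prop)

lemma mdifferentiable_theta2 : MDiff theta2 := by
  rw [funext theta2_eq]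
  exact (mdifferentiable_qpow _).mul
    (mdifferentiable_jacobiTheta₂ (z := fun w => w / 2) (by fun_prop))

lemma summable_qpow_sq (τ : ℍ) (ε : ℂ) :
    Summable fun n : ℤ => qpow τ (((n : ℂ) + ε) ^ 2 / 2) := by
  have h := (summable_jacobiTheta₂_term_iff (ε * τ) τ).2 τ.im_pos
  refine (h.mul_left (qpow τ (ε ^ 2 / 2))).congr fun n => ?_
  rw [qpow, qpow, jacobiTheta₂_term, ← Complex.exp_add]
  congr 1
  ring

/-- The leading behaviour at `i∞` of a theta series. -/
lemma tendsto_theta_series {c : ℤ → ℂ} {C : ℝ} (hc : ∀ n, ‖c n‖ ≤ C) (ε δ : ℝ)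
    (h : ∀ n : ℤ, c n = 0 ∨ δ ≤ ((n : ℝ) + ε) ^ 2 / 2) :
    Tendsto (fun τ : ℍ => qpow τ (-δ) * ∑' n : ℤ, c n * qpow τ (((n : ℂ) + ε) ^ 2 / 2)) atImInfty
      (𝓝 (∑' n : ℤ, if ((n : ℝ) + ε) ^ 2 / 2 = δ then c n else 0)) := by
  set e : ℤ → ℝ := fun n => ((n : ℝ) + ε) ^ 2 / 2 - δ with he
  have hterm (τ : ℍ) (n : ℤ) : qpow τ (-δ) * (c n * qpow τ (((n : ℂ) + ε) ^ 2 / 2)) =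
      c n * qpow τ (e n) := by
    rw [mul_left_comm, ← qpow_add]
    congr 2
    simp only [he]
    push_cast
    ring
  simp only [← tsum_mul_left, hterm]
  have hexp (n : ℤ) : e n = 0 ↔ ((n : ℝ) + ε) ^ 2 / 2 = δ := sub_eq_zero
  simp only [← hexp]
  -- Once δ is subtracted, the exponents of all terms with nonzero coefficient are non-negative, so
  -- for Im τ ≥ 1 each term is dominated by its size at τ = i.
  refine tendsto_tsum_of_dominated_convergence
    (bound := fun n => C * ‖qpow UpperHalfPlane.I (e n)‖) ?_ ?_ ?_
  · refine Summable.mul_left C ?_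
    have := ((summable_qpow_sq UpperHalfPlane.I ε).mul_left (qpow UpperHalfPlane.I (-δ))).norm
    refine this.congr fun n => ?_
    rw [← qpow_add]
    congr 2
    simp only [he]
    push_cast
    ring
  · intro n
    by_cases h0 : e n = 0
    · simp only [h0, ofReal_zero, qpow_zero, mul_one, if_true]
      exact tendsto_const_nhds
    · rw [if_neg h0]
      rcases h n with hn | hn
      · simp [hn]
      · have hpos : 0 < e n := lt_of_le_of_ne (sub_nonneg.2 hn) (Ne.symm h0)
        rw [show (0 : ℂ) = c n * 0 by ring]
        refine Tendsto.const_mul _ ?_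
        rw [tendsto_zero_iff_norm_tendsto_zero]
        simp only [norm_qpow_ofReal]
        refine Real.tendsto_exp_atBot.comp ?_
        have h1 : Tendsto (fun τ : ℍ => τ.im) atImInfty atTop := tendsto_comap
        refine h1.const_mul_atTop_of_neg ?_
        have := mul_pos Real.pi_pos hpos
        linarith
  · refine (atImInfty_mem _).2 ⟨1, fun τ hτ n => ?_⟩
    rw [norm_mul]
    rcases h n with hn | hn
    · rw [hn, norm_zero, zero_mul]
      exact mul_nonneg ((norm_nonneg _).trans (hc n)) (norm_nonneg _)
    · refine mul_le_mul (hc n) ?_ (norm_nonneg _) ((norm_nonneg _).trans (hc n))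
      rw [norm_qpow_ofReal, norm_qpow_ofReal, UpperHalfPlane.I_im]
      refine Real.exp_le_exp.2 ?_
      have h1 : 0 ≤ Real.pi * e n := mul_nonneg Real.pi_pos.le (sub_nonneg.2 hn)
      nlinarith [mul_le_mul_of_nonneg_left hτ h1]

lemma tendsto_theta3 : Tendsto theta3 atImInfty (𝓝 1) := by
  have h := tendsto_theta_series (c := fun _ => 1) (C := 1) (fun _ => by simp) 0 0
    (fun n => Or.inr (by positivity))
  rw [tsum_eq_single 0 fun n hn => by simp [hn]] at h
  refine Tendsto.congr (fun τ => ?_) (by simpa using h)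
  simp [theta3, qpow_zero]

lemma tendsto_theta0 : Tendsto theta0 atImInfty (𝓝 1) := by
  have h := tendsto_theta_series (c := fun n => (-1) ^ n) (C := 1) (fun n => by simp) 0 0
    (fun n => Or.inr (by positivity))
  rw [tsum_eq_single 0 fun n hn => by simp [hn]] at h
  refine Tendsto.congr (fun τ => ?_) (by simpa using h)
  simp [theta0, qpow_zero]

lemma tendsto_theta2 : Tendsto (fun τ => qpow τ (-(1 / 8)) * theta2 τ) atImInfty (𝓝 2) := by
  have hsq (n : ℤ) : ((n : ℝ) + 1 / 2) ^ 2 / 2 = (n * (n + 1) : ℤ) / 2 + 1 / 8 := by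
    push_cast
    ring
  have h := tendsto_theta_series (c := fun _ => 1) (C := 1) (fun _ => by simp) (1 / 2) (1 / 8)
    (fun n => Or.inr (by
      rw [hsq]
      have : 0 ≤ n * (n + 1) := by
        rcases le_or_gt 0 n with hn | hn
        · positivity
        · nlinarith
      have h2 : (0 : ℝ) ≤ (n * (n + 1) : ℤ) := by exact_mod_cast this
      linarith))
  have h2 : (∑' n : ℤ, if ((n : ℝ) + 1 / 2) ^ 2 / 2 = 1 / 8 then (1 : ℂ) else 0) = 2 := by
    -- The minimum 1/8 of (n + 1/2)²/2 is attained at both n = 0 and n = -1, whence the limit 2.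
    rw [tsum_eq_sum (s := {0, -1})]
    · rw [Finset.sum_pair (by norm_num)]
      norm_num
    · intro n hn
      rw [if_neg]
      rw [hsq]
      intro h3
      have h4 : ((n * (n + 1) : ℤ) : ℝ) = 0 := by linarith
      have h5 : n * (n + 1) = 0 := by exact_mod_cast h4
      rcases mul_eq_zero.1 h5 with h6 | h6
      · exact hn (by simp [h6])
      · exact hn (by simp [eq_neg_of_add_eq_zero_left h6])
  rw [h2] at h
  refine h.congr fun τ => ?_
  simp [theta2]

lemma tendsto_theta3_sub_theta0 :
    Tendsto (fun τ => qpow τ (-(1 / 2)) * (theta3 τ - theta0 τ)) atImInfty (𝓝 4) := by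
  have h := tendsto_theta_series (c := fun n => 1 - (-1) ^ n) (C := 2)
    (fun n => (norm_sub_le _ _).trans (by simp; norm_num)) 0 (1 / 2) (fun n => by
      rcases eq_or_ne n 0 with rfl | hn
      · simp
      · right
        have : 0 < n ^ 2 := by positivity
        have h2 : (1 : ℝ) ≤ (n : ℝ) ^ 2 := by exact_mod_cast Int.add_one_le_of_lt this
        rw [add_zero]
        linarith)
  have h2 : (∑' n : ℤ, if ((n : ℝ) + 0) ^ 2 / 2 = 1 / 2 then (1 - (-1) ^ n : ℂ) else 0) = 4 := by
    -- Even n cancel between θ₃ and θ₀; n = ±1 each contribute 2.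
    rw [tsum_eq_sum (s := {1, -1})]
    · norm_num
    · intro n hn
      rw [if_neg]
      intro h3
      have h4 : (n : ℝ) ^ 2 = 1 := by
        rw [add_zero] at h3
        linarith
      have h5 : n ^ 2 = 1 := by exact_mod_cast h4
      rcases sq_eq_one_iff.1 h5 with h6 | h6 <;> exact hn (by simp [h6])
  rw [h2] at h
  refine h.congr fun τ => ?_
  have s1 := summable_qpow_sq τ 0
  have s2 : Summable fun n : ℤ => (-1 : ℂ) ^ n * qpow τ (((n : ℂ) + 0) ^ 2 / 2) := by
    refine Summable.of_norm (s1.norm.congr fun n => ?_)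
    simp
  rw [theta3, theta0]
  simp only [add_zero] at s1 s2
  rw [← s1.tsum_sub s2]
  simp [sub_mul]

/-! ### Theta identities -/

lemma cexp_eighth_pow_four : cexp (2 * Real.pi * I / 8) ^ 4 = -1 := by
  rw [← Complex.exp_nat_mul, ← Complex.exp_pi_mul_I]
  congr 1
  push_cast
  ring

lemma theta2_pow_four_vadd_one (τ : ℍ) : theta2 ((1 : ℝ) +ᵥ τ) ^ 4 = -theta2 τ ^ 4 := by
  rw [theta2_vadd_one, mul_pow, cexp_eighth_pow_four, neg_one_mul]

lemma theta3_pow_four_S (τ : ℍ) :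
    theta3 (ModularGroup.S • τ) ^ 4 = -(τ : ℂ) ^ 2 * theta3 τ ^ 4 := by
  rw [theta3_S, mul_pow, thetaFactor_pow_four]

lemma theta2_pow_four_S (τ : ℍ) :
    theta2 (ModularGroup.S • τ) ^ 4 = -(τ : ℂ) ^ 2 * theta0 τ ^ 4 := by
  rw [theta2_S, mul_pow, thetaFactor_pow_four]

lemma theta0_pow_four_S (τ : ℍ) :
    theta0 (ModularGroup.S • τ) ^ 4 = -(τ : ℂ) ^ 2 * theta2 τ ^ 4 := by
  rw [theta0_S, mul_pow, thetaFactor_pow_four]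

lemma tendsto_qpow_atImInfty {r : ℝ} (hr : 0 < r) :
    Tendsto (fun τ : ℍ => qpow τ r) atImInfty (𝓝 0) := by
  rw [tendsto_zero_iff_norm_tendsto_zero]
  simp only [norm_qpow_ofReal]
  refine Real.tendsto_exp_atBot.comp ?_
  have h1 : Tendsto (fun τ : ℍ => τ.im) atImInfty atTop := tendsto_comap
  refine h1.const_mul_atTop_of_neg ?_
  have := mul_pos Real.pi_pos hr
  linarith

lemma theta2_tendsto_zero : Tendsto theta2 atImInfty (𝓝 0) := by
  have h := (tendsto_qpow_atImInfty (r := 1 / 8) (by norm_num)).mul tendsto_theta2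
  rw [zero_mul] at h
  refine h.congr fun τ => ?_
  rw [← mul_assoc, ← qpow_add]
  simp [qpow_zero]

lemma theta2_pow_four_tendsto_zero : Tendsto (fun τ => theta2 τ ^ 4) atImInfty (𝓝 0) := by
  simpa using theta2_tendsto_zero.pow 4

lemma theta3_pow_four_tendsto : Tendsto (fun τ => theta3 τ ^ 4) atImInfty (𝓝 1) := by
  simpa using tendsto_theta3.pow 4

lemma theta0_pow_four_tendsto : Tendsto (fun τ => theta0 τ ^ 4) atImInfty (𝓝 1) := by
  simpa using tendsto_theta0.pow 4

lemma mdifferentiable_theta2_pow_four : MDiff (fun τ => theta2 τ ^ 4) :=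
  mdifferentiable_theta2.pow 4

lemma mdifferentiable_theta3_pow_four : MDiff (fun τ => theta3 τ ^ 4) :=
  mdifferentiable_theta3.pow 4

lemma mdifferentiable_theta0_pow_four : MDiff (fun τ => theta0 τ ^ 4) :=
  mdifferentiable_theta0.pow 4

/-- Jacobi's identity. -/
lemma theta3_pow_four (τ : ℍ) : theta3 τ ^ 4 = theta2 τ ^ 4 + theta0 τ ^ 4 := by
  set f : ℍ → ℂ := fun τ => theta3 τ ^ 4 - theta2 τ ^ 4 - theta0 τ ^ 4 with hf
  have hm : MDiff f := (mdifferentiable_theta3_pow_four.sub mdifferentiable_theta2_pow_four).sub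
    mdifferentiable_theta0_pow_four
  -- T sends f to -f and S sends it to -τ² f, so only the square is a level one form, of weight 4.
  have h0 : f * f = 0 := by
    refine eq_zero_of_levelOne (k := 4) (by norm_num) (hm.mul hm) (fun τ => ?_) (fun τ => ?_) ?_
    · simp only [hf, Pi.mul_apply]
      rw [theta2_pow_four_vadd_one, theta3_vadd_one, theta0_vadd_one]
      ring
    · simp only [hf, Pi.mul_apply]
      rw [theta2_pow_four_S, theta3_pow_four_S, theta0_pow_four_S, zpow_ofNat]
      ring
    · have h := (theta3_pow_four_tendsto.sub theta2_pow_four_tendsto_zero).sub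
        theta0_pow_four_tendsto
      simpa using! h.mul h
  have h1 := congrFun h0 τ
  simp only [Pi.mul_apply, Pi.zero_apply, mul_self_eq_zero, hf] at h1
  linear_combination h1

/-- `E₄` in terms of theta functions. -/
lemma E4_eq_theta (τ : ℍ) : ModularForm.E₄ τ =
    theta2 τ ^ 8 + theta2 τ ^ 4 * theta0 τ ^ 4 + theta0 τ ^ 8 := by
  have m2 := mdifferentiable_theta2_pow_four
  have m3 := mdifferentiable_theta3_pow_four
  have m0 := mdifferentiable_theta0_pow_four
  -- Up to a common factor, S and T permute the three fourth powers with signs, so the sum of their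
  -- squares is modular; its limit at i∞ is 2. Jacobi's identity then eliminates θ₃.
  set f : ℍ → ℂ := fun τ => theta2 τ ^ 4 * theta2 τ ^ 4 + theta3 τ ^ 4 * theta3 τ ^ 4 +
    theta0 τ ^ 4 * theta0 τ ^ 4 - 2 * ModularForm.E₄ τ with hf
  have hm : MDiff f := (((m2.mul m2).add (m3.mul m3)).add (m0.mul m0)).sub
    ((mdifferentiable_const_fun 2).mul mdifferentiable_E4)
  have h0 : f = 0 := by
    refine eq_zero_of_levelOne (k := 4) (by norm_num) hm (fun τ => ?_) (fun τ => ?_) ?_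
    · simp only [hf]
      rw [theta2_pow_four_vadd_one, theta3_vadd_one, theta0_vadd_one, levelOne_vadd_one]
      ring
    · simp only [hf]
      rw [theta2_pow_four_S, theta3_pow_four_S, theta0_pow_four_S, levelOne_S ModularForm.E₄]
      simp only [zpow_ofNat]
      ring
    · have t2 := theta2_pow_four_tendsto_zero
      have t3 := theta3_pow_four_tendsto
      have t0 := theta0_pow_four_tendsto
      have h := (((t2.mul t2).add (t3.mul t3)).add (t0.mul t0)).sub (tendsto_E4.const_mul 2)
      have e : (0 * 0 + 1 * 1 + 1 * 1 - 2 * 1 : ℂ) = 0 := by norm_num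
      rwa [e] at h
  have h1 := congrFun h0 τ
  simp only [Pi.zero_apply, hf, theta3_pow_four] at h1
  linear_combination -h1 / 2

/-- `E₆` in terms of theta functions. -/
lemma E6_eq_theta (τ : ℍ) : ModularForm.E₆ τ =
    (2 * theta2 τ ^ 4 + theta0 τ ^ 4) * (theta2 τ ^ 4 + 2 * theta0 τ ^ 4) *
      (theta0 τ ^ 4 - theta2 τ ^ 4) / 2 := by
  have m2 := mdifferentiable_theta2_pow_four
  have m3 := mdifferentiable_theta3_pow_four
  have m0 := mdifferentiable_theta0_pow_four
  set f : ℍ → ℂ := fun τ => (theta2 τ ^ 4 + theta3 τ ^ 4) * (theta3 τ ^ 4 + theta0 τ ^ 4) *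
    (theta0 τ ^ 4 - theta2 τ ^ 4) - 2 * ModularForm.E₆ τ with hf
  have hm : MDiff f := (((m2.add m3).mul (m3.add m0)).mul (m0.sub m2)).sub
    ((mdifferentiable_const_fun 2).mul mdifferentiable_E6)
  have h0 : f = 0 := by
    refine eq_zero_of_levelOne (k := 6) (by norm_num) hm (fun τ => ?_) (fun τ => ?_) ?_
    · simp only [hf]
      rw [theta2_pow_four_vadd_one, theta3_vadd_one, theta0_vadd_one, levelOne_vadd_one]
      ring
    · simp only [hf]
      rw [theta2_pow_four_S, theta3_pow_four_S, theta0_pow_four_S, levelOne_S ModularForm.E₆]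
      simp only [zpow_ofNat]
      ring
    · have t2 := theta2_pow_four_tendsto_zero
      have t3 := theta3_pow_four_tendsto
      have t0 := theta0_pow_four_tendsto
      have h := (((t2.add t3).mul (t3.add t0)).mul (t0.sub t2)).sub (tendsto_E6.const_mul 2)
      have e : ((0 + 1) * (1 + 1) * (1 - 0) - 2 * 1 : ℂ) = 0 := by norm_num
      rwa [e] at h
  have h1 := congrFun h0 τ
  simp only [Pi.zero_apply, hf, theta3_pow_four] at h1
  linear_combination -h1 / 2

/-! ### Logarithmic derivatives of the theta functions -/

/-- The logarithmic derivative of (-iτ)^(1/2) is 1/(4πiτ), and 24τ² times this is exactly the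
anomaly of E₂ in `E2_S`; hence 24θ' - E₂θ transforms without anomaly. -/
lemma normalizedDeriv_S_of_thetaFactor {θ φ : ℍ → ℂ} (hθ : MDiff θ) (hφ : MDiff φ)
    (h : ∀ τ : ℍ, θ (ModularGroup.S • τ) = thetaFactor τ * φ τ) (τ : ℍ) :
    24 * D θ (ModularGroup.S • τ) = thetaFactor τ *
      ((τ : ℂ) ^ 2 * (24 * D φ τ) + 6 / (Real.pi * I) * τ * φ τ) := by
  rw [normalizedDeriv_comp_S hθ, show (fun τ : ℍ => θ (ModularGroup.S • τ)) = thetaFactor * φ from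
    funext h, Derivative.normalizedDerivOfComplex_mul _ _ mdifferentiable_thetaFactor hφ]
  simp only [Pi.add_apply, Pi.mul_apply]
  have h1 := thetaFactor_mul_normalizedDeriv τ
  have h2 := thetaFactor_sq τ
  have h3 := thetaFactor_ne_zero τ
  have h0 := τ.ne_zero
  have hpi : (Real.pi : ℂ) ≠ 0 := by exact_mod_cast Real.pi_ne_zero
  have h4 : D thetaFactor τ = thetaFactor τ / (4 * Real.pi * I * τ) := by
    have h5 : D thetaFactor τ = (thetaFactor τ * D thetaFactor τ) * thetaFactor τ /
        thetaFactor τ ^ 2 := by field_simp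
    rw [h5, h1, h2]
    have := I_ne_zero
    field_simp
  rw [h4]
  have := I_ne_zero
  field_simp
  ring

/-- The defect of the formula `24 θ' = (E₂ + w) θ`. -/
def thetaDefect (θ w : ℍ → ℂ) (τ : ℍ) : ℂ :=
  24 * D θ τ - (EisensteinSeries.E2 τ + w τ) * θ τ

lemma mdifferentiable_thetaDefect {θ w : ℍ → ℂ} (hθ : MDiff θ) (hw : MDiff w) :
    MDiff (thetaDefect θ w) :=
  ((mdifferentiable_const_fun 24).mul (Derivative.normalizedDerivOfComplex_mdifferentiable hθ)).sub
    ((E2_mdifferentiable.add hw).mul hθ)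

lemma thetaDefect_S {θ φ w v : ℍ → ℂ} (hθ : MDiff θ) (hφ : MDiff φ)
    (h : ∀ τ : ℍ, θ (ModularGroup.S • τ) = thetaFactor τ * φ τ)
    (hw : ∀ τ : ℍ, w (ModularGroup.S • τ) = (τ : ℂ) ^ 2 * v τ) (τ : ℍ) :
    thetaDefect θ w (ModularGroup.S • τ) = thetaFactor τ * (τ : ℂ) ^ 2 * thetaDefect φ v τ := by
  rw [thetaDefect, thetaDefect, normalizedDeriv_S_of_thetaFactor hθ hφ h, E2_S, hw, h]
  ring

lemma thetaDefect_vadd_one {θ φ w v : ℍ → ℂ} (hθ : MDiff θ) (hφ : MDiff φ) {c : ℂ}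
    (h : ∀ τ : ℍ, θ ((1 : ℝ) +ᵥ τ) = c * φ τ) (hw : ∀ τ : ℍ, w ((1 : ℝ) +ᵥ τ) = v τ) (τ : ℍ) :
    thetaDefect θ w ((1 : ℝ) +ᵥ τ) = c * thetaDefect φ v τ := by
  rw [thetaDefect, thetaDefect, normalizedDeriv_comp_T hθ, E2_vadd_one, hw,
    show (fun τ : ℍ => θ ((1 : ℝ) +ᵥ τ)) = c • φ from funext h,
    Derivative.normalizedDerivOfComplex_smul _ _ hφ, h, Pi.smul_apply, smul_eq_mul]
  ring

lemma thetaDefect_tendsto_zero {θ w : ℍ → ℂ} (hθ : MDiff θ) (h1 : Tendsto θ atImInfty (𝓝 1))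
    (h2 : Tendsto w atImInfty (𝓝 (-1))) : Tendsto (thetaDefect θ w) atImInfty (𝓝 0) := by
  have h := ((tendsto_normalizedDeriv_zero hθ h1).const_mul 24).sub ((tendsto_E2.add h2).mul h1)
  have e : (24 * 0 - (1 + -1) * 1 : ℂ) = 0 := by norm_num
  rwa [e] at h

/-- The weight attached to `θ₂`. -/
def weight2 (τ : ℍ) : ℂ := theta2 τ ^ 4 + 2 * theta0 τ ^ 4

/-- The weight attached to `θ₃`. -/
def weight3 (τ : ℍ) : ℂ := theta2 τ ^ 4 - theta0 τ ^ 4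

/-- The weight attached to `θ₀`. -/
def weight0 (τ : ℍ) : ℂ := -(2 * theta2 τ ^ 4) - theta0 τ ^ 4

lemma mdifferentiable_weight2 : MDiff weight2 :=
  mdifferentiable_theta2_pow_four.add
    ((mdifferentiable_const_fun 2).mul mdifferentiable_theta0_pow_four)

lemma mdifferentiable_weight3 : MDiff weight3 :=
  mdifferentiable_theta2_pow_four.sub mdifferentiable_theta0_pow_four

lemma mdifferentiable_weight0 : MDiff weight0 :=
  ((mdifferentiable_const_fun 2).mul mdifferentiable_theta2_pow_four).neg.sub
    mdifferentiable_theta0_pow_four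

lemma weight2_vadd_one (τ : ℍ) : weight2 ((1 : ℝ) +ᵥ τ) = weight2 τ := by
  rw [weight2, weight2, theta2_pow_four_vadd_one, theta0_vadd_one, theta3_pow_four]
  ring

lemma weight3_vadd_one (τ : ℍ) : weight3 ((1 : ℝ) +ᵥ τ) = weight0 τ := by
  rw [weight3, weight0, theta2_pow_four_vadd_one, theta0_vadd_one, theta3_pow_four]
  ring

lemma weight0_vadd_one (τ : ℍ) : weight0 ((1 : ℝ) +ᵥ τ) = weight3 τ := by
  rw [weight0, weight3, theta2_pow_four_vadd_one, theta0_vadd_one, theta3_pow_four]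
  ring

lemma weight2_S (τ : ℍ) : weight2 (ModularGroup.S • τ) = (τ : ℂ) ^ 2 * weight0 τ := by
  rw [weight2, weight0, theta2_pow_four_S, theta0_pow_four_S]
  ring

lemma weight3_S (τ : ℍ) : weight3 (ModularGroup.S • τ) = (τ : ℂ) ^ 2 * weight3 τ := by
  rw [weight3, weight3, theta2_pow_four_S, theta0_pow_four_S]
  ring

lemma weight0_S (τ : ℍ) : weight0 (ModularGroup.S • τ) = (τ : ℂ) ^ 2 * weight2 τ := by
  rw [weight0, weight2, theta2_pow_four_S, theta0_pow_four_S]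
  ring

/-- Since θ₂ ~ 2q^(1/8), the leading terms are 24 · (1/8) · 2 and (1 + 2) · 2, and they cancel. -/
lemma tendsto_thetaDefect_theta2 :
    Tendsto (fun τ => qpow τ (-(1 / 8)) * thetaDefect theta2 weight2 τ) atImInfty (𝓝 0) := by
  set u : ℍ → ℂ := fun τ => qpow τ (-(1 / 8)) * theta2 τ with hu
  have hum : MDiff u := (mdifferentiable_qpow _).mul mdifferentiable_theta2
  have hDu := tendsto_normalizedDeriv_zero hum tendsto_theta2
  have h2 : Tendsto weight2 atImInfty (𝓝 (0 + 2 * 1)) :=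
    theta2_pow_four_tendsto_zero.add (theta0_pow_four_tendsto.const_mul 2)
  have h := ((hDu.add (tendsto_theta2.const_mul (1 / 8))).const_mul 24).sub
    ((tendsto_E2.add h2).mul tendsto_theta2)
  have e : (24 * (0 + 1 / 8 * 2) - (1 + (0 + 2 * 1)) * 2 : ℂ) = 0 := by norm_num
  rw [e] at h
  refine h.congr fun τ => ?_
  have hD : D u τ = -(1 / 8) * qpow τ (-(1 / 8)) * theta2 τ + qpow τ (-(1 / 8)) * D theta2 τ := by
    rw [show u = (fun τ : ℍ => qpow τ (-(1 / 8))) * theta2 from rfl,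
      Derivative.normalizedDerivOfComplex_mul _ _ (mdifferentiable_qpow _) mdifferentiable_theta2]
    simp only [Pi.add_apply, Pi.mul_apply, normalizedDeriv_qpow]
  rw [hD, thetaDefect]
  ring

lemma tendsto_eta_pow (l : ℕ) :
    Tendsto (fun τ : ℍ => qpow τ (-(l / 24)) * ModularForm.eta τ ^ l) atImInfty (𝓝 1) := by
  have h := tendsto_eta.pow l
  rw [one_pow] at h
  refine h.congr fun τ => ?_
  rw [mul_pow, ← qpow_nat_mul]
  congr 2
  ring

/-- S and T permute the three defects up to automorphy factors. Each has weight 5/2, so their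
product divided by η³ is a level one form of weight 6, and it vanishes at i∞. Hence the product is
zero, one factor is zero by the identity theorem, and the permutations carry this to the other two.
-/
lemma thetaDefect_eq_zero : thetaDefect theta2 weight2 = 0 ∧ thetaDefect theta3 weight3 = 0 ∧
    thetaDefect theta0 weight0 = 0 := by
  set g2 := thetaDefect theta2 weight2
  set g3 := thetaDefect theta3 weight3
  set g0 := thetaDefect theta0 weight0
  have m2 : MDiff g2 := mdifferentiable_thetaDefect mdifferentiable_theta2 mdifferentiable_weight2
  have m3 : MDiff g3 := mdifferentiable_thetaDefect mdifferentiable_theta3 mdifferentiable_weight3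
  have m0 : MDiff g0 := mdifferentiable_thetaDefect mdifferentiable_theta0 mdifferentiable_weight0
  have s2 : ∀ τ : ℍ, g2 (ModularGroup.S • τ) = thetaFactor τ * (τ : ℂ) ^ 2 * g0 τ :=
    thetaDefect_S mdifferentiable_theta2 mdifferentiable_theta0 theta2_S weight2_S
  have s3 : ∀ τ : ℍ, g3 (ModularGroup.S • τ) = thetaFactor τ * (τ : ℂ) ^ 2 * g3 τ :=
    thetaDefect_S mdifferentiable_theta3 mdifferentiable_theta3 theta3_S weight3_S
  have s0 : ∀ τ : ℍ, g0 (ModularGroup.S • τ) = thetaFactor τ * (τ : ℂ) ^ 2 * g2 τ :=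
    thetaDefect_S mdifferentiable_theta0 mdifferentiable_theta2 theta0_S weight0_S
  have t2 : ∀ τ : ℍ, g2 ((1 : ℝ) +ᵥ τ) = cexp (2 * Real.pi * I / 8) * g2 τ :=
    thetaDefect_vadd_one mdifferentiable_theta2 mdifferentiable_theta2 theta2_vadd_one
      weight2_vadd_one
  have t3 : ∀ τ : ℍ, g3 ((1 : ℝ) +ᵥ τ) = 1 * g0 τ :=
    thetaDefect_vadd_one mdifferentiable_theta3 mdifferentiable_theta0
      (fun τ => by rw [theta3_vadd_one, one_mul]) weight3_vadd_one
  have t0 : ∀ τ : ℍ, g0 ((1 : ℝ) +ᵥ τ) = 1 * g3 τ :=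
    thetaDefect_vadd_one mdifferentiable_theta0 mdifferentiable_theta3
      (fun τ => by rw [theta0_vadd_one, one_mul]) weight0_vadd_one
  have hprod : g2 * g3 * g0 = 0 := by
    set f : ℍ → ℂ := fun τ => (g2 τ * g3 τ * g0 τ) / ModularForm.eta τ ^ 3 with hf
    have hm : MDiff f := ((m2.mul m3).mul m0).div (mdifferentiable_eta.pow 3)
      fun τ => pow_ne_zero _ (eta_ne_zero τ)
    have h0 : f = 0 := by
      refine eq_zero_of_levelOne (k := 6) (by norm_num) hm (fun τ => ?_) (fun τ => ?_) ?_
      · simp only [hf]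
        rw [t2, t3, t0, eta_vadd_one, mul_pow]
        have e : cexp (2 * Real.pi * I / 24) ^ 3 = cexp (2 * Real.pi * I / 8) := by
          rw [← Complex.exp_nat_mul]
          congr 1
          push_cast
          ring
        rw [e]
        have h1 := eta_ne_zero τ
        have h2 := Complex.exp_ne_zero (2 * Real.pi * I / 8)
        field_simp
      · simp only [hf]
        rw [s2, s3, s0, eta_S]
        have h1 := eta_ne_zero τ
        have h2 := thetaFactor_ne_zero τ
        simp only [zpow_ofNat]
        field_simp
      · have l3 : Tendsto g3 atImInfty (𝓝 0) :=
          thetaDefect_tendsto_zero mdifferentiable_theta3 tendsto_theta3 (by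
            have := theta2_pow_four_tendsto_zero.sub theta0_pow_four_tendsto
            rwa [zero_sub] at this)
        have l0 : Tendsto g0 atImInfty (𝓝 0) :=
          thetaDefect_tendsto_zero mdifferentiable_theta0 tendsto_theta0 (by
            have := (theta2_pow_four_tendsto_zero.const_mul 2).neg.sub theta0_pow_four_tendsto
            rwa [mul_zero, neg_zero, zero_sub] at this)
        have h := ((tendsto_thetaDefect_theta2.mul l3).mul l0).div (tendsto_eta_pow 3) one_ne_zero
        simp only [mul_zero, zero_div] at h
        refine h.congr fun τ => ?_
        have e : (-((3 : ℕ) / 24) : ℂ) = -(1 / 8) := by norm_num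
        simp only [Pi.div_apply, hf]
        rw [e, mul_assoc, mul_assoc, mul_div_mul_left _ _ (qpow_ne_zero _ _), ← mul_assoc]
    funext τ
    have h1 := congrFun h0 τ
    simpa [hf, eta_ne_zero] using h1
  have i20 : g2 = 0 → g0 = 0 := fun h => by
    funext τ
    have := s2 τ
    rw [h] at this
    simpa [thetaFactor_ne_zero, τ.ne_zero] using this.symm
  have i02 : g0 = 0 → g2 = 0 := fun h => by
    funext τ
    have := s0 τ
    rw [h] at this
    simpa [thetaFactor_ne_zero, τ.ne_zero] using this.symm
  have i03 : g0 = 0 → g3 = 0 := fun h => by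
    funext τ
    have := t0 τ
    rw [h] at this
    simpa using this.symm
  have i30 : g3 = 0 → g0 = 0 := fun h => by
    funext τ
    have := t3 τ
    rw [h] at this
    simpa using this.symm
  have h0 : g0 = 0 := by
    rcases (UpperHalfPlane.mul_eq_zero_iff (m2.mul m3) m0).1 hprod with h | h
    · rcases (UpperHalfPlane.mul_eq_zero_iff m2 m3).1 h with h | h
      · exact i20 h
      · exact i30 h
    · exact h
  exact ⟨i02 h0, i03 h0, h0⟩

lemma normalizedDeriv_theta2 (τ : ℍ) :
    D theta2 τ = (EisensteinSeries.E2 τ + weight2 τ) / 24 * theta2 τ := by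
  have := congrFun thetaDefect_eq_zero.1 τ
  simp only [thetaDefect, Pi.zero_apply] at this
  linear_combination this / 24

lemma normalizedDeriv_theta3 (τ : ℍ) :
    D theta3 τ = (EisensteinSeries.E2 τ + weight3 τ) / 24 * theta3 τ := by
  have := congrFun thetaDefect_eq_zero.2.1 τ
  simp only [thetaDefect, Pi.zero_apply] at this
  linear_combination this / 24

lemma normalizedDeriv_theta0 (τ : ℍ) :
    D theta0 τ = (EisensteinSeries.E2 τ + weight0 τ) / 24 * theta0 τ := by
  have := congrFun thetaDefect_eq_zero.2.2 τ
  simp only [thetaDefect, Pi.zero_apply] at this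
  linear_combination this / 24

/-! ### Explicit solutions -/

lemma normalizedDeriv_div {F G : ℍ → ℂ} (hF : MDiff F) (hG : MDiff G) (h0 : ∀ τ, G τ ≠ 0)
    (τ : ℍ) : D (F / G) τ = (D F τ * G τ - F τ * D G τ) / G τ ^ 2 := by
  have hm : MDiff (F / G) := hF.div hG h0
  have e : F / G * G = F := funext fun τ => div_mul_cancel₀ _ (h0 τ)
  have h := congrFun (Derivative.normalizedDerivOfComplex_mul _ _ hm hG) τ
  rw [e] at h
  simp only [Pi.add_apply, Pi.mul_apply, Pi.div_apply] at h
  have := h0 τ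
  rw [h]
  field_simp
  ring

lemma normalizedDeriv_pow_of_eq {F : ℍ → ℂ} (hF : MDiff F) {φ τ} (h : D F τ = φ * F τ) (l : ℕ) :
    D (F ^ l) τ = l * φ * F τ ^ l := by
  rw [Derivative.normalizedDerivOfComplex_pow _ _ hF]
  simp only [Pi.mul_apply, Pi.pow_apply, Pi.natCast_apply, h]
  rcases l with _ | l
  · simp
  · simp only [Nat.add_sub_cancel]
    ring

/-- The function `(θ / η) ^ l`. -/
def thetaQuotient (θ : ℍ → ℂ) (l : ℕ) (τ : ℍ) : ℂ := θ τ ^ l / ModularForm.eta τ ^ l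

lemma thetaQuotient_eq (θ : ℍ → ℂ) (l : ℕ) :
    thetaQuotient θ l = θ ^ l / (fun τ : ℍ => ModularForm.eta τ) ^ l := rfl

lemma mdifferentiable_thetaQuotient {θ : ℍ → ℂ} (hθ : MDiff θ) (l : ℕ) :
    MDiff (thetaQuotient θ l) :=
  (hθ.pow l).div (mdifferentiable_eta.pow l) fun τ => pow_ne_zero _ (eta_ne_zero τ)

lemma normalizedDeriv_thetaQuotient {θ w : ℍ → ℂ} (hθ : MDiff θ)
    (h : ∀ τ, D θ τ = (EisensteinSeries.E2 τ + w τ) / 24 * θ τ) (l : ℕ) :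
    D (thetaQuotient θ l) = ((l : ℂ) / 24) • (w * thetaQuotient θ l) := by
  funext τ
  rw [thetaQuotient_eq, normalizedDeriv_div (hθ.pow l) (mdifferentiable_eta.pow l)
    (fun τ => pow_ne_zero _ (eta_ne_zero τ)), normalizedDeriv_pow_of_eq hθ (h τ),
    normalizedDeriv_pow_of_eq mdifferentiable_eta (normalizedDeriv_eta τ)]
  have h1 := pow_ne_zero l (eta_ne_zero τ)
  simp only [Pi.smul_apply, Pi.mul_apply, Pi.div_apply, Pi.pow_apply, smul_eq_mul]
  field_simp
  ring

lemma normalizedDeriv_theta2_pow_four : D (theta2 ^ 4) =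
    (1 / 6 : ℂ) • (EisensteinSeries.E2 * theta2 ^ 4 + theta2 ^ 4 * theta2 ^ 4 +
      (2 : ℂ) • (theta2 ^ 4 * theta0 ^ 4)) := by
  funext τ
  rw [normalizedDeriv_pow_of_eq mdifferentiable_theta2 (normalizedDeriv_theta2 τ), weight2]
  simp only [Pi.smul_apply, Pi.add_apply, Pi.mul_apply, Pi.pow_apply, smul_eq_mul]
  push_cast
  ring

lemma normalizedDeriv_theta0_pow_four : D (theta0 ^ 4) =
    (1 / 6 : ℂ) • (EisensteinSeries.E2 * theta0 ^ 4 - (2 : ℂ) • (theta2 ^ 4 * theta0 ^ 4) -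
      theta0 ^ 4 * theta0 ^ 4) := by
  funext τ
  rw [normalizedDeriv_pow_of_eq mdifferentiable_theta0 (normalizedDeriv_theta0 τ), weight0]
  simp only [Pi.smul_apply, Pi.sub_apply, Pi.mul_apply, Pi.pow_apply, smul_eq_mul]
  push_cast
  ring

/-- If `h' = (l / 24) w h` where `w = α θ₂⁴ + β θ₀⁴`, the operator maps `h` to an explicit
polynomial in `E₂, θ₂⁴, θ₀⁴` times `h`. -/
lemma mldeOp_of_logDeriv {h : ℍ → ℂ} (hh : MDiff h) {l α β : ℂ}
    (hD : D h = (l / 24) • ((α • theta2 ^ 4 + β • theta0 ^ 4) * h)) (x y : ℂ) (τ : ℍ) :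
    mldeOp x y h τ = (let a := theta2 τ ^ 4
      let b := theta0 τ ^ 4
      let e := EisensteinSeries.E2 τ
      let E4 := a ^ 2 + a * b + b ^ 2
      let E6 := (2 * a + b) * (a + 2 * b) * (b - a) / 2
      let a' := a * (e + a + 2 * b) / 6
      let b' := b * (e - 2 * a - b) / 6
      let e' := (e ^ 2 - E4) / 12
      let w := α * a + β * b
      let p := α * a ^ 2 + (2 * α - 2 * β) * a * b - β * b ^ 2
      let w' := (e * w + p) / 6
      let w'' := (e' * w + e * w' + 2 * α * a * a' + (2 * α - 2 * β) * (a' * b + a * b') -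
        2 * β * b * b') / 6
      let c := l / 24
      h τ * (c * (w'' + 3 * c * w * w' + c ^ 2 * w ^ 3) - 1 / 2 * e * (c * (w' + c * w ^ 2)) +
        (1 / 2 * e' + x * E4) * (c * w) + y * E6)) := by
  set A := theta2 ^ 4 with hA
  set B := theta0 ^ 4 with hB
  set E := EisensteinSeries.E2 with hE
  have mA : MDiff A := mdifferentiable_theta2_pow_four
  have mB : MDiff B := mdifferentiable_theta0_pow_four
  have mE : MDiff E := E2_mdifferentiable
  have dA := normalizedDeriv_theta2_pow_four
  have dB := normalizedDeriv_theta0_pow_four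
  rw [← hA, ← hB, ← hE] at dA dB
  set w := α • A + β • B with hw
  have mw : MDiff w := (mA.const_smul α).add (mB.const_smul β)
  set v := (1 / 6 : ℂ) • (E * w + α • (A * A) + (2 * α - 2 * β) • (A * B) - β • (B * B)) with hv
  have mv : MDiff v := ((((mE.mul mw).add ((mA.mul mA).const_smul _)).add
    ((mA.mul mB).const_smul _)).sub ((mB.mul mB).const_smul _)).const_smul _
  have dw : D w = v := by
    rw [hw, Derivative.normalizedDerivOfComplex_add _ _ (mA.const_smul α) (mB.const_smul β),
      Derivative.normalizedDerivOfComplex_smul _ _ mA,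
      Derivative.normalizedDerivOfComplex_smul _ _ mB, dA, dB]
    funext τ
    simp only [hv, hw, Pi.smul_apply, Pi.add_apply, Pi.sub_apply, Pi.mul_apply, smul_eq_mul]
    ring
  have dv : D v = (1 / 6 : ℂ) • (D E * w + E * v + α • (D A * A + A * D A) +
      (2 * α - 2 * β) • (D A * B + A * D B) - β • (D B * B + B * D B)) := by
    rw [hv, Derivative.normalizedDerivOfComplex_smul _ _ ((((mE.mul mw).add
      ((mA.mul mA).const_smul _)).add ((mA.mul mB).const_smul _)).sub ((mB.mul mB).const_smul _)),
      Derivative.normalizedDerivOfComplex_sub _ _ (((mE.mul mw).add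
      ((mA.mul mA).const_smul _)).add ((mA.mul mB).const_smul _)) ((mB.mul mB).const_smul _),
      Derivative.normalizedDerivOfComplex_add _ _ ((mE.mul mw).add
      ((mA.mul mA).const_smul _)) ((mA.mul mB).const_smul _),
      Derivative.normalizedDerivOfComplex_add _ _ (mE.mul mw) ((mA.mul mA).const_smul _),
      Derivative.normalizedDerivOfComplex_mul _ _ mE mw,
      Derivative.normalizedDerivOfComplex_smul _ _ (mA.mul mA),
      Derivative.normalizedDerivOfComplex_smul _ _ (mA.mul mB),
      Derivative.normalizedDerivOfComplex_smul _ _ (mB.mul mB),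
      Derivative.normalizedDerivOfComplex_mul _ _ mA mA,
      Derivative.normalizedDerivOfComplex_mul _ _ mA mB,
      Derivative.normalizedDerivOfComplex_mul _ _ mB mB, dw]
  have d2 : D (D h) = (l / 24) • (v * h + w * D h) := by
    rw [hD, Derivative.normalizedDerivOfComplex_smul _ _ (mw.mul hh),
      Derivative.normalizedDerivOfComplex_mul _ _ mw hh, dw, hD]
  have mDh := Derivative.normalizedDerivOfComplex_mdifferentiable hh
  have d3 : D (D (D h)) = (l / 24) • (D v * h + v * D h + (v * D h + w * D (D h))) := by
    rw [d2, Derivative.normalizedDerivOfComplex_smul _ _ ((mv.mul hh).add (mw.mul mDh)),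
      Derivative.normalizedDerivOfComplex_add _ _ (mv.mul hh) (mw.mul mDh),
      Derivative.normalizedDerivOfComplex_mul _ _ mv hh,
      Derivative.normalizedDerivOfComplex_mul _ _ mw mDh, dw, d2]
  have hE' := normalizedDeriv_E2 τ
  have h4 := E4_eq_theta τ
  have h6 := E6_eq_theta τ
  simp only [mldeOp]
  rw [← hE] at hE'
  rw [d3, d2, hD, dv, dA, dB, ← hE, hE', h4, h6]
  simp only [hv, hw, hA, hB, Pi.smul_apply, Pi.add_apply, Pi.sub_apply, Pi.mul_apply, Pi.pow_apply,
    smul_eq_mul, hE', h4]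
  ring

lemma weight2_eq : weight2 = (1 : ℂ) • theta2 ^ 4 + (2 : ℂ) • theta0 ^ 4 := by
  funext τ
  simp [weight2]

lemma weight3_eq : weight3 = (1 : ℂ) • theta2 ^ 4 + (-1 : ℂ) • theta0 ^ 4 := by
  funext τ
  simp [weight3]
  ring

lemma weight0_eq : weight0 = (-2 : ℂ) • theta2 ^ 4 + (-1 : ℂ) • theta0 ^ 4 := by
  funext τ
  simp [weight0]
  ring

/-- `mldeOp_of_logDeriv` reduces the equation to a polynomial identity in E₂, θ₂⁴ and θ₀⁴, verified
separately at each of the two pairs (l, n). -/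
lemma thetaQuotient_theta2_mem {l n : ℕ} (h : (l = 8 ∧ n = 1) ∨ (l = 20 ∧ n = 2)) :
    thetaQuotient theta2 l ∈ solutionSpace (xParam n) (yParam (xParam n)) := by
  have hm := mdifferentiable_thetaQuotient mdifferentiable_theta2 l
  refine ⟨hm, fun τ => ?_⟩
  have hD := normalizedDeriv_thetaQuotient mdifferentiable_theta2 normalizedDeriv_theta2 l
  rw [weight2_eq] at hD
  rw [mldeOp_of_logDeriv hm hD]
  rcases h with ⟨rfl, rfl⟩ | ⟨rfl, rfl⟩ <;> simp only [xParam, yParam] <;> push_cast <;> ring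

lemma thetaQuotient_theta3_mem {l n : ℕ} (h : (l = 8 ∧ n = 1) ∨ (l = 20 ∧ n = 2)) :
    thetaQuotient theta3 l ∈ solutionSpace (xParam n) (yParam (xParam n)) := by
  have hm := mdifferentiable_thetaQuotient mdifferentiable_theta3 l
  refine ⟨hm, fun τ => ?_⟩
  have hD := normalizedDeriv_thetaQuotient mdifferentiable_theta3 normalizedDeriv_theta3 l
  rw [weight3_eq] at hD
  rw [mldeOp_of_logDeriv hm hD]
  rcases h with ⟨rfl, rfl⟩ | ⟨rfl, rfl⟩ <;> simp only [xParam, yParam] <;> push_cast <;> ring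

lemma thetaQuotient_theta0_mem {l n : ℕ} (h : (l = 8 ∧ n = 1) ∨ (l = 20 ∧ n = 2)) :
    thetaQuotient theta0 l ∈ solutionSpace (xParam n) (yParam (xParam n)) := by
  have hm := mdifferentiable_thetaQuotient mdifferentiable_theta0 l
  refine ⟨hm, fun τ => ?_⟩
  have hD := normalizedDeriv_thetaQuotient mdifferentiable_theta0 normalizedDeriv_theta0 l
  rw [weight0_eq] at hD
  rw [mldeOp_of_logDeriv hm hD]
  rcases h with ⟨rfl, rfl⟩ | ⟨rfl, rfl⟩ <;> simp only [xParam, yParam] <;> push_cast <;> ring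

lemma thetaVac_eq (l : ℕ) :
    thetaVac l = (1 / 2 : ℂ) • (thetaQuotient theta3 l + thetaQuotient theta0 l) := by
  funext τ
  simp only [thetaVac, thetaQuotient, Pi.smul_apply, Pi.add_apply, smul_eq_mul]
  ring

lemma thetaVec_eq (l : ℕ) :
    thetaVec l = (1 / 2 : ℂ) • (thetaQuotient theta3 l - thetaQuotient theta0 l) := by
  funext τ
  simp only [thetaVec, thetaQuotient, Pi.smul_apply, Pi.sub_apply, smul_eq_mul]
  ring

lemma thetaSpin_eq (l : ℕ) : thetaSpin l = (1 / 2 : ℂ) • thetaQuotient theta2 l := by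
  funext τ
  simp only [thetaSpin, thetaQuotient, Pi.smul_apply, smul_eq_mul]
  ring

lemma thetaVac_mem {l n : ℕ} (h : (l = 8 ∧ n = 1) ∨ (l = 20 ∧ n = 2)) :
    thetaVac l ∈ solutionSpace (xParam n) (yParam (xParam n)) := by
  rw [thetaVac_eq]
  exact Submodule.smul_mem _ _
    (Submodule.add_mem _ (thetaQuotient_theta3_mem h) (thetaQuotient_theta0_mem h))

lemma thetaVec_mem {l n : ℕ} (h : (l = 8 ∧ n = 1) ∨ (l = 20 ∧ n = 2)) :
    thetaVec l ∈ solutionSpace (xParam n) (yParam (xParam n)) := by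
  rw [thetaVec_eq]
  exact Submodule.smul_mem _ _
    (Submodule.sub_mem _ (thetaQuotient_theta3_mem h) (thetaQuotient_theta0_mem h))

lemma thetaSpin_mem {l n : ℕ} (h : (l = 8 ∧ n = 1) ∨ (l = 20 ∧ n = 2)) :
    thetaSpin l ∈ solutionSpace (xParam n) (yParam (xParam n)) := by
  rw [thetaSpin_eq]
  exact Submodule.smul_mem _ _ (thetaQuotient_theta2_mem h)

/-- Because η'/η = E₂/24, dividing by η⁸ turns the derivative into F' - E₂F/3, the Serre derivative
of weight 4. -/
lemma normalizedDeriv_mul_eta_inv {F : ℍ → ℂ} (hF : MDiff F) :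
    D (F / (fun τ : ℍ => ModularForm.eta τ) ^ 8) =
      D F / (fun τ : ℍ => ModularForm.eta τ) ^ 8 -
        (1 / 3 : ℂ) • (EisensteinSeries.E2 * F / (fun τ : ℍ => ModularForm.eta τ) ^ 8) := by
  funext τ
  have h := eta_ne_zero τ
  rw [normalizedDeriv_div hF (mdifferentiable_eta.pow 8)
    (fun τ => pow_ne_zero _ (eta_ne_zero τ)),
    normalizedDeriv_pow_of_eq mdifferentiable_eta (normalizedDeriv_eta τ)]
  simp only [Pi.sub_apply, Pi.smul_apply, Pi.mul_apply, Pi.div_apply, Pi.pow_apply, smul_eq_mul]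
  push_cast
  field_simp
  ring

/-- `E₄ / η⁸` solves the equation with `y = x/3 + 5/54` for every `x`. -/
lemma e4OverEta8_mem (x : ℂ) : e4OverEta8 ∈ solutionSpace x (yParam x) := by
  set H : ℍ → ℂ := (fun τ : ℍ => ModularForm.eta τ) ^ 8 with hH
  set E : ℍ → ℂ := EisensteinSeries.E2 with hE
  set E4 : ℍ → ℂ := ⇑ModularForm.E₄ with hE4
  set E6 : ℍ → ℂ := ⇑ModularForm.E₆ with hE6
  have mE : MDiff E := E2_mdifferentiable
  have m4 : MDiff E4 := mdifferentiable_E4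
  have m6 : MDiff E6 := mdifferentiable_E6
  have hne : ∀ τ, H τ ≠ 0 := fun τ => pow_ne_zero _ (eta_ne_zero τ)
  have mH : MDiff H := mdifferentiable_eta.pow 8
  have hf : e4OverEta8 = E4 / H := rfl
  have dE : D E = (1 / 12 : ℂ) • (E * E - E4) := funext fun τ => by
    rw [normalizedDeriv_E2]
    simp only [Pi.smul_apply, Pi.sub_apply, Pi.mul_apply, smul_eq_mul, hE, hE4]
    ring
  have d4 : D E4 = (1 / 3 : ℂ) • (E * E4 - E6) := funext fun τ => by
    rw [normalizedDeriv_E4]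
    simp only [Pi.smul_apply, Pi.sub_apply, Pi.mul_apply, smul_eq_mul, hE, hE4, hE6]
    ring
  have d6 : D E6 = (1 / 2 : ℂ) • (E * E6 - E4 * E4) := funext fun τ => by
    rw [normalizedDeriv_E6]
    simp only [Pi.smul_apply, Pi.sub_apply, Pi.mul_apply, smul_eq_mul, hE, hE4, hE6]
    ring
  -- In weight 4 the E₂ terms cancel. The part of the operator carrying x and y is therefore (y -
  -- x/3) E₄E₆/η⁸, which explains why y = x/3 + const works for all x.
  have h1 : D e4OverEta8 = (-1 / 3 : ℂ) • (E6 / H) := by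
    rw [hf, normalizedDeriv_mul_eta_inv m4, d4]
    funext τ
    simp only [Pi.smul_apply, Pi.sub_apply, Pi.mul_apply, Pi.div_apply, smul_eq_mul]
    ring
  set K : ℍ → ℂ := (1 / 6 : ℂ) • (E * E6) - (1 / 2 : ℂ) • (E4 * E4) with hK
  have mK : MDiff K := ((mE.mul m6).const_smul _).sub ((m4.mul m4).const_smul _)
  have h2 : D (D e4OverEta8) = (-1 / 3 : ℂ) • (K / H) := by
    rw [h1, Derivative.normalizedDerivOfComplex_smul _ _ (m6.div mH hne),
      normalizedDeriv_mul_eta_inv m6, d6]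
    funext τ
    simp only [hK, Pi.smul_apply, Pi.sub_apply, Pi.mul_apply, Pi.div_apply, smul_eq_mul]
    ring
  have dK : D K = (1 / 6 : ℂ) • (D E * E6 + E * D E6) - (1 / 2 : ℂ) • (D E4 * E4 + E4 * D E4) := by
    rw [hK, Derivative.normalizedDerivOfComplex_sub _ _ ((mE.mul m6).const_smul _)
      ((m4.mul m4).const_smul _), Derivative.normalizedDerivOfComplex_smul _ _ (mE.mul m6),
      Derivative.normalizedDerivOfComplex_smul _ _ (m4.mul m4),
      Derivative.normalizedDerivOfComplex_mul _ _ mE m6,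
      Derivative.normalizedDerivOfComplex_mul _ _ m4 m4]
  have h3 : D (D (D e4OverEta8)) = (-1 / 3 : ℂ) • (D K / H - (1 / 3 : ℂ) • (E * K / H)) := by
    rw [h2, Derivative.normalizedDerivOfComplex_smul _ _ (mK.div mH hne),
      normalizedDeriv_mul_eta_inv mK]
  refine ⟨m4.div mH hne, fun τ => ?_⟩
  have h0 := hne τ
  simp only [mldeOp]
  rw [h3, h2, h1, dK, d4, d6, ← hE, dE, ← hE4, ← hE6, hf]
  simp only [hK, Pi.smul_apply, Pi.sub_apply, Pi.add_apply, Pi.mul_apply, Pi.div_apply,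
    smul_eq_mul, yParam]
  field_simp
  ring

/-! ### The dimension of the solution space -/

lemma iteratedDeriv_comp_ofComplex (f : ℍ → ℂ) (n : ℕ) :
    ∀ τ : ℍ, iteratedDeriv n (f ∘ ofComplex) τ =
      (2 * Real.pi * I) ^ n * (Derivative.normalizedDerivOfComplex^[n] f) τ := by
  induction n with
  | zero => intro τ; simp
  | succ n ih =>
    intro τ
    rw [iteratedDeriv_succ, Function.iterate_succ_apply']
    have h : iteratedDeriv n (f ∘ ofComplex) =ᶠ[𝓝 (τ : ℂ)] fun w =>
        (2 * Real.pi * I) ^ n * ((Derivative.normalizedDerivOfComplex^[n] f) ∘ ofComplex) w := by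
      filter_upwards [isOpen_upperHalfPlaneSet.mem_nhds τ.im_pos] with w hw
      have := ih ⟨w, hw⟩
      simpa [ofComplex_apply_of_im_pos hw] using this
    rw [h.deriv_eq, deriv_const_mul_field, Derivative.normalizedDerivOfComplex, pow_succ]
    have : (2 * Real.pi * I : ℂ) ≠ 0 := two_pi_I_ne_zero
    field_simp

/-- The Taylor series vanishes on the largest disc in ℍ around τ, and the identity theorem does the
rest. -/
lemma eq_zero_of_iterate_eq_zero {f : ℍ → ℂ} (hf : MDiff f) (τ : ℍ)
    (h : ∀ n, (Derivative.normalizedDerivOfComplex^[n] f) τ = 0) : f = 0 := by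
  have hd : DifferentiableOn ℂ (f ∘ ofComplex) (Metric.ball (τ : ℂ) τ.im) := by
    refine (UpperHalfPlane.mdifferentiable_iff.1 hf).mono fun w hw => ?_
    have h1 : |(w - τ).im| < τ.im := (Complex.abs_im_le_norm _).trans_lt (by
      simpa [dist_eq_norm] using hw)
    rw [sub_im, abs_lt] at h1
    have : τ.im = (τ : ℂ).im := rfl
    change 0 < w.im
    linarith [h1.1]
  refine UpperHalfPlane.eq_zero_of_frequently (τ := τ) hf (Eventually.frequently ?_)
  have hcont : Tendsto (fun z : ℍ => (z : ℂ)) (𝓝[≠] τ) (𝓝 (τ : ℂ)) :=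
    (UpperHalfPlane.continuous_coe.tendsto τ).mono_left nhdsWithin_le_nhds
  filter_upwards [hcont (Metric.ball_mem_nhds (τ : ℂ) τ.im_pos)] with z hz
  have h1 := Complex.hasSum_taylorSeries_on_ball hd hz
  simp only [iteratedDeriv_comp_ofComplex, h, mul_zero, smul_zero] at h1
  simpa using h1.unique hasSum_zero

/-- A solution is determined by its value and its first two derivatives at a point. -/
lemma solution_eq_zero {x y : ℂ} {f : ℍ → ℂ} (hf : f ∈ solutionSpace x y) (τ : ℍ)
    (h0 : f τ = 0) (h1 : D f τ = 0) (h2 : D (D f) τ = 0) : f = 0 := by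
  have m0 : MDiff f := hf.1
  have m1 := Derivative.normalizedDerivOfComplex_mdifferentiable m0
  have m2 := Derivative.normalizedDerivOfComplex_mdifferentiable m1
  have mE := E2_mdifferentiable
  have mE' := Derivative.normalizedDerivOfComplex_mdifferentiable mE
  set p : ℍ → ℂ := (1 / 2 : ℂ) • EisensteinSeries.E2 with hp
  set q : ℍ → ℂ := -((1 / 2 : ℂ) • D EisensteinSeries.E2 + x • ⇑ModularForm.E₄) with hq
  set s : ℍ → ℂ := -(y • ⇑ModularForm.E₆) with hs
  have mp : MDiff p := mE.const_smul _
  have mq : MDiff q := ((mE'.const_smul _).add (mdifferentiable_E4.const_smul x)).neg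
  have ms : MDiff s := (mdifferentiable_E6.const_smul y).neg
  have h3 : D (D (D f)) = p * D (D f) + q * D f + s * f := by
    funext τ
    have := hf.2 τ
    simp only [mldeOp] at this
    simp only [hp, hq, hs, Pi.add_apply, Pi.mul_apply, Pi.neg_apply, Pi.smul_apply, smul_eq_mul]
    linear_combination this
  refine eq_zero_of_iterate_eq_zero m0 τ fun n => ?_
  -- The equation rewrites the third derivative, so every iterated derivative is a holomorphic
  -- combination of f, f' and f''.
  suffices H : ∃ A B C : ℍ → ℂ, MDiff A ∧ MDiff B ∧ MDiff C ∧
      Derivative.normalizedDerivOfComplex^[n] f = A * f + B * D f + C * D (D f) by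
    obtain ⟨A, B, C, -, -, -, h⟩ := H
    rw [h]
    simp [h0, h1, h2]
  induction n with
  | zero => exact ⟨fun _ => 1, 0, 0, mdifferentiable_const, mdifferentiable_const,
      mdifferentiable_const, by funext τ; simp⟩
  | succ n ih =>
    obtain ⟨A, B, C, mA, mB, mC, h⟩ := ih
    refine ⟨D A + C * s, A + D B + C * q, B + D C + C * p, ?_, ?_, ?_, ?_⟩
    · exact (Derivative.normalizedDerivOfComplex_mdifferentiable mA).add (mC.mul ms)
    · exact (mA.add (Derivative.normalizedDerivOfComplex_mdifferentiable mB)).add (mC.mul mq)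
    · exact (mB.add (Derivative.normalizedDerivOfComplex_mdifferentiable mC)).add (mC.mul mp)
    · rw [Function.iterate_succ_apply', h,
        Derivative.normalizedDerivOfComplex_add _ _ ((mA.mul m0).add (mB.mul m1)) (mC.mul m2),
        Derivative.normalizedDerivOfComplex_add _ _ (mA.mul m0) (mB.mul m1),
        Derivative.normalizedDerivOfComplex_mul _ _ mA m0,
        Derivative.normalizedDerivOfComplex_mul _ _ mB m1,
        Derivative.normalizedDerivOfComplex_mul _ _ mC m2, h3]
      ring

/-- The initial values of a solution at `τ`. -/
def initialValues (x y : ℂ) (τ : ℍ) : solutionSpace x y →ₗ[ℂ] Fin 3 → ℂ where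
  toFun f := ![f.1 τ, D f.1 τ, D (D f.1) τ]
  map_add' f g := by
    have hf := f.2.1
    have hg := g.2.1
    have hf1 := Derivative.normalizedDerivOfComplex_mdifferentiable hf
    have hg1 := Derivative.normalizedDerivOfComplex_mdifferentiable hg
    rw [Submodule.coe_add, Derivative.normalizedDerivOfComplex_add _ _ hf hg,
      Derivative.normalizedDerivOfComplex_add _ _ hf1 hg1]
    simp
  map_smul' c f := by
    have hf := f.2.1
    have hf1 := Derivative.normalizedDerivOfComplex_mdifferentiable hf
    rw [Submodule.coe_smul, Derivative.normalizedDerivOfComplex_smul _ _ hf,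
      Derivative.normalizedDerivOfComplex_smul _ _ hf1]
    simp

lemma initialValues_injective (x y : ℂ) (τ : ℍ) : Function.Injective (initialValues x y τ) := by
  rw [← LinearMap.ker_eq_bot, LinearMap.ker_eq_bot']
  intro f hf
  have h : ![f.1 τ, D f.1 τ, D (D f.1) τ] = 0 := hf
  exact Subtype.ext (solution_eq_zero f.2 τ (congrFun h 0) (congrFun h 1) (congrFun h 2))

/-- Injectivity of the initial values bounds the dimension by 3, so no existence theorem for the
equation is needed. -/
lemma solutionSpace_eq_span {x y : ℂ} {v : Fin 3 → ℍ → ℂ} (hv : LinearIndependent ℂ v)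
    (hm : ∀ i, v i ∈ solutionSpace x y) :
    solutionSpace x y = Submodule.span ℂ (Set.range v) := by
  have hinj := initialValues_injective x y UpperHalfPlane.I
  have hfin : FiniteDimensional ℂ (solutionSpace x y) := FiniteDimensional.of_injective _ hinj
  have h3 : Module.finrank ℂ (solutionSpace x y) ≤ 3 := by
    simpa using LinearMap.finrank_le_finrank_of_injective hinj
  refine (Submodule.eq_of_le_of_finrank_le ?_ ?_).symm
  · rw [Submodule.span_le]
    rintro _ ⟨i, rfl⟩
    exact hm i
  · rw [finrank_span_eq_card hv]
    simpa using h3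

/-! ### Linear independence from the behaviour at `i∞` -/

/-- `f` behaves like `c q ^ r` at `i∞`. -/
def HasLeadingTerm (f : ℍ → ℂ) (r : ℝ) (c : ℂ) : Prop :=
  Tendsto (fun τ : ℍ => qpow τ (-r) * f τ) atImInfty (𝓝 c)

lemma HasLeadingTerm.of_lt {f : ℍ → ℂ} {r s : ℝ} {c : ℂ} (h : HasLeadingTerm f r c) (hs : s < r) :
    HasLeadingTerm f s 0 := by
  have h1 := (tendsto_qpow_atImInfty (sub_pos.2 hs)).mul h
  rw [zero_mul] at h1
  refine h1.congr fun τ => ?_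
  rw [← mul_assoc, ← qpow_add]
  congr 2
  push_cast
  ring

lemma HasLeadingTerm.add {f g : ℍ → ℂ} {r : ℝ} {c d : ℂ} (hf : HasLeadingTerm f r c)
    (hg : HasLeadingTerm g r d) : HasLeadingTerm (f + g) r (c + d) :=
  (Tendsto.add hf hg).congr fun τ => by simp [mul_add]

lemma HasLeadingTerm.smul {f : ℍ → ℂ} {r : ℝ} {c : ℂ} (a : ℂ) (hf : HasLeadingTerm f r c) :
    HasLeadingTerm (a • f) r (a * c) :=
  (Tendsto.const_mul a hf).congr fun τ => by simp [mul_left_comm]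

lemma HasLeadingTerm.zero_eq {r : ℝ} {c : ℂ} (h : HasLeadingTerm 0 r c) : c = 0 := by
  have h1 : Tendsto (fun _ : ℍ => (0 : ℂ)) atImInfty (𝓝 c) := by simpa [HasLeadingTerm] using h
  exact (tendsto_nhds_unique h1 tendsto_const_nhds)

/-- Coefficients of a relation are eliminated in order of increasing exponent. In the applications
the exponents are the indicial roots: -1/3, 1/6, 2/3 for l = 8 and -5/6, -1/3, 5/3 for l = 20. -/
lemma linearIndependent_of_hasLeadingTerm {f g h : ℍ → ℂ} {r s t : ℝ} {a b c : ℂ}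
    (hf : HasLeadingTerm f r a) (hg : HasLeadingTerm g s b) (hh : HasLeadingTerm h t c)
    (hrs : r < s) (hst : s < t) (ha : a ≠ 0) (hb : b ≠ 0) (hc : c ≠ 0) :
    LinearIndependent ℂ ![f, g, h] := by
  rw [Fintype.linearIndependent_iff]
  intro u hu
  rw [Fin.sum_univ_three] at hu
  have e : u 0 • f + u 1 • g + u 2 • h = 0 := hu
  have h0 : u 0 = 0 := by
    have h1 := ((hf.smul (u 0)).add ((hg.of_lt hrs).smul (u 1))).add
      ((hh.of_lt (hrs.trans hst)).smul (u 2))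
    rw [e] at h1
    simpa [ha] using h1.zero_eq
  rw [h0, zero_smul, zero_add] at e
  have h1 : u 1 = 0 := by
    have h1 := (hg.smul (u 1)).add ((hh.of_lt hst).smul (u 2))
    rw [e] at h1
    simpa [hb] using h1.zero_eq
  rw [h1, zero_smul, zero_add] at e
  have h2 : u 2 = 0 := by
    have h1 := hh.smul (u 2)
    rw [e] at h1
    simpa [hc] using h1.zero_eq
  intro i
  fin_cases i <;> assumption

lemma hasLeadingTerm_div_eta {f : ℍ → ℂ} {r : ℝ} {c : ℂ} (hf : HasLeadingTerm f r c) (l : ℕ) :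
    HasLeadingTerm (fun τ => f τ / (2 * ModularForm.eta τ ^ l)) (r - l / 24) (c / 2) := by
  have h := Tendsto.div hf ((tendsto_eta_pow l).const_mul 2) (by norm_num)
  rw [mul_one] at h
  refine h.congr fun τ => ?_
  have h1 := eta_ne_zero τ
  have h2 := qpow_ne_zero τ (-(l / 24))
  have e : qpow τ (-((r - l / 24 : ℝ) : ℂ)) * qpow τ (-(l / 24)) = qpow τ (-r) := by
    rw [← qpow_add]
    congr 1
    push_cast
    ring
  simp only [Pi.div_apply]
  rw [← e]
  field_simp

lemma hasLeadingTerm_thetaVac (l : ℕ) : HasLeadingTerm (thetaVac l) (0 - l / 24) ((1 + 1) / 2) := by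
  refine hasLeadingTerm_div_eta (f := fun τ => theta3 τ ^ l + theta0 τ ^ l) ?_ l
  have h := (tendsto_theta3.pow l).add (tendsto_theta0.pow l)
  rw [one_pow] at h
  refine h.congr fun τ => ?_
  simp [qpow_zero]

lemma hasLeadingTerm_thetaVec (l : ℕ) :
    HasLeadingTerm (thetaVec l) (1 / 2 - l / 24) (4 * l / 2) := by
  refine hasLeadingTerm_div_eta (f := fun τ => theta3 τ ^ l - theta0 τ ^ l) ?_ l
  -- Factor the difference of l-th powers: θ₃ - θ₀ ~ 4q^(1/2), and the cofactor tends to l.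
  have h1 : Tendsto (fun τ => ∑ i ∈ Finset.range l, theta3 τ ^ i * theta0 τ ^ (l - 1 - i)) atImInfty
      (𝓝 (∑ i ∈ Finset.range l, 1 ^ i * 1 ^ (l - 1 - i))) :=
    tendsto_finsetSum _ fun i _ => (tendsto_theta3.pow i).mul (tendsto_theta0.pow _)
  have h2 := tendsto_theta3_sub_theta0.mul h1
  simp only [one_pow, mul_one, Finset.sum_const, Finset.card_range, nsmul_eq_mul] at h2
  refine h2.congr fun τ => ?_
  rw [mul_assoc, mul_comm (theta3 τ - theta0 τ), geom_sum₂_mul]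
  norm_num

lemma hasLeadingTerm_thetaSpin (l : ℕ) :
    HasLeadingTerm (thetaSpin l) (l / 8 - l / 24) (2 ^ l / 2) := by
  refine hasLeadingTerm_div_eta (f := fun τ => theta2 τ ^ l) ?_ l
  refine (tendsto_theta2.pow l).congr fun τ => ?_
  rw [mul_pow, ← qpow_nat_mul]
  congr 2
  push_cast
  ring

lemma hasLeadingTerm_e4OverEta8 : HasLeadingTerm e4OverEta8 (0 - (8 : ℕ) / 24) (2 * 1 / 2) := by
  have h := hasLeadingTerm_div_eta (f := fun τ => 2 * ModularForm.E₄ τ) (r := 0) (c := 2 * 1)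
    ((tendsto_E4.const_mul 2).congr fun τ => by simp [qpow_zero]) 8
  refine Tendsto.congr (fun τ => ?_) h
  beta_reduce
  rw [mul_div_mul_left _ _ two_ne_zero, e4OverEta8]

lemma linearIndependent_theta_eight :
    LinearIndependent ℂ ![thetaVac 8, thetaVec 8, thetaSpin 8] :=
  linearIndependent_of_hasLeadingTerm (hasLeadingTerm_thetaVac 8) (hasLeadingTerm_thetaVec 8)
    (hasLeadingTerm_thetaSpin 8) (by norm_num) (by norm_num) (by norm_num) (by norm_num)
    (by norm_num)

lemma linearIndependent_e4_eight :
    LinearIndependent ℂ ![e4OverEta8, thetaVec 8, thetaSpin 8] :=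
  linearIndependent_of_hasLeadingTerm hasLeadingTerm_e4OverEta8 (hasLeadingTerm_thetaVec 8)
    (hasLeadingTerm_thetaSpin 8) (by norm_num) (by norm_num) (by norm_num) (by norm_num)
    (by norm_num)

lemma linearIndependent_theta_twenty :
    LinearIndependent ℂ ![thetaVac 20, thetaVec 20, thetaSpin 20] :=
  linearIndependent_of_hasLeadingTerm (hasLeadingTerm_thetaVac 20) (hasLeadingTerm_thetaVec 20)
    (hasLeadingTerm_thetaSpin 20) (by norm_num) (by norm_num) (by norm_num) (by norm_num)
    (by norm_num)

lemma range_cons_three {α : Type*} (f g h : α) : Set.range ![f, g, h] = {f, g, h} := by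
  ext u
  simp [eq_comm]
  tauto

lemma solutionSpace_eight_eq_span_e4 : solutionSpace (xParam 1) (yParam (xParam 1)) =
    Submodule.span ℂ {e4OverEta8, thetaVec 8, thetaSpin 8} := by
  rw [← range_cons_three]
  refine solutionSpace_eq_span linearIndependent_e4_eight fun i => ?_
  fin_cases i
  · exact e4OverEta8_mem _
  · exact thetaVec_mem (Or.inl ⟨rfl, rfl⟩)
  · exact thetaSpin_mem (Or.inl ⟨rfl, rfl⟩)

/-- This second basis contains the vacuum character in place of E₄/η⁸; comparing both bases with the
solution space avoids any relation between them. -/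
lemma solutionSpace_eight_eq_span_theta : solutionSpace (xParam 1) (yParam (xParam 1)) =
    Submodule.span ℂ {thetaVac 8, thetaVec 8, thetaSpin 8} := by
  rw [← range_cons_three]
  refine solutionSpace_eq_span linearIndependent_theta_eight fun i => ?_
  fin_cases i
  · exact thetaVac_mem (Or.inl ⟨rfl, rfl⟩)
  · exact thetaVec_mem (Or.inl ⟨rfl, rfl⟩)
  · exact thetaSpin_mem (Or.inl ⟨rfl, rfl⟩)

lemma solutionSpace_twenty_eq_span_theta : solutionSpace (xParam 2) (yParam (xParam 2)) =
    Submodule.span ℂ {thetaVac 20, thetaVec 20, thetaSpin 20} := by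
  rw [← range_cons_three]
  refine solutionSpace_eq_span linearIndependent_theta_twenty fun i => ?_
  fin_cases i
  · exact thetaVac_mem (Or.inr ⟨rfl, rfl⟩)
  · exact thetaVec_mem (Or.inr ⟨rfl, rfl⟩)
  · exact thetaSpin_mem (Or.inr ⟨rfl, rfl⟩)

/-! ### Products of series over families of indices -/

/-- Induction on the number of factors, splitting off the first index and multiplying absolutely
convergent series. -/
lemma summable_norm_prod_fin_and_tsum {κ : Type*} (n : ℕ) (f : Fin n → κ → ℂ)
    (hf : ∀ i, Summable fun k => ‖f i k‖) :
    (Summable fun g : Fin n → κ => ‖∏ i, f i (g i)‖) ∧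
      ∑' g : Fin n → κ, ∏ i, f i (g i) = ∏ i, ∑' k, f i k := by
  induction n with
  | zero => exact ⟨(hasSum_fintype _).summable, by simp⟩
  | succ n ih =>
    obtain ⟨h1, h2⟩ := ih (fun i => f i.succ) fun i => hf i.succ
    let e := Fin.consEquiv (n := n) fun _ => κ
    have he (p : κ × (Fin n → κ)) :
        ∏ i, f i (e p i) = f 0 p.1 * ∏ i : Fin n, f i.succ (p.2 i) := by
      simp [e, Fin.prod_univ_succ, Fin.consEquiv]
    constructor
    · rw [← e.summable_iff]
      refine ((hf 0).mul_norm h1).congr fun p => ?_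
      rw [Function.comp_apply, he]
    · rw [← e.tsum_eq, Fin.prod_univ_succ, ← h2, tsum_mul_tsum_of_summable_norm (hf 0) h1]
      exact tsum_congr he

lemma summable_norm_prod_pi_and_tsum {ι κ : Type*} [Fintype ι] (f : ι → κ → ℂ)
    (hf : ∀ i, Summable fun k => ‖f i k‖) :
    (Summable fun g : ι → κ => ‖∏ i, f i (g i)‖) ∧
      ∑' g : ι → κ, ∏ i, f i (g i) = ∏ i, ∑' k, f i k := by
  let e := Fintype.equivFin ι
  let E : (ι → κ) ≃ (Fin (Fintype.card ι) → κ) := e.arrowCongr (Equiv.refl κ)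
  obtain ⟨h1, h2⟩ := summable_norm_prod_fin_and_tsum _ (fun i => f (e.symm i))
    fun i => hf (e.symm i)
  have hE (g : ι → κ) : ∏ i, f (e.symm i) (E g i) = ∏ i, f i (g i) := by
    simp only [E, Equiv.arrowCongr_apply, Function.comp_apply, Equiv.coe_refl, id]
    exact e.symm.prod_comp fun i => f i (g i)
  constructor
  · rw [← E.summable_iff] at h1
    exact h1.congr fun g => by rw [Function.comp_apply, hE]
  · rw [← E.tsum_eq, e.symm.prod_comp (fun i => ∑' k, f i k)] at h2
    rw [← h2]
    exact tsum_congr fun g => (hE g).symm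

/-- The geometric series in finitely many of the variables, as a sum over all multi-indices. -/
lemma hasSum_finsupp_indicator {ι : Type*} (x : ι → ℂ) (hx : ∀ i, ‖x i‖ < 1) (s : Finset ι) :
    HasSum ({m : ι →₀ ℕ | m.support ⊆ s}.indicator fun m => m.prod fun i e => x i ^ e)
      (∏ i ∈ s, (1 - x i)⁻¹) := by
  classical
  obtain ⟨h1, h2⟩ := summable_norm_prod_pi_and_tsum (fun (i : s) (k : ℕ) => x i ^ k)
    fun i => by simpa using summable_geometric_of_lt_one (norm_nonneg _) (hx i)
  have h3 : HasSum (fun g : s → ℕ => ∏ i : s, x i ^ g i) (∏ i ∈ s, (1 - x i)⁻¹) := by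
    rw [← Finset.prod_coe_sort s]
    simp_rw [fun i : s => (tsum_geometric_of_norm_lt_one (hx i))] at h2
    rw [← h2]
    exact (Summable.of_norm h1).hasSum
  let E : {m : ι →₀ ℕ // (m.support : Set ι) ⊆ (s : Set ι)} ≃ (s → ℕ) :=
    (Finsupp.restrictSupportEquiv (s : Set ι) ℕ).trans Finsupp.equivFunOnFinite
  rw [← E.hasSum_iff] at h3
  have h4 : ∀ m : {m : ι →₀ ℕ // (m.support : Set ι) ⊆ (s : Set ι)},
      ∏ i : s, x i ^ E m i = m.1.prod fun i e => x i ^ e := by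
    intro m
    rw [Finsupp.prod_of_support_subset m.1 (by exact_mod_cast m.2) _ (by simp),
      ← Finset.prod_coe_sort s]
    rfl
  have h5 : {m : ι →₀ ℕ | m.support ⊆ s} = {m | (m.support : Set ι) ⊆ (s : Set ι)} := by
    ext m; simp
  rw [h5, ← hasSum_subtype_iff_indicator]
  exact h3.congr_fun fun m => (h4 m).symm


/-- If the partial products of `∏ (1 - x i)⁻¹` along an exhaustion converge, and those of
`∏ (1 - ‖x i‖)⁻¹` are bounded, the sum over all monomials in the `x i` converges absolutely to the
limit. -/
lemma hasSum_finsupp_prod {ι : Type*} (x : ι → ℂ) (hx : ∀ i, ‖x i‖ < 1) (s : ℕ → Finset ι)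
    (hs : Monotone s) (hs' : ∀ i, ∃ N, i ∈ s N) {P : ℂ} {B : ℝ}
    (hP : Tendsto (fun N => ∏ i ∈ s N, (1 - x i)⁻¹) atTop (𝓝 P))
    (hB : ∀ N, ∏ i ∈ s N, (1 - ‖x i‖)⁻¹ ≤ B) :
    (Summable fun m : ι →₀ ℕ => ‖m.prod fun i e => x i ^ e‖) ∧
      HasSum (fun m : ι →₀ ℕ => m.prod fun i e => x i ^ e) P := by
  classical
  have hex (t : Finset ι) : ∃ N, t ⊆ s N := by
    induction t using Finset.induction_on with
    | empty => exact ⟨0, by simp⟩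
    | insert a t _ ih =>
      obtain ⟨N, hN⟩ := ih
      obtain ⟨M, hM⟩ := hs' a
      refine ⟨max M N, Finset.insert_subset (hs (le_max_left _ _) hM)
        (hN.trans (hs (le_max_right _ _)))⟩
  have hnorm (m : ι →₀ ℕ) : ‖m.prod fun i e => x i ^ e‖ = m.prod fun i e => ‖x i‖ ^ e := by
    simp [Finsupp.prod, norm_prod]
  have hnorm' (m : ι →₀ ℕ) : (m.prod fun i e => ((‖x i‖ : ℝ) : ℂ) ^ e) =
      ((m.prod fun i e => ‖x i‖ ^ e : ℝ) : ℂ) := by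
    simp [Finsupp.prod]
  have hsum : Summable fun m : ι →₀ ℕ => ‖m.prod fun i e => x i ^ e‖ := by
    refine summable_of_sum_le (c := B) (fun m => norm_nonneg _) fun u => ?_
    -- A finite set of monomials involves finitely many variables, so its norm sum is at most a
    -- partial product of geometric series.
    obtain ⟨N, hN⟩ := hex (u.biUnion fun m => m.support)
    have h := hasSum_finsupp_indicator (fun i => ((‖x i‖ : ℝ) : ℂ))
      (fun i => by simpa using hx i) (s N)
    have h2 : HasSum ({m : ι →₀ ℕ | m.support ⊆ s N}.indicator
        fun m => m.prod fun i e => ‖x i‖ ^ e) (∏ i ∈ s N, (1 - ‖x i‖)⁻¹) := by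
      rw [← Complex.hasSum_ofReal]
      rw [show ((∏ i ∈ s N, (1 - ‖x i‖)⁻¹ : ℝ) : ℂ) = ∏ i ∈ s N, (1 - (‖x i‖ : ℂ))⁻¹ by
        push_cast; rfl]
      refine h.congr_fun fun m => ?_
      by_cases hm : m ∈ {m : ι →₀ ℕ | m.support ⊆ s N}
      · rw [Set.indicator_of_mem hm, Set.indicator_of_mem hm, ← hnorm']
      · rw [Set.indicator_of_notMem hm, Set.indicator_of_notMem hm, Complex.ofReal_zero]
    refine le_trans ?_ (hB N)
    refine le_trans (Finset.sum_le_sum fun m hm => ?_) (sum_le_hasSum u (fun m _ => ?_) h2)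
    · rw [Set.indicator_of_mem, hnorm]
      exact (Finset.subset_biUnion_of_mem (fun m : ι →₀ ℕ => m.support) hm).trans hN
    · exact Set.indicator_nonneg (fun m _ => by rw [← hnorm]; exact norm_nonneg _) m
  refine ⟨hsum, ?_⟩
  have hlim := tendsto_tsum_of_dominated_convergence (𝓕 := atTop)
    (f := fun N => {m : ι →₀ ℕ | m.support ⊆ s N}.indicator fun m => m.prod fun i e => x i ^ e)
    (g := fun m => m.prod fun i e => x i ^ e) hsum (fun m => ?_)
    (Eventually.of_forall fun N m => norm_indicator_le_norm_self _ _)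
  · have : ∑' m : ι →₀ ℕ, (m.prod fun i e => x i ^ e) = P := by
      refine tendsto_nhds_unique hlim (hP.congr fun N => ?_)
      exact ((hasSum_finsupp_indicator x hx (s N)).tsum_eq).symm
    rw [← this]
    exact (Summable.of_norm hsum).hasSum
  · obtain ⟨N, hN⟩ := hex m.support
    refine tendsto_const_nhds.congr' ?_
    filter_upwards [eventually_ge_atTop N] with M hM
    rw [Set.indicator_of_mem]
    exact hN.trans (hs hM)

/-! ### The oscillator sum -/

lemma tendsto_prod_one_sub_qpow (τ : ℍ) :
    Tendsto (fun N => ∏ k ∈ Finset.range N, (1 - qpow τ 1 ^ (k + 1))) atTop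
      (𝓝 (∏' k : ℕ, (1 - qpow τ 1 ^ (k + 1)))) :=
  (ModularForm.multipliable_one_sub_pow (norm_qpow_one_lt τ)).hasProd.tendsto_prod_nat

lemma tprod_one_sub_qpow_ne_zero (τ : ℍ) : ∏' k : ℕ, (1 - qpow τ 1 ^ (k + 1)) ≠ 0 := by
  rw [qpow_one_eq_qParam]
  exact ModularForm.eta_tprod_ne_zero τ.2

lemma eta_eq_qpow_mul_tprod (τ : ℍ) :
    ModularForm.eta τ = qpow τ (1 / 24) * ∏' k : ℕ, (1 - qpow τ 1 ^ (k + 1)) := by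
  rw [qpow_one_eq_qParam, ModularForm.eta]
  congr 1
  rw [qpow, Function.Periodic.qParam]
  congr 1
  push_cast
  ring

lemma tendsto_prod_oscillators (l : ℕ) (τ : ℍ) :
    Tendsto (fun N => ∏ p ∈ (Finset.univ : Finset (Fin l)) ×ˢ Finset.range N,
      (1 - qpow τ 1 ^ (p.2 + 1))⁻¹) atTop
      (𝓝 (((∏' k : ℕ, (1 - qpow τ 1 ^ (k + 1)))⁻¹) ^ l)) := by
  refine (((tendsto_prod_one_sub_qpow τ).inv₀ (tprod_one_sub_qpow_ne_zero τ)).pow l).congr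
    fun N => ?_
  rw [Finset.prod_product]
  dsimp only
  rw [Finset.prod_const, Finset.card_univ, Fintype.card_fin,
    Finset.prod_inv_distrib]

lemma hasSum_oscillators (l : ℕ) (τ : ℍ) :
    (Summable fun m : Fin l × ℕ →₀ ℕ => ‖m.prod fun p e => (qpow τ 1 ^ (p.2 + 1)) ^ e‖) ∧
      HasSum (fun m : Fin l × ℕ →₀ ℕ => m.prod fun p e => (qpow τ 1 ^ (p.2 + 1)) ^ e)
        (((∏' k : ℕ, (1 - qpow τ 1 ^ (k + 1)))⁻¹) ^ l) := by
  have hq := norm_qpow_one_lt τ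
  -- A point where q takes the value |q(τ)|: the bound on the products of norms is the convergence
  -- already known there.
  obtain ⟨τ', hτ'⟩ := exists_qpow_one_eq (z := ((‖qpow τ 1‖ : ℝ) : ℂ)) (by simpa using hq)
    (by simpa using qpow_ne_zero τ 1)
  obtain ⟨B, hB⟩ := (tendsto_prod_oscillators l τ').norm.bddAbove_range
  refine hasSum_finsupp_prod (fun p : Fin l × ℕ => qpow τ 1 ^ (p.2 + 1)) (fun p => ?_)
    (fun N => Finset.univ ×ˢ Finset.range N) (fun M N h => ?_) (fun p => ⟨p.2 + 1, by simp⟩)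
    (tendsto_prod_oscillators l τ) (B := B) fun N => ?_
  · rw [norm_pow]
    exact pow_lt_one₀ (norm_nonneg _) hq (by simp)
  · exact Finset.product_subset_product_right (Finset.range_mono h)
  · refine le_trans (le_of_eq ?_) (hB ⟨N, rfl⟩)
    dsimp only
    rw [norm_prod]
    refine Finset.prod_congr rfl fun p _ => ?_
    have h0 : 0 ≤ 1 - ‖qpow τ 1‖ ^ (p.2 + 1) :=
      sub_nonneg.2 (pow_le_one₀ (norm_nonneg _) hq.le)
    have h1 : (1 : ℂ) - ((‖qpow τ 1‖ : ℝ) : ℂ) ^ (p.2 + 1) =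
        ((1 - ‖qpow τ 1‖ ^ (p.2 + 1) : ℝ) : ℂ) := by push_cast; rfl
    rw [hτ', norm_inv, norm_pow, h1, Complex.norm_real, Real.norm_of_nonneg h0]

/-! ### Dimensions of the weight spaces -/

/-- Coordinates of `V_{γ+L}` with respect to the basis of monomials. -/
def latticeModuleCoords (l : ℕ) (γ : Fin l → ℚ) :
    LatticeModule l γ ≃ₗ[ℂ] (Coset l γ × (Fin l × ℕ →₀ ℕ) →₀ ℂ) :=
  (Finsupp.mapRange.linearEquiv (MvPolynomial.basisMonomials (Fin l × ℕ) ℂ).repr).trans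
    (Finsupp.curryLinearEquiv ℂ).symm

lemma latticeModuleCoords_apply (l : ℕ) (γ : Fin l → ℚ) (u : LatticeModule l γ)
    (p : Coset l γ × (Fin l × ℕ →₀ ℕ)) :
    latticeModuleCoords l γ u p = MvPolynomial.coeff p.2 (u p.1) := by
  rfl

/-- Monomials tensored with e^α form a basis of homogeneous vectors, so a weight space is spanned by
the basis vectors of that weight. -/
lemma finrank_weightSpace (l : ℕ) (γ : Fin l → ℚ) (Δ : ℚ) :
    Module.finrank ℂ (weightSpace l γ Δ) =
      Nat.card ((fun p : Coset l γ × (Fin l × ℕ →₀ ℕ) => basisWeight l p.2 p.1.1) ⁻¹' {Δ}) := by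
  set S := (fun p : Coset l γ × (Fin l × ℕ →₀ ℕ) => basisWeight l p.2 p.1.1) ⁻¹' {Δ}
  have h : Submodule.map (latticeModuleCoords l γ : LatticeModule l γ →ₗ[ℂ] _)
      (weightSpace l γ Δ) = Finsupp.supported ℂ ℂ S := by
    ext v
    rw [Submodule.mem_map_equiv, Finsupp.mem_supported]
    obtain ⟨u, rfl⟩ := (latticeModuleCoords l γ).surjective v
    rw [LinearEquiv.symm_apply_apply]
    constructor
    · intro hu p hp
      rw [Finset.mem_coe, Finsupp.mem_support_iff, latticeModuleCoords_apply] at hp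
      exact hu p.1 p.2 hp
    · intro hu α m hm
      refine hu (a := (α, m)) ?_
      rwa [Finset.mem_coe, Finsupp.mem_support_iff, latticeModuleCoords_apply]
  exact Module.finrank_eq_nat_card_basis (.ofRepr
    (((latticeModuleCoords l γ).ofSubmodules _ _ h).trans (Finsupp.supportedEquivFinsupp S)))

/-- The sum over basis vectors, grouped by weight: each fibre contributes its cardinality, which is
the dimension. -/
lemma character_eq_of_hasSum {l : ℕ} {γ : Fin l → ℚ} {τ : ℍ} {c : ℂ}
    (h : HasSum (fun p : Coset l γ × (Fin l × ℕ →₀ ℕ) =>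
      qpow τ ((basisWeight l p.2 p.1.1 : ℂ) - (l : ℂ) / 24)) c) : character l γ τ = c := by
  rw [← (h.tsum_fiberwise fun p => basisWeight l p.2 p.1.1).tsum_eq, character]
  refine tsum_congr fun Δ => ?_
  rw [finrank_weightSpace, ← nsmul_eq_mul, ← tsum_const]
  refine tsum_congr fun p => ?_
  rw [show basisWeight l p.1.2 p.1.1.1 = Δ from p.2]

lemma qpow_sum {ι : Type*} (τ : ℍ) (s : Finset ι) (r : ι → ℂ) :
    qpow τ (∑ i ∈ s, r i) = ∏ i ∈ s, qpow τ (r i) := by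
  simp only [qpow]
  rw [Finset.mul_sum, Finset.sum_mul, Complex.exp_sum]

lemma qpow_basisWeight (l : ℕ) (τ : ℍ) (m : Fin l × ℕ →₀ ℕ) (α : Fin l → ℚ) :
    qpow τ ((basisWeight l m α : ℂ) - (l : ℂ) / 24) = qpow τ (-(l * (1 / 24))) *
      ((∏ i, qpow τ ((α i : ℂ) ^ 2 / 2)) * m.prod fun p e => (qpow τ 1 ^ (p.2 + 1)) ^ e) := by
  have e1 : (m.prod fun p e => (qpow τ 1 ^ (p.2 + 1)) ^ e) =
      qpow τ (m.sum fun p e => (e : ℂ) * ((p.2 : ℂ) + 1)) := by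
    rw [Finsupp.prod, Finsupp.sum, qpow_sum]
    refine Finset.prod_congr rfl fun j _ => ?_
    rw [← qpow_natCast, ← qpow_nat_mul]
    push_cast
    rfl
  have e2 : (basisWeight l m α : ℂ) =
      (m.sum fun p e => (e : ℂ) * ((p.2 : ℂ) + 1)) + ∑ i, (α i : ℂ) ^ 2 / 2 := by
    rw [basisWeight, Finsupp.sum, Finsupp.sum, dotProduct, Finset.sum_div]
    push_cast
    simp_rw [sq]
  rw [e1, ← qpow_sum, ← qpow_add, ← qpow_add, e2]
  congr 1
  ring

/-- The character of `V_{γ+L}` is the theta series of the coset divided by `η ^ l`. -/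
lemma character_eq_div_eta {l : ℕ} {γ : Fin l → ℚ} {τ : ℍ} {c : ℂ}
    (hs : Summable fun α : Coset l γ => ‖∏ i, qpow τ ((α.1 i : ℂ) ^ 2 / 2)‖)
    (h : HasSum (fun α : Coset l γ => ∏ i, qpow τ ((α.1 i : ℂ) ^ 2 / 2)) c) :
    character l γ τ = c / ModularForm.eta τ ^ l := by
  obtain ⟨h1, h2⟩ := hasSum_oscillators l τ
  have h3 := summable_mul_of_summable_norm hs h1
  have h4 := (h.mul h2 h3).mul_left (qpow τ (-(l * (1 / 24))))
  have h5 := character_eq_of_hasSum (h4.congr_fun fun p => qpow_basisWeight l τ p.2 p.1.1)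
  rw [h5, eta_eq_qpow_mul_tprod]
  generalize ∏' k : ℕ, (1 - qpow τ 1 ^ (k + 1)) = P
  rw [mul_pow, qpow_neg, qpow_nat_mul, inv_pow, div_eq_mul_inv c, mul_inv]
  ring

/-! ### Theta series of the cosets of `D_l` -/

/-- Pairing with e_i - e_o shows that all coordinates agree modulo 1; pairing with 2e_o shows that
they are half-integers. The parity of the latter pairing is ε. -/
lemma exists_of_mem_dualLattice {l : ℕ} (hl : 0 < l) {γ : Fin l → ℚ} (hγ : γ ∈ dualLattice l) :
    ∃ (ε : ℕ) (g : Fin l → ℤ), ε < 2 ∧ ∀ i, γ i = g i + ε / 2 := by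
  classical
  let o : Fin l := ⟨0, hl⟩
  have h1 (i : Fin l) : ∃ z : ℤ, γ i - γ o = z := by
    have hu : Pi.single i 1 - Pi.single o 1 ∈ rootLattice l := by
      refine ⟨fun j => ⟨(Pi.single i 1 - Pi.single o 1 : Fin l → ℤ) j, ?_⟩, 0, ?_⟩
      · simp [Pi.single_apply]
      · simp [Finset.sum_sub_distrib]
    obtain ⟨z, hz⟩ := hγ _ hu
    exact ⟨z, by simpa [dotProduct_sub] using hz⟩
  have hu : Pi.single o 2 ∈ rootLattice l := by
    refine ⟨fun j => ⟨(Pi.single o 2 : Fin l → ℤ) j, ?_⟩, 1, ?_⟩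
    · simp only [Pi.single_apply]
      split_ifs <;> simp
    · simp
  obtain ⟨z, hz⟩ := hγ _ hu
  rw [dotProduct_single] at hz
  choose d hd using h1
  refine ⟨(z % 2).toNat, fun i => d i + z / 2, by omega, fun i => ?_⟩
  have h2 : ((z % 2).toNat : ℚ) = z - 2 * (z / 2 : ℤ) := by
    have : ((z % 2).toNat : ℤ) = z - 2 * (z / 2) := by omega
    exact_mod_cast this
  rw [h2]
  push_cast
  have := hd i
  linarith

lemma neg_one_zpow_sum {ι : Type*} (s : Finset ι) (n : ι → ℤ) :
    (-1 : ℂ) ^ (∑ i ∈ s, n i) = ∏ i ∈ s, (-1 : ℂ) ^ n i := by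
  classical
  induction s using Finset.induction_on with
  | empty => simp
  | insert a s ha ih =>
    rw [Finset.sum_insert ha, Finset.prod_insert ha, zpow_add₀ (by norm_num), ih]

lemma norm_neg_one_zpow (n : ℤ) : ‖(-1 : ℂ) ^ n‖ = 1 := by simp

/-- Restricting the theta series of `ℤ^l` (shifted by `ε / 2`) to a coset of `D_l`. -/
lemma hasSum_coset {l ε : ℕ} (hε : ε < 2) {γ : Fin l → ℚ} {g : Fin l → ℤ}
    (hγ : ∀ i, γ i = g i + ε / 2) (τ : ℍ) :
    (Summable fun α : Coset l γ => ‖∏ i, qpow τ ((α.1 i : ℂ) ^ 2 / 2)‖) ∧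
    HasSum (fun α : Coset l γ => ∏ i, qpow τ ((α.1 i : ℂ) ^ 2 / 2))
      (((∑' n : ℤ, qpow τ (((n : ℂ) + ε / 2) ^ 2 / 2)) ^ l + (-1) ^ (∑ i, g i) *
        (∑' n : ℤ, (-1) ^ n * qpow τ (((n : ℂ) + ε / 2) ^ 2 / 2)) ^ l) / 2) := by
  have hw : Summable fun n : ℤ => ‖qpow τ (((n : ℂ) + ε / 2) ^ 2 / 2)‖ :=
    (summable_qpow_sq τ (ε / 2)).norm
  have hw' : Summable fun n : ℤ => ‖(-1) ^ n * qpow τ (((n : ℂ) + ε / 2) ^ 2 / 2)‖ :=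
    hw.congr fun n => by rw [norm_mul, norm_neg_one_zpow, one_mul]
  obtain ⟨a1, a2⟩ := summable_norm_prod_pi_and_tsum
    (fun (_ : Fin l) (n : ℤ) => qpow τ (((n : ℂ) + ε / 2) ^ 2 / 2)) fun _ => hw
  obtain ⟨b1, b2⟩ := summable_norm_prod_pi_and_tsum
    (fun (_ : Fin l) (n : ℤ) => (-1) ^ n * qpow τ (((n : ℂ) + ε / 2) ^ 2 / 2)) fun _ => hw'
  rw [Finset.prod_const, Finset.card_univ, Fintype.card_fin] at a2 b2
  have hA := (Summable.of_norm a1).hasSum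
  have hB := (Summable.of_norm b1).hasSum
  rw [a2] at hA
  rw [b2] at hB
  -- Averaging 1 with the sign of ∑ g + ∑ n gives the indicator of the vectors n + ε/2 whose
  -- coordinate sum has the right parity, which are exactly the coset.
  have hsum := (hA.add (hB.mul_left ((-1) ^ (∑ i, g i)))).div_const 2
  -- As ε/2 is 0 or 1/2, the floor recovers the integral part of each coordinate.
  let φ : Coset l γ → Fin l → ℤ := fun α i => ⌊α.1 i⌋
  have hφ (α : Coset l γ) : (∀ i, α.1 i = φ α i + ε / 2) ∧
      ∃ m : ℤ, ∑ i, φ α i = ∑ i, g i + 2 * m := by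
    obtain ⟨h1, m, hm⟩ := α.2
    choose d hd using h1
    have h3 (i : Fin l) : α.1 i = (g i + d i : ℤ) + ε / 2 := by
      have := hd i
      rw [Pi.sub_apply, hγ] at this
      push_cast
      linarith
    have h4 (i : Fin l) : φ α i = g i + d i := by
      simp only [φ]
      rw [Int.floor_eq_iff, h3]
      have h5 : (ε : ℚ) ≤ 1 := by exact_mod_cast Nat.lt_succ_iff.1 hε
      have h6 : (0 : ℚ) ≤ ε := Nat.cast_nonneg ε
      constructor <;> linarith
    refine ⟨fun i => by rw [h4, h3], m, ?_⟩
    simp_rw [h4]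
    rw [Finset.sum_add_distrib]
    congr 1
    have : ((∑ i, d i : ℤ) : ℚ) = ((2 * m : ℤ) : ℚ) := by
      push_cast
      rw [← hm]
      exact Finset.sum_congr rfl fun i _ => (hd i).symm
    exact_mod_cast this
  have hinj : Function.Injective φ := fun α β h => by
    ext i
    rw [(hφ α).1, (hφ β).1, h]
  have hterm (α : Coset l γ) (i : Fin l) :
      (α.1 i : ℂ) ^ 2 / 2 = ((φ α i : ℂ) + ε / 2) ^ 2 / 2 := by
    rw [(hφ α).1]
    push_cast
    rfl
  constructor
  · refine (a1.comp_injective hinj).congr fun α => ?_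
    simp only [Function.comp_apply, hterm]
  · rw [← hinj.hasSum_iff] at hsum
    · refine hsum.congr_fun fun α => ?_
      obtain ⟨m, hm⟩ := (hφ α).2
      simp only [Function.comp_apply, hterm, Finset.prod_mul_distrib]
      rw [← neg_one_zpow_sum, hm, ← mul_assoc, ← zpow_add₀ (by norm_num),
        (show Even (∑ i, g i + (∑ i, g i + 2 * m)) from ⟨∑ i, g i + m, by ring⟩).neg_one_zpow]
      ring
    · intro n hn
      rw [Finset.prod_mul_distrib, ← neg_one_zpow_sum, ← mul_assoc, ← zpow_add₀ (by norm_num)]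
      rcases Int.even_or_odd (∑ i, g i + ∑ i, n i) with h | h
      · refine absurd ⟨⟨fun i => n i + ε / 2, fun i => ⟨n i - g i, ?_⟩, ?_⟩, ?_⟩ hn
        · rw [Pi.sub_apply, hγ]
          push_cast
          ring
        · obtain ⟨m, hm⟩ := h
          refine ⟨m - ∑ i, g i, ?_⟩
          have : (∑ i, (g i : ℚ)) + ∑ i, (n i : ℚ) = m + m := by exact_mod_cast hm
          simp only [Pi.sub_apply, hγ, add_sub_add_right_eq_sub, Finset.sum_sub_distrib]
          push_cast
          linarith
        · funext i
          simp only [φ]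
          rw [Int.floor_eq_iff]
          have h5 : (ε : ℚ) ≤ 1 := by exact_mod_cast Nat.lt_succ_iff.1 hε
          have h6 : (0 : ℚ) ≤ ε := Nat.cast_nonneg ε
          constructor <;> linarith
      · rw [h.neg_one_zpow]
        ring

lemma alternating_theta2_eq_zero (τ : ℍ) :
    ∑' n : ℤ, (-1) ^ n * qpow τ (((n : ℂ) + 1 / 2) ^ 2 / 2) = 0 := by
  have h : ∑' n : ℤ, (-1) ^ n * qpow τ (((n : ℂ) + 1 / 2) ^ 2 / 2) =
      -∑' n : ℤ, (-1) ^ n * qpow τ (((n : ℂ) + 1 / 2) ^ 2 / 2) := by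
    -- The reflection n ↦ -1 - n preserves (n + 1/2)² and reverses the sign.
    rw [← tsum_neg, ← (Equiv.subLeft (-1 : ℤ)).tsum_eq]
    refine tsum_congr fun n => ?_
    rw [Equiv.subLeft_apply, zpow_sub₀ (by norm_num)]
    push_cast
    rw [show (-1 - (n : ℂ) + 1 / 2) ^ 2 = (n + 1 / 2) ^ 2 by ring]
    rcases Int.even_or_odd n with h | h <;> simp [h.neg_one_zpow]
  exact self_eq_neg.1 h

/-- The character of `V_{γ+L}` for `γ` integral. -/
lemma character_of_integral {l : ℕ} {γ : Fin l → ℚ} {g : Fin l → ℤ} (hγ : ∀ i, γ i = g i) :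
    character l γ = if Even (∑ i, g i) then thetaVac l else thetaVec l := by
  funext τ
  obtain ⟨h1, h2⟩ := hasSum_coset (ε := 0) zero_lt_two (fun i => by simpa using hγ i) τ
  rw [character_eq_div_eta h1 h2]
  simp only [Nat.cast_zero, zero_div, add_zero]
  split_ifs with h
  · rw [h.neg_one_zpow, thetaVac, theta3, theta0, div_div, one_mul]
  · rw [(Int.not_even_iff_odd.1 h).neg_one_zpow, thetaVec, theta3, theta0, div_div, neg_one_mul,
      sub_eq_add_neg]

/-- The character of `V_{γ+L}` for `γ` half-integral. -/
lemma character_of_half_integral {l : ℕ} (hl : 0 < l) {γ : Fin l → ℚ} {g : Fin l → ℤ}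
    (hγ : ∀ i, γ i = g i + 1 / 2) : character l γ = thetaSpin l := by
  funext τ
  obtain ⟨h1, h2⟩ := hasSum_coset (ε := 1) one_lt_two (fun i => by simpa using hγ i) τ
  rw [character_eq_div_eta h1 h2]
  simp only [Nat.cast_one]
  rw [alternating_theta2_eq_zero, zero_pow hl.ne', mul_zero, add_zero, thetaSpin, theta2, div_div]

/-- The characters of the simple modules of the lattice vertex operator algebra of `D_l`. -/
lemma character_image_dualLattice {l : ℕ} (hl : 0 < l) :
    character l '' dualLattice l = {thetaVac l, thetaVec l, thetaSpin l} := by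
  classical
  ext f
  simp only [Set.mem_image, Set.mem_insert_iff, Set.mem_singleton_iff]
  constructor
  · rintro ⟨γ, hγ, rfl⟩
    obtain ⟨ε, g, hε, hg⟩ := exists_of_mem_dualLattice hl hγ
    interval_cases ε
    · rw [character_of_integral (g := g) fun i => by simpa using hg i]
      split_ifs <;> simp
    · rw [character_of_half_integral hl (g := g) fun i => by simpa using hg i]
      simp
  · have hint (g : Fin l → ℤ) : (fun i => (g i : ℚ)) ∈ dualLattice l := by
      rintro u ⟨hu, -⟩
      choose d hd using hu
      refine ⟨∑ i, g i * d i, ?_⟩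
      simp [dotProduct, hd]
    rintro (rfl | rfl | rfl)
    · refine ⟨_, hint 0, ?_⟩
      rw [character_of_integral (g := 0) fun i => rfl]
      simp
    · refine ⟨_, hint (Pi.single ⟨0, hl⟩ 1), ?_⟩
      rw [character_of_integral (g := Pi.single ⟨0, hl⟩ 1) fun i => rfl]
      simp
    · refine ⟨fun _ => 1 / 2, ?_, character_of_half_integral hl (g := 0) fun i => by simp⟩
      rintro u ⟨-, m, hm⟩
      refine ⟨m, ?_⟩
      rw [dotProduct, ← Finset.mul_sum, hm]
      ring

/-! ### The `q`-expansion of `E₄ / η ^ 8` -/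

lemma qpow_vadd_one (τ : ℍ) (r : ℂ) :
    qpow ((1 : ℝ) +ᵥ τ) r = cexp (2 * Real.pi * I * r) * qpow τ r := by
  rw [qpow, qpow, ← Complex.exp_add]
  congr 1
  simp
  ring

/-- After multiplication by q^(1/3) the function is periodic and tends to 1, so it has a power
series in q with a_0 = 1. -/
lemma exists_hasQExpansion_e4OverEta8 :
    ∃ a : ℕ → ℂ, HasQExpansion e4OverEta8 (-1 / 3) a ∧ a 0 = 1 ∧ a 1 = 248 := by
  let F : ℍ → ℂ := fun τ => qpow τ (1 / 3) * e4OverEta8 τ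
  have hF : MDiff F := (mdifferentiable_qpow _).mul (e4OverEta8_mem 0).1
  have hT (τ : ℍ) : F ((1 : ℝ) +ᵥ τ) = F τ := by
    simp only [F, e4OverEta8]
    rw [qpow_vadd_one, levelOne_vadd_one, eta_vadd_one, mul_pow, ← Complex.exp_nat_mul,
      show ((8 : ℕ) : ℂ) * (2 * Real.pi * I / 24) = 2 * Real.pi * I * (1 / 3) by push_cast; ring]
    have h1 := Complex.exp_ne_zero (2 * Real.pi * I * (1 / 3))
    have h2 := eta_ne_zero τ
    field_simp
  have hlim : Tendsto F atImInfty (𝓝 1) := by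
    have h := hasLeadingTerm_e4OverEta8
    rw [HasLeadingTerm] at h
    norm_num at h
    simpa [F] using h
  obtain ⟨a, ha⟩ := exists_hasQExpansion hF hT (hlim.isBigO_one ℝ)
  have h0 : a 0 = 1 := tendsto_nhds_unique ha.tendsto hlim
  have hexp : HasQExpansion e4OverEta8 (-1 / 3) a := by
    rw [hasQExpansion_iff] at ha ⊢
    intro τ
    have h := ha τ
    rw [neg_zero, qpow_zero, one_mul] at h
    rwa [show -(-1 / 3 : ℂ) = 1 / 3 by ring]
  refine ⟨a, hexp, h0, ?_⟩
  -- The value 248 comes from the recursion instead of the product for η: at x = 0 it reads a_1/6 -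
  -- 124/3 = 0.
  have h := ((mem_solutionSpace_iff_isFrobenius hexp 0 _).1 (e4OverEta8_mem 0)).one
  rw [lowerCoeff_one, h0, indicial, yParam] at h
  linear_combination 6 * h

/-! ### Indicial roots -/

lemma indicialPoly_roots {x y r s t : ℂ} (h1 : r + s + t = 1 / 2) (h2 : r * s + r * t + s * t = x)
    (h3 : r * s * t = -y) : (indicialPoly x y).roots = {r, s, t} := by
  have h : indicialPoly x y = (Multiset.map (fun a => Polynomial.X - Polynomial.C a)
      {r, s, t}).prod := by
    have hy : y = -(r * s * t) := by rw [h3, neg_neg]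
    rw [indicialPoly, ← h1, ← h2, hy]
    simp only [Multiset.insert_eq_cons, Multiset.map_cons, Multiset.map_singleton,
      Multiset.prod_cons, Multiset.prod_singleton, map_add, map_mul, map_neg]
    ring
  rw [h, Polynomial.roots_multiset_prod_X_sub_C]

lemma indicialPoly_roots_xParam (n : ℕ) :
    (indicialPoly (xParam n) (yParam (xParam n))).roots =
      {7 / 6 - (n : ℂ), -1 / 3, (n : ℂ) - 1 / 3} := by
  refine indicialPoly_roots (by ring) ?_ ?_ <;> simp only [yParam, xParam] <;> ring

lemma eq_yParam_of_indicial {x y : ℂ} (h : indicial x y (-1 / 3) = 0) : y = yParam x := by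
  rw [indicial] at h
  rw [yParam]
  linear_combination h

/-- With y = x/3 + 5/54 the indicial polynomial at n - 1/3 factors as n (x - x_n); this is where x_n
comes from. -/
lemma eq_xParam_of_indicial {x : ℂ} {n : ℕ} (hn : n ≠ 0)
    (h : indicial x (yParam x) (-1 / 3 + n) = 0) : x = xParam n := by
  have h1 : (n : ℂ) * (x - xParam n) = 0 := by
    rw [← h, indicial, yParam, xParam]
    ring
  exact sub_eq_zero.1 ((mul_eq_zero.1 h1).resolve_left (Nat.cast_ne_zero.2 hn))

/-- A solution `q ^ (-1/3) (1 + 248 q + ⋯)` other than `E₄ / η ^ 8` forces a resonance. -/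
lemma exists_xParam_of_ne {x : ℂ} {f : ℍ → ℂ} {a : ℕ → ℂ} (hf : f ∈ solutionSpace x (yParam x))
    (ha : HasQExpansion f (-1 / 3) a) (h0 : a 0 = 1) (h1 : a 1 = 248) (hne : f ≠ e4OverEta8) :
    ∃ n : ℕ, 2 ≤ n ∧ x = xParam n := by
  classical
  obtain ⟨b, hb, hb0, hb1⟩ := exists_hasQExpansion_e4OverEta8
  have hF := (mem_solutionSpace_iff_isFrobenius (ha.sub hb) x (yParam x)).1
    (Submodule.sub_mem _ hf (e4OverEta8_mem x))
  have hex : ∃ k, (a - b) k ≠ 0 := by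
    by_contra! H
    have hab : a = b := funext fun k => sub_eq_zero.1 (H k)
    exact hne (ha.eq_of_coeff_eq (hab ▸ hb))
  have hmin (j : ℕ) (hj : j < Nat.find hex) : (a - b) j = 0 := not_not.1 (Nat.find_min hex hj)
  have h2 : 2 ≤ Nat.find hex := by
    rw [Nat.le_find_iff]
    intro m hm
    interval_cases m
    · simp [h0, hb0]
    · simp [h1, hb1]
  refine ⟨Nat.find hex, h2, eq_xParam_of_indicial (by omega) ?_⟩
  -- At the first nonzero coefficient of the difference the recursion has no earlier terms, so the
  -- indicial polynomial must vanish there.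
  have h := hF (Nat.find hex)
  rw [Finset.sum_eq_zero fun j hj => by rw [hmin j (Finset.mem_range.1 hj), mul_zero],
    add_zero] at h
  exact (mul_eq_zero.1 h).resolve_right (Nat.find_spec hex)

/-! ### The solution of index `7/6 - n` -/

lemma indicial_xParam_add (n : ℕ) (k : ℂ) :
    indicial (xParam n) (yParam (xParam n)) (7 / 6 - n + k) =
      k * (2 * k - 2 * n + 3) * (2 * k - 4 * n + 3) / 4 := by
  rw [indicial, yParam, xParam]
  ring

/-- No resonance: the last two factors are odd integers. -/
lemma indicial_xParam_add_ne_zero (n k : ℕ) (hk : 1 ≤ k) :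
    indicial (xParam n) (yParam (xParam n)) (7 / 6 - n + k) ≠ 0 := by
  rw [indicial_xParam_add]
  have h1 : (2 * k - 2 * n + 3 : ℂ) ≠ 0 := by
    have : (2 * k - 2 * n + 3 : ℤ) ≠ 0 := by omega
    exact_mod_cast this
  have h2 : (2 * k - 4 * n + 3 : ℂ) ≠ 0 := by
    have : (2 * k - 4 * n + 3 : ℤ) ≠ 0 := by omega
    exact_mod_cast this
  have h3 : (k : ℂ) ≠ 0 := Nat.cast_ne_zero.2 (by omega)
  exact div_ne_zero (mul_ne_zero (mul_ne_zero h3 h1) h2) (by norm_num)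

lemma existsUnique_solution_xParam (n : ℕ) :
    ∃! f : ℍ → ℂ, f ∈ solutionSpace (xParam n) (yParam (xParam n)) ∧
      ∃ b : ℕ → ℂ, HasQExpansion f (7 / 6 - (n : ℂ)) b ∧ b 0 = 1 := by
  have hr := indicial_xParam_add_ne_zero n
  have h0 : indicial (xParam n) (yParam (xParam n)) (7 / 6 - (n : ℂ)) = 0 := by
    simpa using indicial_xParam_add n 0
  have hF := isFrobenius_frobeniusCoeff h0 hr
  obtain ⟨f, hf, hexp⟩ := hF.exists_solution hr
  refine ⟨f, ⟨hf, _, hexp, frobeniusCoeff_zero _ _ _⟩, ?_⟩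
  rintro g ⟨hg, b, hb, hb0⟩
  have hFb := (mem_solutionSpace_iff_isFrobenius hb _ _).1 hg
  have := hFb.unique hF (by rw [hb0, frobeniusCoeff_zero]) hr
  exact (this ▸ hb).eq_of_coeff_eq hexp

lemma second_coeff_xParam {n : ℕ} {f : ℍ → ℂ} {b : ℕ → ℂ}
    (hf : f ∈ solutionSpace (xParam n) (yParam (xParam n)))
    (hb : HasQExpansion f (7 / 6 - (n : ℂ)) b) (h0 : b 0 = 1) :
    b 1 * ((2 * (n : ℂ) - 5) * (4 * (n : ℂ) - 5)) =
      -(4 * (6 * (n : ℂ) - 7) * (40 * (n : ℂ) ^ 2 - 30 * n + 17)) := by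
  have h := ((mem_solutionSpace_iff_isFrobenius hb _ _).1 hf).one
  rw [indicial_xParam_add, lowerCoeff_one, h0, yParam, xParam] at h
  linear_combination 4 * h

lemma second_coeff_natural_iff {n : ℕ} (hn : 1 ≤ n) {c : ℂ}
    (hc : c * ((2 * (n : ℂ) - 5) * (4 * (n : ℂ) - 5)) =
      -(4 * (6 * (n : ℂ) - 7) * (40 * (n : ℂ) ^ 2 - 30 * n + 17))) :
    (∃ k : ℕ, c = k) ↔ n = 1 ∨ n = 2 := by
  constructor
  · rintro ⟨k, rfl⟩
    by_contra! hne
    -- For n ≥ 3 every factor has positive coefficients in m = n - 3, so the formula makes the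
    -- coefficient negative.
    obtain ⟨m, rfl⟩ : ∃ m, n = m + 3 := ⟨n - 3, by omega⟩
    have h : (k : ℤ) * ((2 * m + 1) * (4 * m + 7)) +
        4 * (6 * m + 11) * (40 * m ^ 2 + 210 * m + 287) = 0 := by
      have h2 : (k : ℂ) * ((2 * m + 1) * (4 * m + 7)) +
          4 * (6 * m + 11) * (40 * m ^ 2 + 210 * m + 287) = 0 := by
        push_cast at hc
        linear_combination hc
      exact_mod_cast h2
    have : (0 : ℤ) < (k : ℤ) * ((2 * m + 1) * (4 * m + 7)) +
        4 * (6 * m + 11) * (40 * m ^ 2 + 210 * m + 287) := by positivity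
    omega
  · rintro (rfl | rfl)
    · refine ⟨36, ?_⟩
      push_cast at hc ⊢
      linear_combination hc / 3
    · refine ⟨780, ?_⟩
      push_cast at hc ⊢
      linear_combination -hc / 3

end ThirdOrderMLDE

end

/-! ### The main theorem -/

open ThirdOrderMLDE in
theorem mainTheorem3 :
    -- `E₄/η⁸ = q^{-1/3}(1 + 248 q + ⋯)` solves the equation with `y = x/3 + 5/54` for every `x`
    (∃ a : ℕ → ℂ, HasQExpansion e4OverEta8 (-1 / 3) a ∧ a 0 = 1 ∧ a 1 = 248) ∧
    (∀ x : ℂ, e4OverEta8 ∈ solutionSpace x (yParam x)) ∧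
    -- a solution `f₀ = q^{-1/3}(1 + 248 q + ⋯)`
    (∀ (x y : ℂ) (f₀ : UpperHalfPlane → ℂ) (a : ℕ → ℂ),
      f₀ ∈ solutionSpace x y → HasQExpansion f₀ (-1 / 3) a → a 0 = 1 → a 1 = 248 →
        y = yParam x ∧
        (∀ s : ℂ, s ^ 2 = 3 * (-48 * x - 5) →
          (indicialPoly x y).roots = {-1 / 3, (5 - s) / 12, (5 + s) / 12}) ∧
        (f₀ ≠ e4OverEta8 →
          ∃ n : ℕ, 2 ≤ n ∧ x = xParam n ∧
            (indicialPoly x y).roots = {7 / 6 - (n : ℂ), -1 / 3, (n : ℂ) - 1 / 3})) ∧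
    -- the solution `f₃` of index `7/6 - n` and its second coefficient
    (∀ n : ℕ, 1 ≤ n →
      (indicialPoly (xParam n) (yParam (xParam n))).roots
          = {7 / 6 - (n : ℂ), -1 / 3, (n : ℂ) - 1 / 3} ∧
      (∃! f₃ : UpperHalfPlane → ℂ, f₃ ∈ solutionSpace (xParam n) (yParam (xParam n)) ∧
        ∃ b : ℕ → ℂ, HasQExpansion f₃ (7 / 6 - (n : ℂ)) b ∧ b 0 = 1) ∧
      (∀ (f₃ : UpperHalfPlane → ℂ) (b : ℕ → ℂ),
        f₃ ∈ solutionSpace (xParam n) (yParam (xParam n)) →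
        HasQExpansion f₃ (7 / 6 - (n : ℂ)) b → b 0 = 1 →
          b 1 = -(4 * (6 * (n : ℂ) - 7) * (40 * (n : ℂ) ^ 2 - 30 * n + 17))
            / ((2 * (n : ℂ) - 5) * (4 * (n : ℂ) - 5)) ∧
          ((∃ k : ℕ, b 1 = k) ↔ n = 1 ∨ n = 2))) ∧
    -- `n = 1`: the characters of `L_{D₈,1}`
    (solutionSpace (xParam 1) (yParam (xParam 1)) = characterSpace 8 ∧
      character 8 '' dualLattice 8 = {thetaVac 8, thetaVec 8, thetaSpin 8} ∧
      LinearIndependent ℂ ![e4OverEta8, thetaVec 8, thetaSpin 8] ∧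
      solutionSpace (xParam 1) (yParam (xParam 1))
        = Submodule.span ℂ {e4OverEta8, thetaVec 8, thetaSpin 8}) ∧
    -- `n = 2`: the characters of `L_{D₂₀,1}`
    (solutionSpace (xParam 2) (yParam (xParam 2)) = characterSpace 20 ∧
      character 20 '' dualLattice 20 = {thetaVac 20, thetaVec 20, thetaSpin 20} ∧
      LinearIndependent ℂ ![thetaVac 20, thetaVec 20, thetaSpin 20] ∧
      solutionSpace (xParam 2) (yParam (xParam 2))
        = Submodule.span ℂ {thetaVac 20, thetaVec 20, thetaSpin 20}) := by
  refine ⟨exists_hasQExpansion_e4OverEta8, e4OverEta8_mem, ?_, ?_, ?_, ?_⟩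
  · intro x y f₀ a hf ha h0 h1
    have hy := eq_yParam_of_indicial
      (((mem_solutionSpace_iff_isFrobenius ha x y).1 hf).indicial_eq_zero (by simp [h0]))
    subst hy
    refine ⟨rfl, fun s hs => ?_, fun hne => ?_⟩
    -- Vieta's formulas: beside -1/3 the roots have sum 5/6 and product x + 5/18, and either square
    -- root s serves.
    · refine indicialPoly_roots (by ring) ?_ ?_
      · linear_combination -hs / 144
      · rw [yParam]
        linear_combination hs / 432
    · obtain ⟨n, hn, rfl⟩ := exists_xParam_of_ne hf ha h0 h1 hne
      exact ⟨n, hn, rfl, indicialPoly_roots_xParam n⟩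
  · intro n hn
    refine ⟨indicialPoly_roots_xParam n, existsUnique_solution_xParam n, fun f₃ b hf hb h0 => ?_⟩
    have h := second_coeff_xParam hf hb h0
    refine ⟨?_, second_coeff_natural_iff hn h⟩
    have h1 : (2 * n - 5 : ℂ) ≠ 0 := by
      have : (2 * n - 5 : ℤ) ≠ 0 := by omega
      exact_mod_cast this
    have h2 : (4 * n - 5 : ℂ) ≠ 0 := by
      have : (4 * n - 5 : ℤ) ≠ 0 := by omega
      exact_mod_cast this
    rw [eq_div_iff (mul_ne_zero h1 h2), h]
  · have h := character_image_dualLattice (l := 8) (by norm_num)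
    refine ⟨?_, h, linearIndependent_e4_eight, solutionSpace_eight_eq_span_e4⟩
    rw [characterSpace, h, solutionSpace_eight_eq_span_theta]
  · have h := character_image_dualLattice (l := 20) (by norm_num)
    refine ⟨?_, h, linearIndependent_theta_twenty, solutionSpace_twenty_eq_span_theta⟩
    rw [characterSpace, h, solutionSpace_twenty_eq_span_theta]
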